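/- Let $\Sigma=\mathbb D^2\setminus\{p_1,\dots,p_n\}$ be a disk with $n>1$ punctures, let $L$ be an oriented link in $\Sigma\times[0,1]$, let $D\subset\Sigma$ be a diagram of $L$ with ordered crossings, obtained by a regular projection, and let $K$ be a field (for instance $\mathbb Q$). Choose a puncture $p$, and let $A=\mathbb D^2\setminus\{p\}$ be the annulus obtained from $\Sigma$ by filling in every puncture except $p$. Let $(\mathrm{CKh}(D),\partial)$ be the Khovanov complex of $D$ over $K$, with basis the enhanced states $x=\{(C_i,s_i)\}_i$ (a complete resolution of $D$ into circles $C_i$ with signs $s_i=\pm1$), and with its homological grading $h$ and quantum grading $q$. Put $g^\Sigma(x)=\sum_i s_i[C_i]\in H_1(\Sigma;\mathbb Z)=\mathbb Z^n$, where the circles are oriented counterclockwise, $H_1(\Sigma;\mathbb Z)$ has the basis of positively oriented loops around the punctures, and $\mathbb Z^n$ has the product partial order; let $g^A(x)\in H_1(A;\mathbb Z)=\mathbb Z$ be defined in the same way, and let $\epsilon:\mathbb Z^n\to\mathbb Z$ be the sum of the coordinates. Then $\partial$ is a differential of bidegree $(1,0)$ that respects the filtrations $\mathcal F^\Sigma$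 and $\mathcal F^A$ induced by $g^\Sigma$ and $g^A$. Let $$\mathrm{MKh}(L\subset\Sigma\times[0,1])=\bigoplus_{h,q,v}\mathrm{MKh}^{h,q,v},\quad v\in\mathbb Z^n,\qquad\text{and}\qquad \mathrm{AKh}(L\subset A\times[0,1])=\bigoplus_{h,q}\mathrm{AKh}^{h,q}$$ be the homologies of the associated graded complexes of $\mathrm{CKh}(D)$ with respect to $\mathcal F^\Sigma$ and $\mathcal F^A$. Then there is a spectral sequence of $K$-vector spaces $E_r^{a,h,q}$, $r\ge1$, with differentials $d_r:E_r^{a,h,q}\to E_r^{a-r,h+1,q}$, whose first page is $\mathrm{MKh}$ with flattened grading, $$E_1^{a,h,q}\;\cong\;\bigoplus_{v\in\mathbb Z^n,\ \epsilon(v)=a}\mathrm{MKh}^{h,q,v}(L\subset\Sigma\times[0,1]),$$ and which converges to $\mathrm{AKh}(L\subset A\times[0,1])$: from some page on all differentials vanish, and $E_\infty^{a,h,q}\cong G_a\mathrm{AKh}^{h,q}/G_{a-1}\mathrm{AKh}^{h,q}$, where $G$ is the finite increasing filtration of $\mathrm{AKh}^{h,q}$ induced by the filtration of $\mathrm{CKh}(D)$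 by $\epsilon\circ g^\Sigma$. -/

import Mathlib

open CategoryTheory
open scoped ContDiff DirectSum ComplexConjugate

universe u

noncomputable section

namespace PuncturedKhovanov

/-! ### Links in thickened punctured disks and their diagrams -/

/-- The closed unit disk in the oriented plane `ℂ` with `n` distinct interior punctures. -/
structure PuncturedDisk (n : ℕ) where
  puncture : Fin n → ℂ
  injective : Function.Injective puncture
  mem_disk : ∀ i, puncture i ∈ Metric.ball (0 : ℂ) 1

/-- The surface underlying an `n`-punctured disk. -/
def PuncturedDisk.carrier {n : ℕ} (P : PuncturedDisk n) : Set ℂ :=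
  Metric.closedBall 0 1 \ Set.range P.puncture

/-- The annulus obtained from the closed unit disk by removing the single point `z`. -/
def annulus (z : ℂ) : Set ℂ := Metric.closedBall 0 1 \ {z}

lemma PuncturedDisk.carrier_subset_annulus {n : ℕ} (P : PuncturedDisk n) (p : Fin n) :
    P.carrier ⊆ annulus (P.puncture p) := fun _ hz =>
  ⟨hz.1, fun h => hz.2 ⟨p, (Set.mem_singleton_iff.mp h).symm⟩⟩

/-- An oriented link in `U × [0,1]`: a smooth embedding of finitely many circles `ℝ / ℤ`, each given
by a `1`-periodic parametrization `t ↦ (proj i t, height i t)`.  (An injective immersion of a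
compact manifold is an embedding.) -/
structure Link (U : Set ℂ) where
  numComponents : ℕ
  proj : Fin numComponents → ℝ → ℂ
  height : Fin numComponents → ℝ → ℝ
  proj_smooth : ∀ i, ContDiff ℝ ∞ (proj i)
  height_smooth : ∀ i, ContDiff ℝ ∞ (height i)
  proj_periodic : ∀ i, Function.Periodic (proj i) 1
  height_periodic : ∀ i, Function.Periodic (height i) 1
  immersion : ∀ i t, deriv (proj i) t ≠ 0 ∨ deriv (height i) t ≠ 0
  injective : ∀ i j s t, proj i s = proj j t → height i s = height j t →
    i = j ∧ ∃ k : ℤ, t = s + k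
  proj_mem : ∀ i t, proj i t ∈ U
  height_mem : ∀ i t, height i t ∈ Set.Icc (0 : ℝ) 1

/-- A link in `U × [0,1]`, viewed as a link in `V × [0,1]` for a larger surface `V`. -/
def Link.inclusion {U V : Set ℂ} (h : U ⊆ V) (L : Link U) : Link V :=
  { L with proj_mem := fun i t => h (L.proj_mem i t) }

/-- The link diagram obtained by projecting `L` to the surface, where the projection is assumed to
be regular (an immersion whose only multiple points are finitely many transverse double points),
together with an ordering of its `crossings` many crossings.

The two passages of the link through the crossing `c` are `(c, true)`, the over-strand, and
`(c, false)`, the under-strand; the passage `s` happens on the component `comp s` at the parameter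
`time s`.  Travelling along the link from the passage `s`, the first passage that is met is
`next s`, at the parameter `arrival s`; these two fields are determined by the other ones. -/
structure Diagram {U : Set ℂ} (L : Link U) where
  immersed : ∀ i t, deriv (L.proj i) t ≠ 0
  crossings : ℕ
  comp : Fin crossings × Bool → Fin L.numComponents
  time : Fin crossings × Bool → ℝ
  time_mem : ∀ s, time s ∈ Set.Ico (0 : ℝ) 1
  strand_injective : Function.Injective fun s => (comp s, time s)
  double_point : ∀ c, L.proj (comp (c, true)) (time (c, true)) =
    L.proj (comp (c, false)) (time (c, false))
  over_above_under : ∀ c, L.height (comp (c, false)) (time (c, false)) <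
    L.height (comp (c, true)) (time (c, true))
  all_double_points : ∀ i j, ∀ s ∈ Set.Ico (0 : ℝ) 1, ∀ t ∈ Set.Ico (0 : ℝ) 1,
    L.proj i s = L.proj j t → (i, s) ≠ (j, t) →
      ∃ c b, (comp (c, b), time (c, b)) = (i, s) ∧ (comp (c, !b), time (c, !b)) = (j, t)
  transverse : ∀ c, (conj (deriv (L.proj (comp (c, true))) (time (c, true))) *
    deriv (L.proj (comp (c, false))) (time (c, false))).im ≠ 0
  next : Equiv.Perm (Fin crossings × Bool)
  arrival : Fin crossings × Bool → ℝ
  comp_next : ∀ s, comp (next s) = comp s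
  time_lt_arrival : ∀ s, time s < arrival s
  arrival_eq : ∀ s, ∃ k : ℤ, arrival s = time (next s) + k
  arrival_le : ∀ s s', comp s' = comp s → ∀ k : ℤ, time s < time s' + k → arrival s ≤ time s' + k

namespace Diagram

/-- A diagram in a surface, viewed as a diagram in a larger surface. -/
def inclusion {U V : Set ℂ} (h : U ⊆ V) {L : Link U} (D : Diagram L) :
    Diagram (L.inclusion h) :=
  { D with }

variable {U : Set ℂ} {L : Link U} (D : Diagram L)

/-- The crossing `c` is positive: the direction of the under-strand lies counterclockwise (by less
than a half turn) from the direction of the over-strand. -/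
def Positive (c : Fin D.crossings) : Prop :=
  0 < (conj (deriv (L.proj (D.comp (c, true))) (D.time (c, true))) *
    deriv (L.proj (D.comp (c, false))) (D.time (c, false))).im

/-- The number of positive crossings. -/
def nPos : ℕ := Nat.card {c // D.Positive c}

/-- The number of negative crossings. -/
def nNeg : ℕ := Nat.card {c // ¬ D.Positive c}

/-- The writhe. -/
def writhe : ℤ := D.nPos - D.nNeg

/-! ### Resolutions -/

/-- The edges of the diagram: for each passage `s` the arc of the link from `s` to `next s`, and the
components of the link which meet no crossing. -/
abbrev Edge : Type :=
  (Fin D.crossings × Bool) ⊕ {i : Fin L.numComponents // ∀ s, D.comp s ≠ i}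

/-- A choice of `0`-resolution (`false`) or `1`-resolution (`true`) at each crossing. -/
abbrev Resolution : Type := Fin D.crossings → Bool

/-- The `0`-resolution of a positive crossing and the `1`-resolution of a negative crossing are the
ones that respect the orientation. -/
def OrientedAt (S : D.Resolution) (c : Fin D.crossings) : Prop :=
  S c = false ↔ D.Positive c

open Classical in
/-- Walking along the resolved diagram: an edge traversed forwards (`true`) or backwards (`false`) is
followed by an edge with a direction of traversal.  An orientation-respecting resolution joins the
incoming edge of either strand to the outgoing edge of the other strand; the other resolution joins
the two incoming edges to each other, and the two outgoing edges to each other. -/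
def walk (S : D.Resolution) : D.Edge × Bool → D.Edge × Bool
  | (Sum.inl s, true) =>
      let t : Fin D.crossings × Bool := ((D.next s).1, !(D.next s).2)
      if D.OrientedAt S t.1 then (Sum.inl t, true) else (Sum.inl (D.next.symm t), false)
  | (Sum.inl s, false) =>
      let t : Fin D.crossings × Bool := (s.1, !s.2)
      if D.OrientedAt S t.1 then (Sum.inl (D.next.symm t), false) else (Sum.inl t, true)
  | (Sum.inr i, b) => (Sum.inr i, b)

/-- The circles of the resolved diagram `D(S)`: edges are identified when one follows the other. -/
def Circle (S : D.Resolution) : Type :=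
  Quot fun e f : D.Edge => ∃ b b', D.walk S (e, b) = (f, b')

/-- The circle of `D(S)` containing the edge `e`. -/
def circleOf (S : D.Resolution) (e : D.Edge) : D.Circle S := Quot.mk _ e

instance (S : D.Resolution) : Finite (D.Circle S) :=
  inferInstanceAs (Finite (Quot _))

instance (S : D.Resolution) : Fintype (D.Circle S) := Fintype.ofFinite _

/-- The change of the argument around `z` along an edge, in the form `∫ dw / (w - z)`. -/
def edgeIntegral (z : ℂ) : D.Edge → ℂ
  | Sum.inl s => ∫ t in (D.time s)..(D.arrival s),
      deriv (L.proj (D.comp s)) t / (L.proj (D.comp s) t - z)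
  | Sum.inr i => ∫ t in (0 : ℝ)..1, deriv (L.proj i.1) t / (L.proj i.1 t - z)

open Classical in
/-- The winding number around `z` of the circle of `D(S)` through `e`, traversed in the direction in
which `e` is traversed forwards.  It is an integer, being `(2πi)⁻¹ ∫ dw / (w - z)` over a closed
curve, so that rounding only changes its type. -/
def winding (z : ℂ) (S : D.Resolution) (e : D.Edge) : ℤ :=
  round ((∑ d : D.Edge × Bool with ∃ k : ℕ, (D.walk S)^[k] (e, true) = d,
    (if d.2 then D.edgeIntegral z d.1 else - D.edgeIntegral z d.1)) /
      (2 * Real.pi * Complex.I)).re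

/-- The coefficient at the puncture `z` of the homology class of a circle of `D(S)`, with respect to
the basis of positively oriented loops around the punctures.  Circles, being simple closed curves,
are oriented counterclockwise, that is, so that all winding numbers are nonnegative. -/
def circleClass (z : ℂ) (S : D.Resolution) (C : D.Circle S) : ℤ :=
  |D.winding z S (Quot.out C)|

/-! ### The Khovanov complex -/

/-- Enhanced Kauffman states: a resolution and a labelling of its circles by signs. -/
abbrev State : Type := Σ S : D.Resolution, D.Circle S → ℤˣ

instance : Fintype D.State := Fintype.ofFinite _

/-- The sign of an edge of the diagram in an enhanced state. -/
def label (x : D.State) (e : D.Edge) : ℤˣ := x.2 (D.circleOf x.1 e)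

/-- The number of `1`-resolutions. -/
def weight (S : D.Resolution) : ℕ := Nat.card {c // S c = true}

/-- The homological grading. -/
def hDegree (x : D.State) : ℤ := D.weight x.1 - D.nNeg

/-- The quantum grading. -/
def qDegree (x : D.State) : ℤ :=
  ∑ C, (x.2 C : ℤ) + (D.weight x.1 - D.nNeg + D.writhe)

/-- The grading around a point `z`: the sum over the circles of the sign times the homology class. -/
def gradingAt (z : ℂ) (x : D.State) : ℤ :=
  ∑ C, (x.2 C : ℤ) * D.circleClass z x.1 C

variable (K : Type u) [Field K]

open Classical in
/-- The matrix coefficient of the multiplication `V ⊗ V → V` from `v_a ⊗ v_b` to `v_c`. -/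
def mergeCoeff (a b c : ℤˣ) : K :=
  if (a = 1 ∧ b = 1 ∧ c = 1) ∨ (a = 1 ∧ b = -1 ∧ c = -1) ∨ (a = -1 ∧ b = 1 ∧ c = -1)
  then 1 else 0

open Classical in
/-- The matrix coefficient of the comultiplication `V → V ⊗ V` from `v_a` to `v_b ⊗ v_c`. -/
def splitCoeff (a b c : ℤˣ) : K :=
  if (a = 1 ∧ b = 1 ∧ c = -1) ∨ (a = 1 ∧ b = -1 ∧ c = 1) ∨ (a = -1 ∧ b = -1 ∧ c = -1)
  then 1 else 0

open Classical in
/-- The matrix coefficient from `x` to `y` of the map `CKh(D(S)) → CKh(D(S'))`, where `S'` is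
obtained from `S` by changing the resolution of the crossing `c` from `0` to `1`.  In both
resolutions, the two strands near `c` are those of the edge `e` leaving `c` on the over-strand and
of the edge `f` arriving at `c` on the over-strand. -/
def cubeCoeff (c : Fin D.crossings) (x y : D.State) : K :=
  let e : D.Edge := Sum.inl (c, true)
  let f : D.Edge := Sum.inl (D.next.symm (c, true))
  if ∀ g, D.circleOf x.1 g ≠ D.circleOf x.1 e → D.circleOf x.1 g ≠ D.circleOf x.1 f →
      D.label y g = D.label x g then
    if D.circleOf x.1 e ≠ D.circleOf x.1 f ∧ D.circleOf y.1 e = D.circleOf y.1 f then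
      mergeCoeff K (D.label x e) (D.label x f) (D.label y e)
    else if D.circleOf x.1 e = D.circleOf x.1 f ∧ D.circleOf y.1 e ≠ D.circleOf y.1 f then
      splitCoeff K (D.label x e) (D.label y e) (D.label y f)
    else 0
  else 0

open Classical in
/-- The matrix coefficient from `x` to `y` of the Khovanov differential.  At most one summand is
nonzero; its sign is `-1` to the number of `1`-resolutions preceding the changed crossing. -/
def diffCoeff (x y : D.State) : K :=
  ∑ c, if x.1 c = false ∧ y.1 = Function.update x.1 c true then
    (-1) ^ Nat.card {c' // c' < c ∧ x.1 c' = true} * D.cubeCoeff K c x y else 0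

/-- The module underlying the Khovanov complex: enhanced states form a basis. -/
abbrev CKh : Type u := D.State →₀ K

/-- The Khovanov differential. -/
def differential : D.CKh K →ₗ[K] D.CKh K :=
  Finsupp.linearCombination K fun x => ∑ y, Finsupp.single y (D.diffCoeff K x y)

/-- The graded piece of homological degree `h` and quantum degree `q`. -/
def piece (h q : ℤ) : Submodule K (D.CKh K) :=
  Finsupp.supported K K {x | D.hDegree x = h ∧ D.qDegree x = q}

/-- The filtration of the Khovanov complex induced by a grading of the enhanced states. -/
def filtration {P : Type*} [PartialOrder P] (g : D.State → P) (a : P) : Submodule K (D.CKh K) :=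
  Finsupp.supported K K {x | g x ≤ a}

end Diagram

/-! ### Filtered complexes -/

section Algebra

variable {K : Type u} [Field K] {M : Type u} [AddCommGroup M] [Module K M]
  {P : Type*} [PartialOrder P]

/-- A module `M` with bigraded pieces `M^{h,q}` and a filtration `F` by a poset is a filtered complex
with differential `d`: the square of `d` is zero, `d` has bidegree `(1, 0)`, and `d` respects `F`. -/
structure IsFilteredComplex (d : M →ₗ[K] M) (piece : ℤ → ℤ → Submodule K M)
    (F : P → Submodule K M) : Prop where
  sq_zero : d ∘ₗ d = 0
  degree : ∀ h q, piece h q ≤ (piece (h + 1) q).comap d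
  monotone : Monotone F
  filtered : ∀ a, F a ≤ (F a).comap d

/-- The graded piece `F_a / ∑_{b < a} F_b` of a filtration by a poset. -/
abbrev Gr (F : P → Submodule K M) (a : P) : Type u :=
  ↥(F a) ⧸ (⨆ b, ⨆ (_ : b < a), F b).submoduleOf (F a)

/-- The map induced on `gr_a` by a filtered endomorphism. -/
def grMap (F : P → Submodule K M) (d : M →ₗ[K] M) (hd : ∀ a, F a ≤ (F a).comap d) (a : P) :
    Gr F a →ₗ[K] Gr F a :=
  Submodule.mapQ _ _ (d.restrict (hd a)) <| by
    have key : (⨆ b, ⨆ (_ : b < a), F b) ≤ (⨆ b, ⨆ (_ : b < a), F b).comap d :=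
      iSup₂_le fun b hb => (hd b).trans
        (Submodule.comap_mono (le_iSup₂ (f := fun b (_ : b < a) => F b) b hb))
    exact fun x hx => key hx

/-- The submodule of `gr_a` induced by a submodule `N` of `M`: the image of `N ∩ F_a`. -/
def grSub (F : P → Submodule K M) (a : P) (N : Submodule K M) : Submodule K (Gr F a) :=
  (N.submoduleOf (F a)).map (Submodule.mkQ _)

/-- The homology, at the graded piece `M₁`, of a differential `d` mapping the graded piece `M₀` to
the graded piece `M₁`: cycles in `M₁` modulo `d M₀`. -/
abbrev Homology (d : M →ₗ[K] M) (M₀ M₁ : Submodule K M) : Type u :=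
  ↥(M₁ ⊓ LinearMap.ker d) ⧸ (M₀.map d).submoduleOf (M₁ ⊓ LinearMap.ker d)

/-- The submodule of the homology of the classes that are represented by a cycle in `N`. -/
def homologySub (d : M →ₗ[K] M) (M₀ M₁ N : Submodule K M) : Submodule K (Homology d M₀ M₁) :=
  (N.submoduleOf (M₁ ⊓ LinearMap.ker d)).map (Submodule.mkQ _)

/-- The homology in bidegree `(h, q)` of the graded piece `gr_a` of a filtered complex. -/
abbrev GrHomology {d : M →ₗ[K] M} {piece : ℤ → ℤ → Submodule K M} {F : P → Submodule K M}
    (hF : IsFilteredComplex d piece F) (h q : ℤ) (a : P) : Type u :=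
  Homology (grMap F d hF.filtered a) (grSub F a (piece (h - 1) q)) (grSub F a (piece h q))

/-- The submodule of the direct sum of the `N i` consisting of the elements with components in
`G i`. -/
def directSumSub {ι : Type} {N : ι → Type u} [∀ i, AddCommGroup (N i)] [∀ i, Module K (N i)]
    (G : ∀ i, Submodule K (N i)) : Submodule K (⨁ i, N i) :=
  ⨅ i, (G i).comap (DirectSum.component K ι N i)

/-- Spectral sequences of `K`-vector spaces, starting at the first page, whose terms are indexed by
the filtration degree, the homological degree and the quantum degree.  As filtrations are increasing
and differentials raise the homological degree, the differential of the `r`-th page has degree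
`(-r, 1, 0)`. -/
abbrev TrigradedSpectralSequence (K : Type u) [Field K] :=
  SpectralSequence (ModuleCat.{u} K) (fun r => ComplexShape.up' ((-r, 1, 0) : ℤ × ℤ × ℤ)) 1

/-- The spectral sequence `E` converges to `H`, where `H` carries the filtration `G`: the filtration
is increasing and finite, and from some page on all differentials vanish and the pages, which are
then all isomorphic to `E_∞`, are isomorphic to the associated graded of `H`. -/
structure ConvergesTo (E : TrigradedSpectralSequence K) (H : ℤ → ℤ → Type u)
    [∀ h q, AddCommGroup (H h q)] [∀ h q, Module K (H h q)]
    (G : ∀ h q, ℤ → Submodule K (H h q)) : Prop where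
  monotone : ∀ h q, Monotone (G h q)
  eventually_bot : ∀ h q, ∃ a, G h q a = ⊥
  eventually_top : ∀ h q, ∃ a, G h q a = ⊤
  degenerates : ∃ R : ℤ, 1 ≤ R ∧ ∀ (r : ℤ) (hr : 1 ≤ r), R ≤ r →
    (∀ i j, (E.page r hr).d i j = 0) ∧
    ∀ a h q, Nonempty ((E.page r hr).X (a, h, q) ≃ₗ[K]
      (↥(G h q a) ⧸ (G h q (a - 1)).submoduleOf (G h q a)))

end Algebra

/-! ### Multipunctured and annular Khovanov homology -/

section Homologies

variable (K : Type u) [Field K] {n : ℕ} {P : PuncturedDisk n}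

/-- The grading of the enhanced states by `H₁(Σ; ℤ) = ℤⁿ`, with the product partial order. -/
def multiGrading (P : PuncturedDisk n) {U : Set ℂ} {L : Link U} (D : Diagram L) (x : D.State) :
    Fin n → ℤ :=
  fun i => D.gradingAt (P.puncture i) x

/-- The sum of the components of the multipunctured grading. -/
def flatGrading (P : PuncturedDisk n) {U : Set ℂ} {L : Link U} (D : Diagram L) (x : D.State) : ℤ :=
  ∑ i, multiGrading P D x i

/-- The Khovanov complex with the `ℤⁿ`-filtration of the punctured disk is a filtered complex. -/
abbrev IsMultiFiltered {L : Link P.carrier} (D : Diagram L) : Prop :=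
  IsFilteredComplex (D.differential K) (D.piece K) (D.filtration K (multiGrading P D))

/-- Multipunctured Khovanov homology in homological degree `h`, quantum degree `q` and
multipunctured degree `v`. -/
abbrev MKh {L : Link P.carrier} (D : Diagram L) (hD : IsMultiFiltered K D) (h q : ℤ)
    (v : Fin n → ℤ) : Type u :=
  GrHomology hD h q v

/-- Multipunctured Khovanov homology with flattened grading: the sum of the graded pieces whose
multipunctured degree has components adding up to `a`. -/
abbrev FlatMKh {L : Link P.carrier} (D : Diagram L) (hD : IsMultiFiltered K D) (a h q : ℤ) :
    Type u :=
  ⨁ v : {v : Fin n → ℤ // ∑ i, v i = a}, MKh K D hD h q v.1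

variable {z : ℂ}

/-- The Khovanov complex with the `ℤ`-filtration of the annulus is a filtered complex. -/
abbrev IsAnnularFiltered {L : Link (annulus z)} (D : Diagram L) : Prop :=
  IsFilteredComplex (D.differential K) (D.piece K) (D.filtration K (D.gradingAt z))

/-- Annular Khovanov homology in homological degree `h` and quantum degree `q`, as the direct sum
of the homologies of the graded pieces of the annular filtration. -/
abbrev AKh {L : Link (annulus z)} (D : Diagram L) (hD : IsAnnularFiltered K D) (h q : ℤ) : Type u :=
  ⨁ k : ℤ, GrHomology hD h q k

/-- The filtration of annular Khovanov homology induced by the `ℤ`-filtration of the Khovanov complex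
by the flattened multipunctured grading. -/
def flatFiltrationAKh (P : PuncturedDisk n) {L : Link (annulus z)} (D : Diagram L)
    (hD : IsAnnularFiltered K D) (h q : ℤ) (a : ℤ) : Submodule K (AKh K D hD h q) :=
  directSumSub fun k => homologySub _ _ _
    (grSub (D.filtration K (D.gradingAt z)) k (D.filtration K (flatGrading P D) a))

end Homologies

end PuncturedKhovanov

end

/-! Split the Khovanov differential `∂` by filtration degree. Let `∂_A` be the part that preserves
`g^A` and `∂_Σ` the part that preserves `g^Σ`. A filtration induced by a grading of a basis has a
canonical splitting, so the homologies of the graded pieces add up to the homology of the degree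
preserving part (`exists_grHomology_equiv`). Thus `AKh` is the homology of `∂_A`, and `MKh` is the
homology of `∂_Σ`.

The map `∂_A` still does not raise `f = ε ∘ g^Σ`. Filtering `(CKh, ∂_A)` by `f` therefore gives a
spectral sequence. It converges to the homology of `∂_A`, because there are finitely many states and
so `f` is bounded (`convergesTo_spectralSequence`). Its first page is the homology of the part of
`∂_A` that preserves `f` (`firstPageEquiv`). Since `∂` raises no coordinate of `g^Σ`, a term that
preserves the sum of the coordinates preserves each of them, in particular the one at `p`, which is
`g^A`. So this part is `∂_Σ` (`gradedPart_flat`), and the first page is `MKh`, with all `v` of sum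
`a` collected.

It remains to see that `∂` is a filtered differential. The diagram is given analytically, and
planarity must be extracted from the regular projection. What is needed is that changing a
resolution merges two circles or splits one (`merge_or_split`); for virtual diagrams this fails. It
follows from a source-sink orientation of the edges (`exists_alternating`), found as the parity of a
winding number: that of the product of all components around a point moving along a strand, which
jumps by one at each crossing. With this orientation the circles of a resolution are the cycles of a
permutation of the edges, and changing a crossing multiplies the permutation by a transposition.

For `∂² = 0`, the edge maps of the cube commute with multiplication by the negative generator on the
circle of any edge. Hence the faces need only be checked on states with all signs positive
(`cubeMap_comm`).

For the filtrations, winding numbers taken along the source-sink orientation add up when circles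
merge, while the class of a circle is their absolute value. The grading does not increase by the
triangle inequality (`gradingAt_le_of_diffCoeff_ne_zero`). -/

noncomputable section

namespace PuncturedKhovanov

section Planarity

open Filter Topology

/-! ### Winding numbers of loops in the punctured plane -/

/-- `L` is a logarithm of the `1`-periodic function `φ`, which winds `m` times around the origin. -/
def HasWinding (φ : ℝ → ℂ) (m : ℤ) : Prop :=
  ∃ L : ℝ → ℂ, Continuous L ∧ (∀ t, Complex.exp (L t) = φ t) ∧
    ∀ t, L (t + 1) = L t + m * (2 * Real.pi * Complex.I)

lemma exists_continuous_log {φ : ℝ → ℂ} (hφ : Continuous φ) (h0 : ∀ t, φ t ≠ 0) :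
    ∃ L : ℝ → ℂ, Continuous L ∧ ∀ t, Complex.exp (L t) = φ t := by
  have huniv : IsSimplyConnected (Set.univ : Set ℝ) :=
    (Homeomorph.Set.univ ℝ).toHomotopyEquiv.simplyConnectedSpace
  obtain ⟨L, hL, h⟩ := Complex.exists_continuousOn_eqOn_exp_comp huniv isOpen_univ
    hφ.continuousOn (by simpa using h0)
  exact ⟨L, continuousOn_univ.mp hL, fun t => h (Set.mem_univ t)⟩

/-- A continuous function on the line with values in the discrete set `2πiℤ` is constant. Both
existence and uniqueness of winding numbers rest on this. -/
lemma eq_const_of_exp_eq_one {G : ℝ → ℂ} (hG : Continuous G) (h : ∀ t, Complex.exp (G t) = 1) :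
    ∃ k : ℤ, ∀ t, G t = k * (2 * Real.pi * Complex.I) := by
  have h2 : ∀ t, ∃ k : ℤ, G t = k * (2 * Real.pi * Complex.I) := fun t =>
    Complex.exp_eq_one_iff.mp (h t)
  choose k hk using h2
  have hpi : (Real.pi : ℝ) ≠ 0 := Real.pi_ne_zero
  have hc : Continuous k := by
    rw [Int.isClosedEmbedding_coe_real.isEmbedding.continuous_iff]
    have : ((fun n : ℤ => (n : ℝ)) ∘ k) = fun t => (G t).im / (2 * Real.pi) := by
      funext t
      have := congrArg Complex.im (hk t)
      simp at this
      simp [this]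
    exact this ▸ (by fun_prop)
  exact ⟨k 0, fun t => by
    rw [hk t, (IsLocallyConstant.iff_continuous k).mpr hc |>.apply_eq_of_preconnectedSpace t 0]⟩

lemma HasWinding.exists {φ : ℝ → ℂ} (hφ : Continuous φ) (h0 : ∀ t, φ t ≠ 0)
    (hp : ∀ t, φ (t + 1) = φ t) : ∃ m, HasWinding φ m := by
  obtain ⟨L, hL, h⟩ := exists_continuous_log hφ h0
  obtain ⟨k, hk⟩ := eq_const_of_exp_eq_one (G := fun t => L (t + 1) - L t) (by fun_prop)
    (fun t => by rw [Complex.exp_sub, h, h, hp, div_self (h0 t)])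
  exact ⟨k, L, hL, h, fun t => by rw [← hk t]; ring⟩

lemma HasWinding.unique {φ : ℝ → ℂ} {m n : ℤ} (hm : HasWinding φ m) (hn : HasWinding φ n) :
    m = n := by
  obtain ⟨L, hL, h, h1⟩ := hm
  obtain ⟨L', hL', h', h1'⟩ := hn
  obtain ⟨k, hk⟩ := eq_const_of_exp_eq_one (G := fun t => L t - L' t) (by fun_prop)
    (fun t => by rw [Complex.exp_sub, h, h', div_self (h' t ▸ Complex.exp_ne_zero _)])
  have e0 := hk 0
  have e1 := hk (0 + 1)
  simp only [h1, h1'] at e1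
  have : ((m : ℂ) - n) * (2 * Real.pi * Complex.I) = 0 := by linear_combination e1 - e0
  have h3 : ((m : ℂ) - n) = 0 := (mul_eq_zero.mp this).resolve_right Complex.two_pi_I_ne_zero
  exact_mod_cast sub_eq_zero.mp h3

lemma HasWinding.mul {φ ψ : ℝ → ℂ} {m n : ℤ} (hm : HasWinding φ m) (hn : HasWinding ψ n) :
    HasWinding (fun t => φ t * ψ t) (m + n) := by
  obtain ⟨L, hL, h, h1⟩ := hm
  obtain ⟨L', hL', h', h1'⟩ := hn
  exact ⟨fun t => L t + L' t, by fun_prop, fun t => by rw [Complex.exp_add, h, h'],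
    fun t => by simp only [h1, h1']; push_cast; ring⟩

lemma hasWinding_const {c : ℂ} (hc : c ≠ 0) : HasWinding (fun _ => c) 0 :=
  ⟨fun _ => Complex.log c, by fun_prop, fun _ => Complex.exp_log hc, fun _ => by simp⟩

/-- The principal logarithm of the quotient is continuous and periodic, so adding it to a logarithm
of `ψ` gives one of `φ` with the same increment. All comparisons of winding numbers below are of
this Rouché type. -/
lemma HasWinding.of_div_mem_slitPlane {φ ψ : ℝ → ℂ} {m : ℤ} (h : HasWinding ψ m)
    (hφ : Continuous φ) (hψ : Continuous ψ) (hφp : ∀ t, φ (t + 1) = φ t)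
    (hψp : ∀ t, ψ (t + 1) = ψ t) (hs : ∀ t, φ t / ψ t ∈ Complex.slitPlane) : HasWinding φ m := by
  obtain ⟨L, hL, h, h1⟩ := h
  have hψ0 : ∀ t, ψ t ≠ 0 := fun t => h t ▸ Complex.exp_ne_zero _
  refine ⟨fun t => L t + Complex.log (φ t / ψ t), ?_, fun t => ?_, fun t => ?_⟩
  · exact hL.add ((hφ.div hψ hψ0).clog hs)
  · rw [Complex.exp_add, h, Complex.exp_log (Complex.slitPlane_ne_zero (hs t)),
      mul_div_cancel₀ _ (hψ0 t)]
  · simp only [h1, hφp, hψp]; ring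

lemma exp_two_pi_add_one (τ : ℝ) : Complex.exp (2 * Real.pi * Complex.I * ((τ + 1 : ℝ) : ℂ)) =
    Complex.exp (2 * Real.pi * Complex.I * τ) := by
  push_cast
  rw [mul_add, mul_one, Complex.exp_add, Complex.exp_two_pi_mul_I, mul_one]

lemma norm_exp_two_pi (τ : ℝ) : ‖Complex.exp (2 * Real.pi * Complex.I * τ)‖ = 1 := by
  rw [Complex.norm_exp]; simp

lemma one_sub_mem_slitPlane {w : ℂ} (hw : ‖w‖ < 1) : 1 - w ∈ Complex.slitPlane := by
  refine Complex.mem_slitPlane_of_norm_lt_one (z := -w) (by simpa using hw) |> fun h => ?_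
  simpa [sub_eq_add_neg] using h

lemma hasWinding_circle_inside {ζ : ℂ} (hζ : ‖ζ‖ < 1) :
    HasWinding (fun τ => Complex.exp (2 * Real.pi * Complex.I * τ) - ζ) 1 := by
  have h1 : HasWinding (fun τ => Complex.exp (2 * Real.pi * Complex.I * τ)) 1 :=
    ⟨fun τ => 2 * Real.pi * Complex.I * τ, by fun_prop, fun _ => rfl, fun τ => by
      push_cast; ring⟩
  refine h1.of_div_mem_slitPlane (by fun_prop) (by fun_prop)
    (fun τ => by rw [exp_two_pi_add_one]) exp_two_pi_add_one fun τ => ?_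
  rw [sub_div, div_self (Complex.exp_ne_zero _)]
  exact one_sub_mem_slitPlane (by rw [norm_div, norm_exp_two_pi, div_one]; exact hζ)

lemma hasWinding_circle_outside {ζ : ℂ} (hζ : 1 < ‖ζ‖) :
    HasWinding (fun τ => Complex.exp (2 * Real.pi * Complex.I * τ) - ζ) 0 := by
  have h0 : ζ ≠ 0 := fun h => by simp [h] at hζ; linarith
  refine (hasWinding_const (neg_ne_zero.mpr h0)).of_div_mem_slitPlane (by fun_prop) (by fun_prop)
    (fun τ => by rw [exp_two_pi_add_one]) (fun _ => rfl) fun τ => ?_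
  have : (Complex.exp (2 * Real.pi * Complex.I * τ) - ζ) / (-ζ) =
      1 - Complex.exp (2 * Real.pi * Complex.I * τ) / ζ := by field_simp; ring
  rw [this]
  refine one_sub_mem_slitPlane ?_
  rw [norm_div, norm_exp_two_pi]
  exact (div_lt_one (by linarith)).mpr hζ

/-- The winding number is locally constant in families of loops. -/
lemma eventually_hasWinding {Φ : ℝ → ℝ → ℂ} {t₀ : ℝ}
    (hc : ∀ τ, ContinuousAt (fun p : ℝ × ℝ => Φ p.1 p.2) (t₀, τ))
    (hs : ∀ᶠ t in 𝓝 t₀, Continuous (Φ t)) (hp : ∀ t τ, Φ t (τ + 1) = Φ t τ)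
    {m : ℤ} (hm : HasWinding (Φ t₀) m) : ∀ᶠ t in 𝓝 t₀, HasWinding (Φ t) m := by
  have h0 : ∀ τ, Φ t₀ τ ≠ 0 := by
    obtain ⟨L, -, h, -⟩ := hm
    exact fun τ => h τ ▸ Complex.exp_ne_zero _
  have hs0 : Continuous (Φ t₀) := hs.self_of_nhds
  -- The quotient equals `1` at `t₀`; compactness of one period makes a single neighbourhood of `t₀`
  -- serve all `τ`.
  have key : ∀ᶠ t in 𝓝 t₀, ∀ τ ∈ Set.Icc (0 : ℝ) 1, Φ t τ / Φ t₀ τ ∈ Complex.slitPlane := by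
    refine isCompact_Icc.eventually_forall_of_forall_eventually fun τ _ => ?_
    have h1 : ContinuousAt (fun p : ℝ × ℝ => Φ p.1 p.2 / Φ t₀ p.2) (t₀, τ) :=
      (hc τ).div (hs0.continuousAt.comp continuousAt_snd) (h0 τ)
    refine h1.eventually_mem (Complex.isOpen_slitPlane.mem_nhds ?_)
    simp [div_self (h0 τ)]
  filter_upwards [hs, key] with t ht hk
  refine hm.of_div_mem_slitPlane ht hs0 (hp t) (hp t₀) fun τ => ?_
  have hfr : ∀ t, Function.Periodic (Φ t) 1 := hp
  have hper : Φ t τ / Φ t₀ τ = Φ t (Int.fract τ) / Φ t₀ (Int.fract τ) := by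
    have e : Int.fract τ = τ - ⌊τ⌋ * (1 : ℝ) := by rw [mul_one]; rfl
    rw [e, (hfr t).sub_int_mul_eq, (hfr t₀).sub_int_mul_eq]
  rw [hper]
  exact hk _ ⟨Int.fract_nonneg τ, (Int.fract_lt_one τ).le⟩

/-- The function `τ ↦ exp (2πiτ) - 1`, with simple zeros at the integers. -/
def circleSub (τ : ℝ) : ℂ := Complex.exp (2 * Real.pi * Complex.I * τ) - 1

lemma continuous_circleSub : Continuous circleSub := by unfold circleSub; fun_prop

lemma circleSub_add_one (τ : ℝ) : circleSub (τ + 1) = circleSub τ := by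
  rw [circleSub, exp_two_pi_add_one, circleSub]

lemma circleSub_eq_zero {τ : ℝ} : circleSub τ = 0 ↔ ∃ k : ℤ, τ = k := by
  rw [circleSub, sub_eq_zero, Complex.exp_eq_one_iff]
  refine exists_congr fun k => ?_
  rw [mul_comm, mul_left_inj' Complex.two_pi_I_ne_zero]
  exact ⟨fun h => by exact_mod_cast h, fun h => by rw [h]; simp⟩

lemma hasDerivAt_circleSub_zero : HasDerivAt circleSub (2 * Real.pi * Complex.I) 0 := by
  have h1 : HasDerivAt (fun τ : ℝ => 2 * Real.pi * Complex.I * (τ : ℂ)) (2 * Real.pi * Complex.I) 0 := by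
    simpa using (Complex.ofRealCLM.hasDerivAt (x := (0 : ℝ))).const_mul (2 * Real.pi * Complex.I)
  have h2 := h1.cexp.sub_const 1
  simp only [Complex.ofReal_zero, mul_zero, Complex.exp_zero, one_mul] at h2
  exact h2

/-- The model for a strand passing through the base point: the winding number of a circle through
the origin around a point which crosses it at the parameter `t = 0`. -/
def passModel (w v : ℂ) (t τ : ℝ) : ℂ :=
  v / (2 * Real.pi * Complex.I) * (Complex.exp (2 * Real.pi * Complex.I * τ) -
    (1 - 2 * Real.pi * Complex.I * w * t))

lemma passModel_zero (w v : ℂ) (τ : ℝ) :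
    passModel w v 0 τ = v / (2 * Real.pi * Complex.I) * circleSub τ := by
  simp [passModel, circleSub]

lemma continuous_passModel (w v : ℂ) : Continuous fun p : ℝ × ℝ => passModel w v p.1 p.2 := by
  unfold passModel; fun_prop

/-- The constants in `passModel` are chosen for this: its first-order behaviour at the origin is the
one assumed of the family in `hasWinding_jump`. -/
lemma hasFDerivAt_passModel (w v : ℂ) :
    HasFDerivAt (fun p : ℝ × ℝ => passModel w v p.1 p.2)
      ((ContinuousLinearMap.fst ℝ ℝ ℝ).smulRight (w * v) +
        (ContinuousLinearMap.snd ℝ ℝ ℝ).smulRight v) (0, 0) := by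
  have e : (fun p : ℝ × ℝ => passModel w v p.1 p.2) = fun p : ℝ × ℝ =>
      v / (2 * Real.pi * Complex.I) * circleSub p.2 + p.1 • (w * v) := by
    funext p
    have := Complex.two_pi_I_ne_zero
    simp only [passModel, circleSub, Complex.real_smul]
    field_simp
    ring
  rw [e]
  have h1 : HasFDerivAt (fun p : ℝ × ℝ => circleSub p.2)
      ((ContinuousLinearMap.snd ℝ ℝ ℝ).smulRight (2 * Real.pi * Complex.I)) (0, 0) := by
    have := HasFDerivAt.comp (0, 0) (g := circleSub) (f := fun p : ℝ × ℝ => p.2)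
      hasDerivAt_circleSub_zero.hasFDerivAt (hasFDerivAt_snd (𝕜 := ℝ) (E := ℝ) (F := ℝ) (p := (0, 0)))
    convert! this using 1
  have h2 : HasFDerivAt (fun p : ℝ × ℝ => p.1 • (w * v))
      ((ContinuousLinearMap.fst ℝ ℝ ℝ).smulRight (w * v)) (0, 0) :=
    ((ContinuousLinearMap.fst ℝ ℝ ℝ).smulRight (w * v)).hasFDerivAt
  convert! (h1.const_mul (v / (2 * Real.pi * Complex.I))).add h2 using 1
  rw [add_comm]
  congr 1
  ext <;> simp

/-- The linear term `t * w.im` decides on which side of the unit circle the point lies: outside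
whenever it is positive, inside for small `t` when it is negative. -/
lemma normSq_one_sub (w : ℂ) (t : ℝ) :
    Complex.normSq (1 - 2 * Real.pi * Complex.I * w * t) =
      1 + 4 * Real.pi * (t * w.im + t ^ 2 * (Real.pi * Complex.normSq w)) := by
  simp [Complex.normSq_apply]
  ring

lemma one_lt_norm_of_pos {w : ℂ} {t : ℝ} (h : 0 < t * w.im) :
    1 < ‖1 - 2 * Real.pi * Complex.I * w * t‖ := by
  rw [← one_lt_sq_iff₀ (norm_nonneg _), ← Complex.normSq_eq_norm_sq, normSq_one_sub]
  have := Complex.normSq_nonneg w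
  have : 0 ≤ t ^ 2 * (Real.pi * Complex.normSq w) := by positivity
  have := mul_pos (show (0 : ℝ) < 4 * Real.pi by positivity)
    (add_pos_of_pos_of_nonneg h this)
  linarith

lemma eventually_norm_lt_one_of_neg {w : ℂ} (hw : w.im ≠ 0) :
    ∀ᶠ t : ℝ in 𝓝 0, t * w.im < 0 → ‖1 - 2 * Real.pi * Complex.I * w * t‖ < 1 := by
  have hc : ContinuousAt (fun t : ℝ => |t| * (Real.pi * Complex.normSq w)) 0 := by fun_prop
  have h0 : |(0 : ℝ)| * (Real.pi * Complex.normSq w) < |w.im| := by simpa using hw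
  filter_upwards [hc.eventually_lt_const h0] with t ht hneg
  rw [← sq_lt_one_iff₀ (norm_nonneg _), ← Complex.normSq_eq_norm_sq, normSq_one_sub]
  have ht0 : t ≠ 0 := fun h => by simp [h] at hneg
  have h1 : t ^ 2 * (Real.pi * Complex.normSq w) < |t| * |w.im| := by
    rw [← sq_abs, pow_two, mul_assoc]
    exact mul_lt_mul_of_pos_left ht (abs_pos.mpr ht0)
  rw [← abs_mul, abs_of_neg hneg] at h1
  have := mul_pos (show (0 : ℝ) < 4 * Real.pi by positivity)
    (show 0 < -(t * w.im + t ^ 2 * (Real.pi * Complex.normSq w)) by linarith)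
  linarith

lemma passModel_ne_zero {w v : ℂ} (hv : v ≠ 0) {t : ℝ}
    (ht : ‖1 - 2 * Real.pi * Complex.I * w * t‖ ≠ 1) (τ : ℝ) : passModel w v t τ ≠ 0 := by
  refine mul_ne_zero (div_ne_zero hv Complex.two_pi_I_ne_zero) (sub_ne_zero.mpr fun h => ht ?_)
  rw [← h, norm_exp_two_pi]

/-- Since `w` is not real, `v` and `w * v` are linearly independent over `ℝ`. So the derivative at
the origin is injective, hence bounded below. -/
lemma isBigO_of_transverse {w v : ℂ} (hv : v ≠ 0) (hw : w.im ≠ 0) :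
    (fun p : ℝ × ℝ => p) =O[𝓝 0] fun p : ℝ × ℝ => passModel w v p.1 p.2 := by
  set A : ℝ × ℝ →L[ℝ] ℂ := (ContinuousLinearMap.fst ℝ ℝ ℝ).smulRight (w * v) +
        (ContinuousLinearMap.snd ℝ ℝ ℝ).smulRight v with hA
  have hd := (hasFDerivAt_passModel w v)
  have hinj : LinearMap.ker (A : ℝ × ℝ →ₗ[ℝ] ℂ) = ⊥ := by
    refine LinearMap.ker_eq_bot'.mpr fun p hp => ?_
    have h1 : ((p.1 : ℂ) * w + p.2) * v = 0 := by
      have : (p.1 : ℂ) * (w * v) + p.2 * v = 0 := by simpa [hA] using hp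
      linear_combination this
    have h2 := (mul_eq_zero.mp h1).resolve_right hv
    have h3 := congrArg Complex.im h2
    have h4 := congrArg Complex.re h2
    simp [hw] at h3
    simp [h3] at h4
    exact Prod.ext h3 h4
  obtain ⟨C, -, hC⟩ := (A : ℝ × ℝ →ₗ[ℝ] ℂ).exists_antilipschitzWith hinj
  have h := (hd.isTheta_sub (hC.isUniformInducing A.uniformContinuous).isInducing).2
  have h00 : passModel w v 0 0 = 0 := by simp [passModel_zero, circleSub]
  simp only [h00, Prod.mk_zero_zero, sub_zero] at h
  exact h

/-- A family of loops crossing the origin transversally, once, at the parameter `t = 0`: the winding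
number jumps by one. -/
lemma hasWinding_jump {Q : ℝ → ℝ → ℂ} {v w : ℂ} (hv : v ≠ 0) (hw : w.im ≠ 0)
    (hc : ∀ τ, ContinuousAt (fun p : ℝ × ℝ => Q p.1 p.2) (0, τ))
    (hs : ∀ᶠ t in 𝓝 0, Continuous (Q t)) (hp : ∀ t τ, Q t (τ + 1) = Q t τ)
    (hd : HasFDerivAt (fun p : ℝ × ℝ => Q p.1 p.2)
      ((ContinuousLinearMap.fst ℝ ℝ ℝ).smulRight (w * v) +
        (ContinuousLinearMap.snd ℝ ℝ ℝ).smulRight v) (0, 0))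
    (h0 : ∀ τ, Q 0 τ = 0 ↔ ∃ k : ℤ, τ = k) :
    ∃ m, (∃ ρ : ℝ → ℂ, Continuous ρ ∧ (∀ τ, Q 0 τ = circleSub τ * ρ τ) ∧ HasWinding ρ m) ∧
      ∀ᶠ t in 𝓝 0, (0 < t * w.im → HasWinding (Q t) m) ∧
        (t * w.im < 0 → HasWinding (Q t) (m + 1)) := by
  set M := passModel w v with hM
  have hMp : ∀ t τ, M t (τ + 1) = M t τ := fun t τ => by
    simp only [hM, passModel, exp_two_pi_add_one]
  have hMc : Continuous fun p : ℝ × ℝ => M p.1 p.2 := continuous_passModel w v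
  have hMs : ∀ t, Continuous (M t) := fun t => by
    simp only [hM]; unfold passModel; fun_prop
  have hc0 : v / (2 * Real.pi * Complex.I) ≠ 0 := div_ne_zero hv Complex.two_pi_I_ne_zero
  have hM0 : ∀ τ, M 0 τ = 0 ↔ ∃ k : ℤ, τ = k := fun τ => by
    rw [hM, passModel_zero, mul_eq_zero, or_iff_right hc0, circleSub_eq_zero]
  -- Dividing by the model removes the common zeros. The quotient, with value `1` at the zeros, is
  -- continuous and nonvanishing around `t = 0`, so its winding number is locally constant and the
  -- jump of `Q` is that of the model.
  let ρ : ℝ → ℝ → ℂ := fun t τ => if M t τ = 0 then 1 else Q t τ / M t τ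
  have hρp : ∀ t τ, ρ t (τ + 1) = ρ t τ := fun t τ => by simp only [ρ, hMp, hp]
  have hMρ : ∀ t τ, (M t τ = 0 → Q t τ = 0) → Q t τ = M t τ * ρ t τ := fun t τ h => by
    by_cases hm : M t τ = 0
    · rw [h hm, hm, zero_mul]
    · simp only [ρ, if_neg hm, mul_div_cancel₀ _ hm]
  have hlim : ContinuousAt (fun p : ℝ × ℝ => ρ p.1 p.2) (0, 0) := by
    have hρ0 : ρ 0 0 = 1 := if_pos ((hM0 0).mpr ⟨0, by simp⟩)
    have hQ0 : Q 0 0 = 0 := (h0 0).mpr ⟨0, by simp⟩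
    have hM00 : M 0 0 = 0 := (hM0 0).mpr ⟨0, by simp⟩
    -- `Q` and `M` have the same value and derivative at the origin, so they differ by `o(p)`, and
    -- transversality turns this into `o(M)`.
    have e1 : (fun p : ℝ × ℝ => Q p.1 p.2 - M p.1 p.2) =o[𝓝 0] fun p : ℝ × ℝ => M p.1 p.2 := by
      refine Asymptotics.IsLittleO.trans_isBigO ?_ (isBigO_of_transverse hv hw)
      have := (hd.sub (hasFDerivAt_passModel w v)).isLittleO
      simp only [← hM, Pi.sub_apply, Prod.mk_zero_zero, sub_zero] at this
      rw [Prod.fst_zero, Prod.snd_zero, hQ0, hM00] at this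
      simpa using! this
    have e2 := (Asymptotics.isLittleO_iff_tendsto' (by
      filter_upwards [e1.bound zero_lt_one] with p hp hm
      exact norm_le_zero_iff.mp (by simpa [hm] using hp))).mp e1
    have e3 : (fun p : ℝ × ℝ => ρ p.1 p.2) = fun p : ℝ × ℝ =>
        1 + (Q p.1 p.2 - M p.1 p.2) / M p.1 p.2 := by
      funext p
      by_cases hm : M p.1 p.2 = 0
      · simp [ρ, hm]
      · simp only [ρ, if_neg hm]; field_simp; ring
    rw [ContinuousAt, hρ0, e3]
    simpa using! e2.const_add 1
  have hρc : ∀ τ, ContinuousAt (fun p : ℝ × ℝ => ρ p.1 p.2) (0, τ) := fun τ => by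
    by_cases hm : M 0 τ = 0
    · obtain ⟨k, rfl⟩ := (hM0 τ).mp hm
      have e : (fun p : ℝ × ℝ => ρ p.1 p.2) =
          (fun p : ℝ × ℝ => ρ p.1 p.2) ∘ fun p : ℝ × ℝ => (p.1, p.2 - k) := by
        funext p
        have hper : Function.Periodic (ρ p.1) 1 := hρp p.1
        simpa using (hper.sub_int_mul_eq (x := p.2) k).symm
      rw [e]
      refine ContinuousAt.comp ?_ (by fun_prop)
      simpa using hlim
    · have h1 : ContinuousAt (fun p : ℝ × ℝ => Q p.1 p.2 / M p.1 p.2) (0, τ) :=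
        (hc τ).div hMc.continuousAt hm
      refine h1.congr ?_
      filter_upwards [hMc.continuousAt.eventually_ne hm] with p hp
      exact (if_neg hp).symm
  have hρ0c : Continuous (ρ 0) := continuous_iff_continuousAt.mpr fun τ =>
    (hρc τ).comp (f := fun τ => ((0 : ℝ), τ)) (by fun_prop)
  have hev : ∀ᶠ t in 𝓝 (0 : ℝ), t ≠ 0 → ∀ τ, M t τ ≠ 0 := by
    filter_upwards [eventually_norm_lt_one_of_neg hw] with t ht ht0 τ
    refine passModel_ne_zero hv ?_ τ
    rcases lt_or_gt_of_ne (mul_ne_zero ht0 hw) with h | h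
    · exact (ht h).ne
    · exact (one_lt_norm_of_pos h).ne'
  have hρs : ∀ᶠ t in 𝓝 (0 : ℝ), Continuous (ρ t) := by
    filter_upwards [hev, hs] with t ht hst
    by_cases h : t = 0
    · exact h ▸ hρ0c
    · have : ρ t = fun τ => Q t τ / M t τ := funext fun τ => if_neg (ht h τ)
      rw [this]
      exact hst.div (hMs t) (ht h)
  have hρne : ∀ τ, ρ 0 τ ≠ 0 := fun τ => by
    by_cases hm : M 0 τ = 0
    · simp [ρ, hm]
    · simp only [ρ, if_neg hm]
      exact div_ne_zero (fun h => hm ((hM0 τ).mpr ((h0 τ).mp h))) hm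
  obtain ⟨m, hm⟩ := HasWinding.exists hρ0c hρne (hρp 0)
  refine ⟨m, ⟨fun τ => v / (2 * Real.pi * Complex.I) * ρ 0 τ, by fun_prop, fun τ => ?_, ?_⟩, ?_⟩
  · rw [hMρ 0 τ (fun h => (h0 τ).mpr ((hM0 τ).mp h)), hM, passModel_zero]
    ring
  · simpa using (hasWinding_const hc0).mul hm
  · filter_upwards [hev, eventually_hasWinding hρc hρs hρp hm, eventually_norm_lt_one_of_neg hw]
      with t ht hmt hlt
    have key : ∀ n : ℤ, t ≠ 0 → HasWinding (fun τ =>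
        Complex.exp (2 * Real.pi * Complex.I * τ) - (1 - 2 * Real.pi * Complex.I * w * t)) n →
        HasWinding (Q t) (n + m) := fun n htn hn => by
      have h1 := ((hasWinding_const hc0).mul hn).mul hmt
      rw [zero_add] at h1
      convert! h1 using 1
      funext τ
      exact hMρ t τ fun h => absurd h (ht htn τ)
    refine ⟨fun h => ?_, fun h => ?_⟩
    · simpa using key 0 (fun h' => by simp [h'] at h) (hasWinding_circle_outside (one_lt_norm_of_pos h))
    · simpa [add_comm] using key 1 (fun h' => by simp [h'] at h) (hasWinding_circle_inside (hlt h))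

/-! ### Difference quotients of closed curves -/

/-- The difference quotient of a closed curve with respect to the parameter of the circle, extended
to the diagonal by the derivative. -/
def circleQuot (f : ℝ → ℂ) (t τ : ℝ) : ℂ :=
  if circleSub (τ - t) = 0 then deriv f t / (2 * Real.pi * Complex.I)
  else (f τ - f t) / circleSub (τ - t)

lemma periodic_add_int {f : ℝ → ℂ} (hf : Function.Periodic f 1) (t : ℝ) (k : ℤ) :
    f (t + k) = f t := by
  simpa using (hf.sub_int_mul_eq (x := t) (-k))

lemma deriv_periodic {f : ℝ → ℂ} (hf : Function.Periodic f 1) :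
    Function.Periodic (deriv f) 1 := fun t => by
  rw [← deriv_comp_add_const, funext hf]

lemma circleSub_mul_circleQuot {f : ℝ → ℂ} (hf : Function.Periodic f 1) (t τ : ℝ) :
    circleSub (τ - t) * circleQuot f t τ = f τ - f t := by
  unfold circleQuot
  split_ifs with h
  · obtain ⟨k, hk⟩ := circleSub_eq_zero.mp h
    rw [h, zero_mul, eq_comm, sub_eq_zero, ← periodic_add_int hf t k, ← hk, add_sub_cancel]
  · rw [mul_div_cancel₀ _ h]

lemma circleQuot_add_one_right {f : ℝ → ℂ} (hf : Function.Periodic f 1) (t τ : ℝ) :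
    circleQuot f t (τ + 1) = circleQuot f t τ := by
  have : circleSub (τ + 1 - t) = circleSub (τ - t) := by
    rw [add_sub_right_comm, circleSub_add_one]
  simp only [circleQuot, this, hf τ]

lemma circleQuot_add_one_left {f : ℝ → ℂ} (hf : Function.Periodic f 1) (t τ : ℝ) :
    circleQuot f (t + 1) τ = circleQuot f t τ := by
  have : circleSub (τ - (t + 1)) = circleSub (τ - t) := by
    rw [← circleSub_add_one]; congr 1; ring
  simp only [circleQuot, this, hf t, deriv_periodic hf t]

/-- The mean of the derivative of a curve along a parameter interval. -/
def meanDeriv (f : ℝ → ℂ) (t x : ℝ) : ℂ := ∫ s in (0 : ℝ)..1, deriv f (t + s • x)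

lemma smul_meanDeriv {f : ℝ → ℂ} (hf : ContDiff ℝ ∞ f) (t x : ℝ) :
    x • meanDeriv f t x = f (t + x) - f t := by
  have hc : Continuous (deriv f) := hf.continuous_deriv (by simp)
  have hd : Differentiable ℝ f := hf.differentiable (by simp)
  exact intervalIntegral.integral_unitInterval_deriv_eq_sub (𝕜 := ℝ) (by fun_prop)
    fun s _ => (hd _).hasDerivAt

lemma continuous_meanDeriv {f : ℝ → ℂ} (hf : ContDiff ℝ ∞ f) :
    Continuous fun p : ℝ × ℝ => meanDeriv f p.1 p.2 := by
  have hc : Continuous (deriv f) := hf.continuous_deriv (by simp)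
  exact intervalIntegral.continuous_parametric_intervalIntegral_of_continuous'
    (f := fun (p : ℝ × ℝ) s => deriv f (p.1 + s • p.2)) (by fun_prop) 0 1

lemma meanDeriv_zero (f : ℝ → ℂ) (t : ℝ) : meanDeriv f t 0 = deriv f t := by
  simp [meanDeriv]

lemma contDiff_circleSub : ContDiff ℝ ∞ circleSub := by
  unfold circleSub
  exact (((contDiff_const.mul Complex.ofRealCLM.contDiff).cexp).sub contDiff_const)

lemma smul_meanDeriv_circleSub (x : ℝ) : x • meanDeriv circleSub 0 x = circleSub x := by
  have h : circleSub 0 = 0 := circleSub_eq_zero.mpr ⟨0, by simp⟩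
  rw [smul_meanDeriv contDiff_circleSub, zero_add, h, sub_zero]

lemma meanDeriv_circleSub_ne_zero : meanDeriv circleSub 0 0 ≠ 0 := by
  rw [meanDeriv_zero, hasDerivAt_circleSub_zero.deriv]
  exact Complex.two_pi_I_ne_zero

/-- Near the diagonal, numerator and denominator are both `τ - t` times a mean of a derivative; the
factor cancels and the mean for `circleSub` does not vanish there. Periodicity covers the other
integer values of `τ - t`. -/
lemma continuous_circleQuot {f : ℝ → ℂ} (hf : ContDiff ℝ ∞ f) (hp : Function.Periodic f 1) :
    Continuous fun p : ℝ × ℝ => circleQuot f p.1 p.2 := by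
  have diag : ∀ t, ContinuousAt (fun p : ℝ × ℝ => circleQuot f p.1 p.2) (t, t) := fun t => by
    have h1 : ContinuousAt (fun p : ℝ × ℝ => meanDeriv f p.1 (p.2 - p.1) /
        meanDeriv circleSub 0 (p.2 - p.1)) (t, t) := by
      refine ContinuousAt.div ?_ ?_ (by simpa using meanDeriv_circleSub_ne_zero)
      · exact ((continuous_meanDeriv hf).comp (g := fun p : ℝ × ℝ => meanDeriv f p.1 p.2)
          (f := fun p : ℝ × ℝ => (p.1, p.2 - p.1)) (by fun_prop)).continuousAt
      · exact ((continuous_meanDeriv contDiff_circleSub).comp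
          (g := fun p : ℝ × ℝ => meanDeriv circleSub p.1 p.2)
          (f := fun p : ℝ × ℝ => ((0 : ℝ), p.2 - p.1)) (by fun_prop)).continuousAt
    refine h1.congr ?_
    have hlt : ∀ᶠ p : ℝ × ℝ in 𝓝 (t, t), |p.2 - p.1| < 1 := by
      have : ContinuousAt (fun p : ℝ × ℝ => |p.2 - p.1|) (t, t) := by fun_prop
      exact this.eventually_lt_const (by simp)
    filter_upwards [hlt] with p hlt
    by_cases he : p.2 - p.1 = 0
    · rw [circleQuot, he, if_pos (circleSub_eq_zero.mpr ⟨0, by simp⟩), meanDeriv_zero,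
        meanDeriv_zero, hasDerivAt_circleSub_zero.deriv]
    · have hE : circleSub (p.2 - p.1) ≠ 0 := fun h => by
        obtain ⟨k, hk⟩ := circleSub_eq_zero.mp h
        rw [hk] at hlt he
        have : |k| < 1 := by exact_mod_cast hlt
        exact he (by exact_mod_cast Int.abs_lt_one_iff.mp this)
      have e1 := smul_meanDeriv hf p.1 (p.2 - p.1)
      have e2 := smul_meanDeriv_circleSub (p.2 - p.1)
      rw [add_sub_cancel] at e1
      rw [circleQuot, if_neg hE, ← e1, ← e2, Complex.real_smul, Complex.real_smul,
        mul_div_mul_left _ _ (by exact_mod_cast he)]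
  refine continuous_iff_continuousAt.mpr fun ⟨t, τ⟩ => ?_
  by_cases h : circleSub (τ - t) = 0
  · obtain ⟨k, hk⟩ := circleSub_eq_zero.mp h
    have e : (fun p : ℝ × ℝ => circleQuot f p.1 p.2) =
        (fun p : ℝ × ℝ => circleQuot f p.1 p.2) ∘ fun p : ℝ × ℝ => (p.1, p.2 - k) := by
      funext p
      have hper : Function.Periodic (circleQuot f p.1) 1 := circleQuot_add_one_right hp p.1
      simpa using (hper.sub_int_mul_eq (x := p.2) k).symm
    rw [e]
    refine ContinuousAt.comp ?_ (by fun_prop)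
    have : τ - k = t := by linarith
    simpa [this] using diag t
  · have hc : Continuous fun p : ℝ × ℝ => circleSub (p.2 - p.1) :=
      continuous_circleSub.comp (by fun_prop)
    have hfc := hf.continuous
    have h1 : ContinuousAt (fun p : ℝ × ℝ => (f p.2 - f p.1) / circleSub (p.2 - p.1)) (t, τ) :=
      ContinuousAt.div (by fun_prop) hc.continuousAt h
    refine h1.congr ?_
    filter_upwards [hc.continuousAt.eventually_ne h] with p hp
    rw [circleQuot, if_neg hp]

/-- As `H` vanishes at `p`, continuity of `G` suffices: `(G - G p) * H` is already of order `o(q -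
p)`. This matters because the factor `circleQuot` is only known to be continuous. -/
lemma hasFDerivAt_mul_of_eq_zero {G H : ℝ × ℝ → ℂ} {p : ℝ × ℝ} {H' : ℝ × ℝ →L[ℝ] ℂ}
    (hG : ContinuousAt G p) (hH : HasFDerivAt H H' p) (h0 : H p = 0) :
    HasFDerivAt (fun q => G q * H q) (G p • H') p := by
  have h1 : (fun q => (G q - G p) * H q) =o[𝓝 p] fun q => q - p := by
    have hg : (fun q => G q - G p) =o[𝓝 p] fun _ => (1 : ℂ) := by
      rw [Asymptotics.isLittleO_one_iff]
      simpa using hG.sub_const (G p)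
    have hh : H =O[𝓝 p] fun q => q - p := by simpa [h0] using hH.isBigO_sub
    have hh' : H =O[𝓝 p] fun q => ‖q - p‖ := hh.norm_right
    have := hg.mul_isBigO (hh'.trans (Asymptotics.isBigO_of_le (g := fun q => ((‖q - p‖ : ℝ) : ℂ)) _
      fun q => by simp))
    refine this.trans_isBigO (Asymptotics.isBigO_of_le _ fun q => by simp)
  have h2 : HasFDerivAt (fun q => (G q - G p) * H q) (0 : ℝ × ℝ →L[ℝ] ℂ) p :=
    .of_isLittleO (by simpa [h0] using h1)
  have h3 := h2.add (hH.const_mul (G p))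
  rw [zero_add] at h3
  refine h3.congr_of_eventuallyEq (.of_forall fun q => ?_)
  simp only [Pi.add_apply]
  ring

lemma HasWinding.comp_add {φ : ℝ → ℂ} {m : ℤ} (h : HasWinding φ m) (a : ℝ) :
    HasWinding (fun τ => φ (τ + a)) m := by
  obtain ⟨L, hL, h, h1⟩ := h
  exact ⟨fun τ => L (τ + a), by fun_prop, fun τ => h _, fun τ => by
    rw [← h1, add_right_comm]⟩

/-! ### The parity of a planar diagram -/

/-- The product over all components of their difference from the point `proj i t`, as a function of
the parameter `τ`, with the zero at `τ = t` removed. -/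
def Link.pointLoop {U : Set ℂ} (L : Link U) (i : Fin L.numComponents) (t τ : ℝ) : ℂ :=
  circleQuot (L.proj i) t τ * ∏ j ∈ Finset.univ.erase i, (L.proj j τ - L.proj i t)

namespace Link

variable {U : Set ℂ} (L : Link U)

lemma continuous_proj (i : Fin L.numComponents) : Continuous (L.proj i) :=
  (L.proj_smooth i).continuous

lemma circleSub_mul_pointLoop (i : Fin L.numComponents) (t τ : ℝ) :
    circleSub (τ - t) * L.pointLoop i t τ = ∏ j, (L.proj j τ - L.proj i t) := by
  rw [pointLoop, ← mul_assoc, circleSub_mul_circleQuot (L.proj_periodic i),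
    Finset.mul_prod_erase Finset.univ (fun j => L.proj j τ - L.proj i t) (Finset.mem_univ i)]

lemma continuous_pointLoop (i : Fin L.numComponents) :
    Continuous fun p : ℝ × ℝ => L.pointLoop i p.1 p.2 := by
  have h := L.continuous_proj
  exact (continuous_circleQuot (L.proj_smooth i) (L.proj_periodic i)).mul
    (continuous_finsetProd _ fun j _ => by fun_prop)

lemma pointLoop_add_one_right (i : Fin L.numComponents) (t τ : ℝ) :
    L.pointLoop i t (τ + 1) = L.pointLoop i t τ := by
  simp only [pointLoop, circleQuot_add_one_right (L.proj_periodic i), fun j => L.proj_periodic j τ]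

lemma pointLoop_add_one_left (i : Fin L.numComponents) (t τ : ℝ) :
    L.pointLoop i (t + 1) τ = L.pointLoop i t τ := by
  simp only [pointLoop, circleQuot_add_one_left (L.proj_periodic i), L.proj_periodic i t]

lemma pointLoop_add_int_left (i : Fin L.numComponents) (t : ℝ) (k : ℤ) :
    L.pointLoop i (t + k) = L.pointLoop i t := by
  funext τ
  have h : Function.Periodic (fun t => L.pointLoop i t τ) 1 := fun t =>
    L.pointLoop_add_one_left i t τ
  simpa using (h.sub_int_mul_eq (x := t) (-k))

lemma proj_fract (i : Fin L.numComponents) (t : ℝ) : L.proj i (Int.fract t) = L.proj i t := by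
  have := (L.proj_periodic i).sub_int_mul_eq (x := t) ⌊t⌋
  rw [mul_one] at this
  exact this

lemma eventually_hasWinding_pointLoop {i : Fin L.numComponents} {t₀ : ℝ} {m : ℤ}
    (h : HasWinding (L.pointLoop i t₀) m) :
    ∀ᶠ t in 𝓝 t₀, HasWinding (L.pointLoop i t) m :=
  eventually_hasWinding (fun _ => (L.continuous_pointLoop i).continuousAt)
    (.of_forall fun t => (L.continuous_pointLoop i).comp (f := fun τ : ℝ => (t, τ)) (by fun_prop))
    (L.pointLoop_add_one_right i) h

end Link

namespace Diagram

variable {U : Set ℂ} {L : Link U} (D : Diagram L)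

/-- The other passage through the same crossing. -/
def flip (s : Fin D.crossings × Bool) : Fin D.crossings × Bool := (s.1, !s.2)

@[simp] lemma flip_flip (s : Fin D.crossings × Bool) : D.flip (D.flip s) = s := by simp [flip]

lemma flip_ne (s : Fin D.crossings × Bool) : D.flip s ≠ s := fun h => by
  have := congrArg Prod.snd h
  simp [flip] at this

/-- The sign of the crossing of the two strands at the passage `s`, up to a positive factor. -/
def turn (s : Fin D.crossings × Bool) : ℝ :=
  (conj (deriv (L.proj (D.comp s)) (D.time s)) *
    deriv (L.proj (D.comp (D.flip s))) (D.time (D.flip s))).im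

lemma turn_flip (s : Fin D.crossings × Bool) : D.turn (D.flip s) = -D.turn s := by
  simp only [turn, flip_flip, Complex.mul_im, Complex.conj_re, Complex.conj_im]
  ring

lemma turn_ne_zero (s : Fin D.crossings × Bool) : D.turn s ≠ 0 := by
  obtain ⟨c, b⟩ := s
  cases b
  · have := D.turn_flip (c, true)
    rw [show D.flip (c, true) = (c, false) from rfl] at this
    rw [this]
    exact neg_ne_zero.mpr (D.transverse c)
  · exact D.transverse c

lemma proj_flip (s : Fin D.crossings × Bool) :
    L.proj (D.comp (D.flip s)) (D.time (D.flip s)) = L.proj (D.comp s) (D.time s) := by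
  obtain ⟨c, b⟩ := s
  cases b
  · exact D.double_point c
  · exact (D.double_point c).symm

lemma exists_passage {i j : Fin L.numComponents} {t τ : ℝ} (h : L.proj j τ = L.proj i t)
    (hne : i = j → ∀ k : ℤ, τ ≠ t + k) :
    ∃ s, D.comp s = i ∧ (∃ k : ℤ, t = D.time s + k) ∧ D.comp (D.flip s) = j ∧
      ∃ k : ℤ, τ = D.time (D.flip s) + k := by
  obtain ⟨c, b, h1, h2⟩ := D.all_double_points i j (Int.fract t)
    ⟨Int.fract_nonneg _, Int.fract_lt_one _⟩ (Int.fract τ) ⟨Int.fract_nonneg _, Int.fract_lt_one _⟩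
    (by rw [L.proj_fract, L.proj_fract, h]) (fun he => by
      obtain ⟨rfl, h2⟩ := Prod.mk.inj he
      refine hne rfl (⌊τ⌋ - ⌊t⌋) ?_
      have e1 := Int.floor_add_fract τ
      have e2 := Int.floor_add_fract t
      push_cast
      linarith)
  obtain ⟨h3, h4⟩ := Prod.mk.inj h1
  obtain ⟨h5, h6⟩ := Prod.mk.inj h2
  refine ⟨(c, b), h3, ⟨⌊t⌋, ?_⟩, h5, ⌊τ⌋, ?_⟩
  · rw [h4, add_comm, Int.floor_add_fract]
  · rw [show D.time (D.flip (c, b)) = Int.fract τ from h6, add_comm, Int.floor_add_fract]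

lemma time_eq_of_eq_add_int {s s' : Fin D.crossings × Bool} {k : ℤ}
    (h : D.time s = D.time s' + k) : D.time s = D.time s' := by
  have h1 := D.time_mem s
  have h2 := D.time_mem s'
  have h3 : |(k : ℝ)| < 1 := by
    rw [abs_lt]
    constructor <;> linarith [h1.1, h1.2, h2.1, h2.2]
  have : |k| < 1 := by exact_mod_cast h3
  rw [h, Int.abs_lt_one_iff.mp this]
  simp

lemma eq_of_comp_eq_of_time_eq {s s' : Fin D.crossings × Bool} (hc : D.comp s = D.comp s')
    {k : ℤ} (h : D.time s = D.time s' + k) : s = s' :=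
  D.strand_injective (Prod.ext hc (D.time_eq_of_eq_add_int h))

lemma eq_flip_of_proj_eq {s : Fin D.crossings × Bool} {j : Fin L.numComponents} {τ : ℝ}
    (h : L.proj j τ = L.proj (D.comp s) (D.time s))
    (hne : D.comp s = j → ∀ k : ℤ, τ ≠ D.time s + k) :
    j = D.comp (D.flip s) ∧ ∃ k : ℤ, τ = D.time (D.flip s) + k := by
  obtain ⟨s', h1, ⟨k, h2⟩, h3, h4⟩ := D.exists_passage h hne
  obtain rfl := D.eq_of_comp_eq_of_time_eq h1.symm h2
  exact ⟨h3.symm, h4⟩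

lemma circleQuot_ne_zero_of_mem (D : Diagram L) {i : Fin L.numComponents} {t τ : ℝ}
    (h : circleSub (τ - t) = 0) : circleQuot (L.proj i) t τ ≠ 0 := by
  rw [circleQuot, if_pos h]
  exact div_ne_zero (D.immersed i t) Complex.two_pi_I_ne_zero

lemma ne_add_int_of_circleSub_ne_zero {t τ : ℝ} (h : circleSub (τ - t) ≠ 0) (k : ℤ) :
    τ ≠ t + k := fun h' => h (circleSub_eq_zero.mpr ⟨k, by rw [h']; ring⟩)

/-- A vanishing factor is a double point of the projection, hence a crossing. The removed zero at `τ
= t` does not return, because the projection is an immersion. -/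
lemma pointLoop_eq_zero {i : Fin L.numComponents} {t τ : ℝ} (h : L.pointLoop i t τ = 0) :
    ∃ s, D.comp s = i ∧ (∃ k : ℤ, t = D.time s + k) ∧ ∃ k : ℤ, τ = D.time (D.flip s) + k := by
  rcases mul_eq_zero.mp h with h | h
  · by_cases h0 : circleSub (τ - t) = 0
    · exact absurd h (D.circleQuot_ne_zero_of_mem h0)
    · rw [circleQuot, if_neg h0, div_eq_zero_iff, or_iff_left h0, sub_eq_zero] at h
      obtain ⟨s, h1, h2, -, h3⟩ := D.exists_passage h fun _ => ne_add_int_of_circleSub_ne_zero h0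
      exact ⟨s, h1, h2, h3⟩
  · obtain ⟨j, hj, h⟩ := Finset.prod_eq_zero_iff.mp h
    obtain ⟨s, h1, h2, -, h3⟩ := D.exists_passage (sub_eq_zero.mp h)
      fun he => absurd he.symm (Finset.ne_of_mem_erase hj)
    exact ⟨s, h1, h2, h3⟩

lemma circleSub_time_ne_zero {s : Fin D.crossings × Bool}
    (h : D.comp (D.flip s) = D.comp s) : circleSub (D.time (D.flip s) - D.time s) ≠ 0 := fun h0 => by
  obtain ⟨k, hk⟩ := circleSub_eq_zero.mp h0
  exact D.flip_ne s (D.eq_of_comp_eq_of_time_eq (k := k) h (by linarith))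

/-- Near a crossing, the loop of a point moving along a strand is a nonvanishing multiple of the
difference of the two strands. -/
lemma exists_pointLoop_eq_mul (s : Fin D.crossings × Bool) :
    ∃ G : ℝ × ℝ → ℂ, ContinuousAt G (D.time s, D.time (D.flip s)) ∧
      G (D.time s, D.time (D.flip s)) ≠ 0 ∧
      ∀ᶠ p : ℝ × ℝ in 𝓝 (D.time s, D.time (D.flip s)), L.pointLoop (D.comp s) p.1 p.2 =
        G p * (L.proj (D.comp (D.flip s)) p.2 - L.proj (D.comp s) p.1) := by
  have hcont := L.continuous_proj
  set i := D.comp s with hi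
  set j := D.comp (D.flip s) with hj
  have hprod : ∀ S : Finset (Fin L.numComponents), i ∉ S → j ∉ S →
      ∏ l ∈ S, (L.proj l (D.time (D.flip s)) - L.proj i (D.time s)) ≠ 0 := fun S hiS hjS => by
    refine Finset.prod_ne_zero_iff.mpr fun l hl h => ?_
    have := (D.eq_flip_of_proj_eq (s := s) (sub_eq_zero.mp h) fun he => absurd hl (he ▸ hiS)).1
    exact hjS (by rw [hj, ← this]; exact hl)
  -- If both strands belong to one component, the vanishing factor is hidden in `circleQuot`;
  -- otherwise it is a factor of the product. `G` collects everything else.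
  by_cases hij : j = i
  · have hE := D.circleSub_time_ne_zero (s := s) hij
    have hEc : Continuous fun p : ℝ × ℝ => circleSub (p.2 - p.1) :=
      continuous_circleSub.comp (by fun_prop)
    refine ⟨fun p => (circleSub (p.2 - p.1))⁻¹ *
      ∏ l ∈ Finset.univ.erase i, (L.proj l p.2 - L.proj i p.1), ?_, ?_, ?_⟩
    · exact (hEc.continuousAt.inv₀ hE).mul
        (continuous_finsetProd _ fun j _ => by fun_prop).continuousAt
    · exact mul_ne_zero (inv_ne_zero hE) (hprod _ (by simp) (by simp [hij]))
    · filter_upwards [hEc.continuousAt.eventually_ne hE] with p hp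
      rw [Link.pointLoop, circleQuot, if_neg hp, hij]
      ring
  · refine ⟨fun p => circleQuot (L.proj i) p.1 p.2 *
      ∏ l ∈ (Finset.univ.erase i).erase j, (L.proj l p.2 - L.proj i p.1), ?_, ?_, ?_⟩
    · exact ((continuous_circleQuot (L.proj_smooth i) (L.proj_periodic i)).mul
        (continuous_finsetProd _ fun j _ => by fun_prop)).continuousAt
    · refine mul_ne_zero (fun h => ?_) (hprod _ (by simp) (by simp))
      by_cases h0 : circleSub (D.time (D.flip s) - D.time s) = 0
      · exact D.circleQuot_ne_zero_of_mem h0 h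
      · rw [circleQuot, if_neg h0, div_eq_zero_iff, or_iff_left h0, sub_eq_zero] at h
        exact hij (D.eq_flip_of_proj_eq (s := s) h
          fun _ => ne_add_int_of_circleSub_ne_zero h0).1.symm
    · refine .of_forall fun p => ?_
      rw [Link.pointLoop, ← Finset.prod_erase_mul _ _ (Finset.mem_erase.mpr ⟨hij, Finset.mem_univ j⟩)]
      ring

lemma pointLoop_time_eq_zero_iff (s : Fin D.crossings × Bool) (τ : ℝ) :
    L.pointLoop (D.comp s) (D.time s) τ = 0 ↔ ∃ k : ℤ, τ = D.time (D.flip s) + k := by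
  constructor
  · intro h
    obtain ⟨s', h1, ⟨k, h2⟩, h3⟩ := D.pointLoop_eq_zero h
    obtain rfl := D.eq_of_comp_eq_of_time_eq h1.symm h2
    exact h3
  · rintro ⟨k, rfl⟩
    have h : Function.Periodic (L.pointLoop (D.comp s) (D.time s)) 1 :=
      L.pointLoop_add_one_right _ _
    rw [periodic_add_int h]
    obtain ⟨G, -, -, hG⟩ := D.exists_pointLoop_eq_mul s
    have := hG.self_of_nhds
    simp only [D.proj_flip, sub_self, mul_zero] at this
    exact this

/-- The derivative is a nonzero `κ` times that of the difference of the strands, `dv` in `τ` and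
`-du` in `t`. Hence `w = -du / dv`, from which `κ` has cancelled, and its imaginary part is `turn s
/ |dv|²`. -/
lemma hasFDerivAt_pointLoop (s : Fin D.crossings × Bool) : ∃ v w : ℂ, v ≠ 0 ∧
    (∃ a : ℝ, 0 < a ∧ w.im = a * D.turn s) ∧
    HasFDerivAt (fun p : ℝ × ℝ => L.pointLoop (D.comp s) p.1 p.2)
      ((ContinuousLinearMap.fst ℝ ℝ ℝ).smulRight (w * v) +
        (ContinuousLinearMap.snd ℝ ℝ ℝ).smulRight v) (D.time s, D.time (D.flip s)) := by
  obtain ⟨G, hGc, hG0, hG⟩ := D.exists_pointLoop_eq_mul s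
  set du := deriv (L.proj (D.comp s)) (D.time s) with hdu
  set dv := deriv (L.proj (D.comp (D.flip s))) (D.time (D.flip s)) with hdv
  have hv0 : dv ≠ 0 := D.immersed _ _
  set κ := G (D.time s, D.time (D.flip s)) with hκ
  have hder : ∀ i t, HasDerivAt (L.proj i) (deriv (L.proj i) t) t := fun i t =>
    ((L.proj_smooth i).differentiable (by simp) t).hasDerivAt
  have h1 : HasFDerivAt (fun p : ℝ × ℝ => L.proj (D.comp (D.flip s)) p.2 - L.proj (D.comp s) p.1)
      ((ContinuousLinearMap.snd ℝ ℝ ℝ).smulRight dv - (ContinuousLinearMap.fst ℝ ℝ ℝ).smulRight du)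
      (D.time s, D.time (D.flip s)) := by
    have e1 := HasFDerivAt.comp (D.time s, D.time (D.flip s)) (f := fun p : ℝ × ℝ => p.2)
      (hder (D.comp (D.flip s)) (D.time (D.flip s))).hasFDerivAt hasFDerivAt_snd
    have e2 := HasFDerivAt.comp (D.time s, D.time (D.flip s)) (f := fun p : ℝ × ℝ => p.1)
      (hder (D.comp s) (D.time s)).hasFDerivAt hasFDerivAt_fst
    convert! e1.sub e2 using 1
  have h2 := hasFDerivAt_mul_of_eq_zero hGc h1 (by simp [D.proj_flip])
  refine ⟨κ * dv, -du / dv, mul_ne_zero hG0 hv0, ⟨(Complex.normSq dv)⁻¹,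
    inv_pos.mpr (Complex.normSq_pos.mpr hv0), ?_⟩, ?_⟩
  · rw [turn, ← hdu, ← hdv]
    simp only [Complex.div_im, Complex.neg_im, Complex.neg_re, Complex.mul_im, Complex.conj_re,
      Complex.conj_im]
    ring
  · refine HasFDerivAt.congr_of_eventuallyEq ?_ hG
    convert! h2 using 1
    rw [← hκ]
    ext <;> simp
    field_simp

/-- The winding number of the loop of a point moving along a strand jumps at a crossing.  The
intermediate value `m` depends only on the crossing. -/
lemma hasWinding_pointLoop_jump (s : Fin D.crossings × Bool) :
    ∃ m, (∃ ρ : ℝ → ℂ, Continuous ρ ∧ (∀ τ, ∏ j, (L.proj j τ - L.proj (D.comp s) (D.time s)) =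
        circleSub (τ - D.time s) * circleSub (τ - D.time (D.flip s)) * ρ τ) ∧ HasWinding ρ m) ∧
      ∀ᶠ t in 𝓝 0, (0 < t * D.turn s → HasWinding (L.pointLoop (D.comp s) (t + D.time s)) m) ∧
        (t * D.turn s < 0 → HasWinding (L.pointLoop (D.comp s) (t + D.time s)) (m + 1)) := by
  obtain ⟨v, w, hv, ⟨a, ha, hw⟩, hd⟩ := D.hasFDerivAt_pointLoop s
  have hc := L.continuous_pointLoop (D.comp s)
  have hc2 : Continuous fun p : ℝ × ℝ =>
      L.pointLoop (D.comp s) (p.1 + D.time s) (p.2 + D.time (D.flip s)) :=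
    hc.comp (f := fun p : ℝ × ℝ => (p.1 + D.time s, p.2 + D.time (D.flip s))) (by fun_prop)
  obtain ⟨m, ⟨ρ, hρc, hρ, hm⟩, hev⟩ := hasWinding_jump (Q := fun t τ =>
    L.pointLoop (D.comp s) (t + D.time s) (τ + D.time (D.flip s))) (w := w) hv
    (by rw [hw]; exact mul_ne_zero ha.ne' (D.turn_ne_zero s)) (fun τ => hc2.continuousAt)
    (.of_forall fun t => hc2.comp (f := fun τ : ℝ => (t, τ)) (by fun_prop))
    (fun t τ => by rw [add_right_comm, L.pointLoop_add_one_right])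
    (by
      have e : ((0 : ℝ), (0 : ℝ)) + (D.time s, D.time (D.flip s)) =
        (D.time s, D.time (D.flip s)) := by simp
      rw [← e] at hd
      have := HasFDerivAt.comp ((0 : ℝ), (0 : ℝ)) hd
        ((hasFDerivAt_id _).add_const (D.time s, D.time (D.flip s)))
      exact this)
    (fun τ => by
      rw [zero_add, D.pointLoop_time_eq_zero_iff]
      simp only [add_comm (D.time (D.flip s)), add_left_inj])
  refine ⟨m, ⟨fun τ => ρ (τ + -D.time (D.flip s)), by fun_prop, fun τ => ?_,
    hm.comp_add _⟩, ?_⟩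
  · have := hρ (τ + -D.time (D.flip s))
    simp only [zero_add, neg_add_cancel_right] at this
    rw [← L.circleSub_mul_pointLoop, this, mul_assoc, sub_eq_add_neg τ (D.time (D.flip s))]
  · filter_upwards [hev] with t ht
    have e : ∀ n, HasWinding (fun τ => L.pointLoop (D.comp s) (t + D.time s)
        (τ + D.time (D.flip s))) n → HasWinding (L.pointLoop (D.comp s) (t + D.time s)) n :=
      fun n hn => by simpa using hn.comp_add (-D.time (D.flip s))
    have e2 : t * w.im = a * (t * D.turn s) := by rw [hw]; ring
    refine ⟨fun h => e _ (ht.1 ?_), fun h => e _ (ht.2 ?_)⟩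
    · rw [e2]; exact mul_pos ha h
    · rw [e2]; exact mul_neg_of_pos_of_neg ha h

/-- The winding number at a crossing. -/
def crossingWinding (s : Fin D.crossings × Bool) : ℤ := (D.hasWinding_pointLoop_jump s).choose

/-- Both numbers are winding numbers of the same function: the product over all components seen from
the crossing, divided by its two zeros. The point and the pair of zeros do not depend on the chosen
strand. The quotients agree off a countable set, so everywhere. -/
lemma crossingWinding_flip (s : Fin D.crossings × Bool) :
    D.crossingWinding (D.flip s) = D.crossingWinding s := by
  obtain ⟨ρ, hρc, hρ, hm⟩ := (D.hasWinding_pointLoop_jump s).choose_spec.1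
  obtain ⟨ρ', hρc', hρ', hm'⟩ := (D.hasWinding_pointLoop_jump (D.flip s)).choose_spec.1
  suffices h : ρ' = ρ from (h ▸ hm').unique hm
  have hcount : ∀ a : ℝ, {τ : ℝ | circleSub (τ - a) = 0}.Countable := fun a => by
    refine (Set.countable_range fun k : ℤ => a + k).mono fun τ hτ => ?_
    obtain ⟨k, hk⟩ := circleSub_eq_zero.mp hτ
    exact ⟨k, by simp only; linarith⟩
  refine hρc'.ext_on (((hcount (D.time s)).union
    (hcount (D.time (D.flip s)))).dense_compl ℝ) hρc fun τ hτ => ?_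
  have h1 : circleSub (τ - D.time s) ≠ 0 := fun h => hτ (Or.inl h)
  have h2 : circleSub (τ - D.time (D.flip s)) ≠ 0 := fun h => hτ (Or.inr h)
  have e := hρ' τ
  rw [D.proj_flip, hρ τ, flip_flip, mul_comm (circleSub (τ - D.time (D.flip s)))] at e
  exact (mul_left_cancel₀ (mul_ne_zero h1 h2) e).symm

/-- By `arrival_le` the moving point meets no crossing inside the interval, so the loop never
vanishes and its winding number is locally constant on a connected set. -/
lemma exists_hasWinding_edge (s : Fin D.crossings × Bool) :
    ∃ a, ∀ t ∈ Set.Ioo (D.time s) (D.arrival s), HasWinding (L.pointLoop (D.comp s) t) a := by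
  have hex : ∀ t ∈ Set.Ioo (D.time s) (D.arrival s), ∃ a,
      HasWinding (L.pointLoop (D.comp s) t) a := fun t ht => by
    refine HasWinding.exists ?_ (fun τ h => ?_) (L.pointLoop_add_one_right _ t)
    · exact (L.continuous_pointLoop _).comp (f := fun τ : ℝ => (t, τ)) (by fun_prop)
    · obtain ⟨s', h1, ⟨k, h2⟩, -⟩ := D.pointLoop_eq_zero h
      have := D.arrival_le s s' h1 k (h2 ▸ ht.1)
      exact absurd ht.2 (not_lt.mpr (h2 ▸ this))
  obtain ⟨t₀, ht₀⟩ : (Set.Ioo (D.time s) (D.arrival s)).Nonempty :=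
    Set.nonempty_Ioo.mpr (D.time_lt_arrival s)
  obtain ⟨a, ha⟩ := hex t₀ ht₀
  refine ⟨a, fun t ht => ?_⟩
  have := isPreconnected_Ioo.induction₂ (fun t t' => ∀ n, HasWinding (L.pointLoop (D.comp s) t) n ↔
    HasWinding (L.pointLoop (D.comp s) t') n) (fun x hx => ?_) (fun x y z _ _ _ h h' n => (h n).trans (h' n))
    (fun x y _ _ h n => (h n).symm) ht₀ ht
  · exact (this a).mp ha
  · obtain ⟨b, hb⟩ := hex x hx
    filter_upwards [nhdsWithin_le_nhds (L.eventually_hasWinding_pointLoop hb)] with y hy n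
    exact ⟨fun h => hb.unique h ▸ hy, fun h => hy.unique h ▸ hb⟩

/-- The winding number along the edge leaving the passage `s`. -/
def edgeWinding (s : Fin D.crossings × Bool) : ℤ := (D.exists_hasWinding_edge s).choose

/-- An edge sees the crossing where it starts with `t > 0` and the one where it ends with `t < 0`;
hence the opposite cases here and in `edgeWinding_eq_next`. -/
lemma edgeWinding_eq (s : Fin D.crossings × Bool) :
    D.edgeWinding s = D.crossingWinding s + if D.turn s < 0 then 1 else 0 := by
  have hedge := (D.exists_hasWinding_edge s).choose_spec
  have hev := (D.hasWinding_pointLoop_jump s).choose_spec.2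
  have h1 : ∀ᶠ t : ℝ in 𝓝[>] 0, t + D.time s ∈ Set.Ioo (D.time s) (D.arrival s) := by
    have : ∀ᶠ t : ℝ in 𝓝[>] 0, t < D.arrival s - D.time s :=
      nhdsWithin_le_nhds (gt_mem_nhds (sub_pos.mpr (D.time_lt_arrival s)))
    filter_upwards [this, self_mem_nhdsWithin] with t ht ht0
    have : 0 < t := ht0
    constructor <;> linarith
  obtain ⟨t, ht, htm, ht0⟩ :=
    ((hev.filter_mono nhdsWithin_le_nhds).and (h1.and (self_mem_nhdsWithin (s := Set.Ioi 0)))).exists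
  have ht0 : 0 < t := ht0
  split_ifs with h
  · exact (hedge _ htm).unique (ht.2 (mul_neg_of_pos_of_neg ht0 h))
  · rw [add_zero]
    exact (hedge _ htm).unique (ht.1 (mul_pos ht0
      (lt_of_le_of_ne (not_lt.mp h) (D.turn_ne_zero s).symm)))

lemma edgeWinding_eq_next (s : Fin D.crossings × Bool) : D.edgeWinding s =
    D.crossingWinding (D.next s) + if D.turn (D.next s) < 0 then 0 else 1 := by
  have hedge := (D.exists_hasWinding_edge s).choose_spec
  have hev := (D.hasWinding_pointLoop_jump (D.next s)).choose_spec.2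
  change ∀ᶠ t in 𝓝 0, (_ → HasWinding _ (D.crossingWinding (D.next s))) ∧
    (_ → HasWinding _ (D.crossingWinding (D.next s) + 1)) at hev
  obtain ⟨k, hk⟩ := D.arrival_eq s
  have hloop : ∀ t, L.pointLoop (D.comp (D.next s)) (t + D.time (D.next s)) =
      L.pointLoop (D.comp s) (t + D.arrival s) := fun t => by
    rw [hk, D.comp_next, ← add_assoc, L.pointLoop_add_int_left]
  simp only [hloop] at hev
  have h1 : ∀ᶠ t : ℝ in 𝓝[<] 0, t + D.arrival s ∈ Set.Ioo (D.time s) (D.arrival s) := by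
    have : ∀ᶠ t : ℝ in 𝓝[<] 0, D.time s - D.arrival s < t :=
      nhdsWithin_le_nhds (lt_mem_nhds (sub_neg.mpr (D.time_lt_arrival s)))
    filter_upwards [this, self_mem_nhdsWithin] with t ht ht0
    have : t < 0 := ht0
    constructor <;> linarith
  obtain ⟨t, ht, htm, ht0⟩ :=
    ((hev.filter_mono nhdsWithin_le_nhds).and (h1.and (self_mem_nhdsWithin (s := Set.Iio 0)))).exists
  have ht0 : t < 0 := ht0
  split_ifs with h
  · rw [add_zero]
    exact (hedge _ htm).unique (ht.1 (mul_pos_of_neg_of_neg ht0 h))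
  · exact (hedge _ htm).unique (ht.2 (mul_neg_of_neg_of_pos ht0
      (lt_of_le_of_ne (not_lt.mp h) (D.turn_ne_zero _).symm)))

/-- The edges of a planar diagram have orientations which alternate along the strands, and which
are opposite on the two strands that leave a crossing. -/
theorem exists_alternating : ∃ a : Fin D.crossings × Bool → Bool,
    (∀ s, a (D.next s) = !a s) ∧ ∀ s, a (D.flip s) = !a s := by
  have key : ∀ x y : ℤ, Odd (x + y) → decide (Even y) = !decide (Even x) := fun x y h => by
    rw [Int.odd_add] at h
    by_cases hx : Even x <;> by_cases hy : Even y <;> simp_all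
    exact absurd hx (Int.not_even_iff_odd.mpr h)
  -- The orientation is the parity of the winding number. It alternates along a strand because of
  -- the jump by one, and differs on the two outgoing edges because `turn` changes sign under `flip`
  -- while `crossingWinding` does not.
  refine ⟨fun s => decide (Even (D.edgeWinding s)), fun s => key _ _ ?_, fun s => key _ _ ?_⟩
  · rw [D.edgeWinding_eq_next s, D.edgeWinding_eq (D.next s)]
    refine ⟨D.crossingWinding (D.next s), ?_⟩
    split_ifs <;> ring
  · rw [D.edgeWinding_eq s, D.edgeWinding_eq (D.flip s), D.crossingWinding_flip, D.turn_flip]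
    refine ⟨D.crossingWinding s, ?_⟩
    have := D.turn_ne_zero s
    rcases lt_or_gt_of_ne this with h | h
    · rw [if_pos h, if_neg (by linarith)]; ring
    · rw [if_neg (by linarith), if_pos (by linarith)]; ring

end Diagram

end Planarity

/-! ### Cycles of a permutation multiplied by a transposition -/

/-- The relation obtained from an equivalence relation `r` by joining the classes of `a` and `b`. -/
def Joined {α : Type*} (r : α → α → Prop) (a b x y : α) : Prop :=
  r x y ∨ ((r x a ∨ r x b) ∧ (r y a ∨ r y b))

/-- The relation `r'` is obtained from `r` by joining the distinct classes of `a` and `b`. -/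
def Joins {α : Type*} (r r' : α → α → Prop) (a b : α) : Prop :=
  ¬ r a b ∧ ∀ x y, r' x y ↔ Joined r a b x y

section Perm

variable {α : Type*}

lemma Joined.equivalence {r : α → α → Prop} (hr : Equivalence r) (a b : α) :
    Equivalence (Joined r a b) where
  refl x := Or.inl (hr.refl x)
  symm {x y} h := h.elim (fun h => Or.inl (hr.symm h)) fun h => Or.inr ⟨h.2, h.1⟩
  trans {x y z} h h' := by
    rcases h with h | ⟨h1, h2⟩
    · rcases h' with h' | ⟨h3, h4⟩
      · exact Or.inl (hr.trans h h')
      · exact Or.inr ⟨h3.imp (hr.trans h) (hr.trans h), h4⟩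
    · rcases h' with h' | ⟨h3, h4⟩
      · exact Or.inr ⟨h1, h2.imp (hr.trans (hr.symm h')) (hr.trans (hr.symm h'))⟩
      · exact Or.inr ⟨h1, h4⟩

lemma sameCycle_equivalence (σ : Equiv.Perm α) : Equivalence σ.SameCycle :=
  ⟨fun x => .refl σ x, fun h => h.symm, fun h h' => h.trans h'⟩

lemma sameCycle_of_joined {σ : Equiv.Perm α} {a b x y : α} (hab : σ.SameCycle a b)
    (h : Joined σ.SameCycle a b x y) : σ.SameCycle x y := by
  rcases h with h | ⟨h1, h2⟩
  · exact h
  · have e1 : σ.SameCycle x a := h1.elim id fun h => h.trans hab.symm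
    have e2 : σ.SameCycle y a := h2.elim id fun h => h.trans hab.symm
    exact e1.trans e2.symm

variable [Finite α]

lemma sameCycle_le {σ : Equiv.Perm α} {r : α → α → Prop} (hr : Equivalence r)
    (h : ∀ x, r x (σ x)) {x y : α} (hxy : σ.SameCycle x y) : r x y := by
  obtain ⟨n, -, rfl⟩ := hxy.exists_pow_eq'
  clear hxy
  induction n with
  | zero => exact hr.refl x
  | succ n ih => rw [pow_succ', Equiv.Perm.mul_apply]; exact hr.trans ih (h _)

variable [DecidableEq α]

lemma joined_of_sameCycle_mul_swap {σ : Equiv.Perm α} {a b x y : α}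
    (h : (σ * Equiv.swap a b).SameCycle x y) : Joined σ.SameCycle a b x y := by
  refine sameCycle_le (Joined.equivalence (sameCycle_equivalence σ) a b) (fun x => ?_) h
  rw [Equiv.Perm.mul_apply, Equiv.swap_apply_def]
  have hs : ∀ z, σ.SameCycle (σ z) z := fun z => Equiv.Perm.sameCycle_apply_left.mpr (.refl _ _)
  split_ifs with h1 h2
  · exact Or.inr ⟨Or.inl (h1 ▸ .refl _ _), Or.inr (hs b)⟩
  · exact Or.inr ⟨Or.inr (h2 ▸ .refl _ _), Or.inl (hs a)⟩
  · exact Or.inl (hs x).symm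

/-- With `k` minimal such that `σ ^ k` takes `a` to `b`, the product sends `b` to `σ a` and then
agrees with `σ` until `b` is reached again. So the new orbit of `b` is `σ a, …, σ ^ k a = b` and
misses `a`. -/
lemma not_sameCycle_mul_swap {σ : Equiv.Perm α} {a b : α} (hne : a ≠ b) (hab : σ.SameCycle a b) :
    ¬ (σ * Equiv.swap a b).SameCycle a b := by
  classical
  have hex : ∃ k, 0 < k ∧ (σ ^ k) a = b := by
    obtain ⟨n, h0, -, h⟩ := hab.exists_pow_eq''
    exact ⟨n, h0, h⟩
  obtain ⟨hk0, hk⟩ := Nat.find_spec hex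
  have hmin : ∀ m, 0 < m → m < Nat.find hex → (σ ^ m) a ≠ b := fun m h0 hm h =>
    Nat.find_min hex hm ⟨h0, h⟩
  set k := Nat.find hex with hkdef
  clear_value k
  have hna : ∀ i, 0 < i → i ≤ k → (σ ^ i) a ≠ a := fun i h0 hi h => by
    rcases hi.lt_or_eq with hi | rfl
    · refine hmin (k - i) (by omega) (by omega) ?_
      rw [← hk, ← Nat.sub_add_cancel hi.le, pow_add, Equiv.Perm.mul_apply, h,
        Nat.add_sub_cancel]
    · exact hne (h.symm.trans hk)
  intro hs
  obtain ⟨n, -, hn⟩ := hs.symm.exists_pow_eq'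
  have key : ∀ n, ∃ i, 0 < i ∧ i ≤ k ∧ ((σ * Equiv.swap a b) ^ n) b = (σ ^ i) a := fun n => by
    induction n with
    | zero => exact ⟨k, hk0, le_rfl, hk.symm⟩
    | succ n ih =>
      obtain ⟨i, h0, hi, h⟩ := ih
      rw [pow_succ', Equiv.Perm.mul_apply, h, Equiv.Perm.mul_apply]
      rcases hi.lt_or_eq with hi | rfl
      · refine ⟨i + 1, by omega, by omega, ?_⟩
        rw [Equiv.swap_apply_of_ne_of_ne (hna i h0 hi.le) (hmin i h0 hi), pow_succ',
          Equiv.Perm.mul_apply]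
      · exact ⟨1, one_pos, hk0, by rw [hk, Equiv.swap_apply_right, pow_one]⟩
  obtain ⟨i, h0, hi, h⟩ := key n
  exact hna i h0 hi (h.symm.trans hn)

/-- From `a` the product moves to `σ b` and follows the `σ`-cycle of `b`, which avoids `a`, until it
comes back to `b`. -/
lemma sameCycle_mul_swap {σ : Equiv.Perm α} {a b : α} (hab : ¬ σ.SameCycle a b) :
    (σ * Equiv.swap a b).SameCycle a b := by
  classical
  have hex : ∃ k, 0 < k ∧ (σ ^ k) b = b :=
    ⟨orderOf σ, orderOf_pos σ, by rw [pow_orderOf_eq_one, Equiv.Perm.one_apply]⟩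
  obtain ⟨hk0, hk⟩ := Nat.find_spec hex
  have hmin : ∀ m, 0 < m → m < Nat.find hex → (σ ^ m) b ≠ b := fun m h0 hm h =>
    Nat.find_min hex hm ⟨h0, h⟩
  set k := Nat.find hex with hkdef
  clear_value k
  have key : ∀ n, n < k → ((σ * Equiv.swap a b) ^ (n + 1)) a = (σ ^ (n + 1)) b := fun n hn => by
    induction n with
    | zero => simp
    | succ n ih =>
      rw [pow_succ', Equiv.Perm.mul_apply, ih (by omega), Equiv.Perm.mul_apply,
        Equiv.swap_apply_of_ne_of_ne (fun h => hab ?_) (hmin _ (by omega) hn), ← Equiv.Perm.mul_apply,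
        ← pow_succ']
      exact (Equiv.Perm.SameCycle.symm ⟨(n + 1 : ℕ), by rw [zpow_natCast, h]⟩)
  have := key (k - 1) (by omega)
  rw [Nat.sub_add_cancel hk0, hk] at this
  exact ⟨k, by rw [zpow_natCast, this]⟩

/-- Multiplication with a transposition joins two cycles of a permutation or separates one. -/
theorem joins_mul_swap (σ : Equiv.Perm α) {a b : α} (hne : a ≠ b) :
    Joins σ.SameCycle (σ * Equiv.swap a b).SameCycle a b ∨
      Joins (σ * Equiv.swap a b).SameCycle σ.SameCycle a b := by
  have hσ : σ * Equiv.swap a b * Equiv.swap a b = σ := by rw [mul_assoc, Equiv.swap_mul_self, mul_one]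
  by_cases hab : σ.SameCycle a b
  · refine Or.inr ⟨not_sameCycle_mul_swap hne hab, fun x y => ⟨fun h => ?_, fun h => ?_⟩⟩
    · exact joined_of_sameCycle_mul_swap (by rwa [hσ])
    · refine sameCycle_of_joined hab ?_
      have h' := Joined.equivalence (sameCycle_equivalence σ) a b
      have hle : ∀ {x y}, (σ * Equiv.swap a b).SameCycle x y → σ.SameCycle x y := fun h =>
        sameCycle_of_joined hab (joined_of_sameCycle_mul_swap h)
      exact h.imp hle (And.imp (Or.imp hle hle) (Or.imp hle hle))
  · have hab' := sameCycle_mul_swap hab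
    refine Or.inl ⟨hab, fun x y => ⟨joined_of_sameCycle_mul_swap, fun h => ?_⟩⟩
    have hle : ∀ {x y}, σ.SameCycle x y → (σ * Equiv.swap a b).SameCycle x y := fun h =>
      sameCycle_of_joined hab' (joined_of_sameCycle_mul_swap (by rwa [hσ]))
    exact sameCycle_of_joined hab' (h.imp hle (And.imp (Or.imp hle hle) (Or.imp hle hle)))

end Perm

namespace Diagram

variable {U : Set ℂ} {L : Link U} (D : Diagram L)

/-! ### Resolutions as permutations of the edges -/

/-- An orientation of the edges which alternates along the strands of the link. -/
structure Alternating where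
  toFun : Fin D.crossings × Bool → Bool
  map_next : ∀ s, toFun (D.next s) = !toFun s
  map_flip : ∀ s, toFun (D.flip s) = !toFun s

variable {D}

namespace Alternating

/-- The opposite orientation. -/
def neg (a : D.Alternating) : D.Alternating where
  toFun s := !a.toFun s
  map_next s := by rw [a.map_next]
  map_flip s := by rw [a.map_flip]

variable (a : D.Alternating)

lemma map_next_symm (s : Fin D.crossings × Bool) : a.toFun (D.next.symm s) = !a.toFun s := by
  have := a.map_next (D.next.symm s)
  rw [Equiv.apply_symm_apply] at this
  rw [this, Bool.not_not]

/-- The direction in which the edge is traversed. -/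
def orient : D.Edge → Bool
  | Sum.inl s => a.toFun s
  | Sum.inr _ => true

lemma neg_orient_inl (s : Fin D.crossings × Bool) :
    a.neg.orient (Sum.inl s) = !a.orient (Sum.inl s) := rfl

/-- At each crossing both edges of one strand point towards it and both edges of the other strand
away from it. Either resolution joins an edge of one strand to an edge of the other, so walking
never has to reverse the orientation. -/
lemma walk_orient (S : D.Resolution) (e : D.Edge) : D.walk S (e, a.orient e) =
    ((D.walk S (e, a.orient e)).1, a.orient (D.walk S (e, a.orient e)).1) := by
  refine Prod.ext rfl ?_
  rcases e with s | i
  · have h1 := a.map_flip (D.next s)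
    have h2 := a.map_flip s
    simp only [flip] at h1 h2
    rcases h : a.toFun s with _ | _
    · simp only [orient, h, walk]
      split_ifs <;> simp [a.map_next_symm, h2, h]
    · simp only [orient, h, walk]
      split_ifs <;> simp [a.map_next_symm, h1, h, a.map_next]
  · rfl

end Alternating

variable (D)

lemma exists_alternating_at (c : Fin D.crossings) : ∃ a : D.Alternating, a.toFun (c, true) = false := by
  obtain ⟨a, h1, h2⟩ := D.exists_alternating
  let A : D.Alternating := ⟨a, h1, h2⟩
  by_cases h : a (c, true) = false
  · exact ⟨A, h⟩
  · exact ⟨A.neg, by simpa [Alternating.neg, A] using h⟩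

lemma nonempty_alternating : Nonempty D.Alternating := by
  obtain ⟨a, h1, h2⟩ := D.exists_alternating
  exact ⟨⟨a, h1, h2⟩⟩

/-- Reversibility of the walk makes `Alternating.perm` injective. -/
lemma walk_reverse {S : D.Resolution} {e f : D.Edge} {b b' : Bool} (h : D.walk S (e, b) = (f, b')) :
    D.walk S (f, !b') = (e, !b) := by
  rcases e with s | i
  · cases b <;> simp only [walk] at h <;> split_ifs at h with ho <;>
      obtain ⟨rfl, rfl⟩ := Prod.mk.inj h <;> simp [walk, ho]
  · obtain ⟨rfl, rfl⟩ := Prod.mk.inj h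
    rfl

variable {D}

/-- The permutation of the edges given by walking along the circles of a resolution in the direction
of an alternating orientation. -/
def Alternating.perm (a : D.Alternating) (S : D.Resolution) : Equiv.Perm D.Edge :=
  Equiv.ofBijective (fun e => (D.walk S (e, a.orient e)).1) <| Finite.injective_iff_bijective.mp
    fun e f (h : (D.walk S (e, a.orient e)).1 = (D.walk S (f, a.orient f)).1) => by
      have h1 := D.walk_reverse (a.walk_orient S e)
      have h2 := D.walk_reverse (a.walk_orient S f)
      rw [h] at h1
      exact (Prod.mk.inj (h1.symm.trans h2)).1

lemma Alternating.walk_eq (a : D.Alternating) (S : D.Resolution) (e : D.Edge) :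
    D.walk S (e, a.orient e) = (a.perm S e, a.orient (a.perm S e)) := a.walk_orient S e

lemma Alternating.circleOf_perm (a : D.Alternating) (S : D.Resolution) (e : D.Edge) :
    D.circleOf S (a.perm S e) = D.circleOf S e :=
  (Quot.sound ⟨_, _, a.walk_eq S e⟩).symm

/-- The relation defining circles allows steps in either direction. A step against the orientation
follows the opposite orientation, and `walk_reverse` turns it into an inverse step of the
permutation. -/
lemma Alternating.circleOf_eq_iff (a : D.Alternating) (S : D.Resolution) (e f : D.Edge) :
    D.circleOf S e = D.circleOf S f ↔ (a.perm S).SameCycle e f := by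
  classical
  constructor
  · intro h
    replace h := Quot.eqvGen_exact h
    have step : ∀ e f : D.Edge, ∀ b b', D.walk S (e, b) = (f, b') → (a.perm S).SameCycle e f := by
      intro e f b b' h
      by_cases hb : b = a.orient e
      · subst hb
        have : f = a.perm S e := (Prod.mk.inj (h.symm.trans (a.walk_eq S e))).1
        rw [this]
        exact Equiv.Perm.sameCycle_apply_right.mpr (.refl _ _)
      · rcases e with s | i
        · have hb' : b = a.neg.orient (Sum.inl s) := by
            rw [Alternating.neg_orient_inl]; exact Bool.eq_not_of_ne hb
          subst hb'
          have h1 := a.neg.walk_eq S (Sum.inl s)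
          rw [h] at h1
          obtain ⟨rfl, rfl⟩ := Prod.mk.inj h1
          have h2 := D.walk_reverse h
          have h3 : (!(a.neg.orient (a.neg.perm S (Sum.inl s)))) =
              a.orient (a.neg.perm S (Sum.inl s)) := by
            rcases hq : a.neg.perm S (Sum.inl s) with s' | i
            · simp [Alternating.neg_orient_inl]
            · rw [hq] at h2
              cases (Prod.mk.inj h2).1
          rw [h3, a.walk_eq] at h2
          have h4 := (Prod.mk.inj h2).1
          rw [← h4]
          exact (Equiv.Perm.sameCycle_apply_left.mpr (by rw [h4]))
        · obtain ⟨rfl, -⟩ := Prod.mk.inj h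
          exact .refl _ _
    induction h with
    | rel _ _ h => obtain ⟨b, b', h⟩ := h; exact step _ _ b b' h
    | refl _ => exact .refl _ _
    | symm _ _ _ ih => exact ih.symm
    | trans _ _ _ _ _ ih ih' => exact ih.trans ih'
  · intro h
    refine sameCycle_le (r := fun e f => D.circleOf S e = D.circleOf S f)
      ⟨fun _ => rfl, fun h => h.symm, fun h h' => h.trans h'⟩ (fun e => ?_) h
    exact (a.circleOf_perm S e).symm

/-- The edge leaving the crossing `c` on the over-strand. -/
abbrev outEdge (D : Diagram L) (c : Fin D.crossings) : D.Edge := Sum.inl (c, true)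

/-- The edge arriving at the crossing `c` on the over-strand. -/
abbrev inEdge (D : Diagram L) (c : Fin D.crossings) : D.Edge := Sum.inl (D.next.symm (c, true))

/-- The orientation takes opposite values on consecutive edges; in particular no component closes up
after a single passage. -/
lemma Alternating.outEdge_ne_inEdge (a : D.Alternating) (c : Fin D.crossings) :
    D.outEdge c ≠ D.inEdge c := fun h => by
  have := a.map_next_symm (c, true)
  rw [← Sum.inl.inj h] at this
  cases h' : a.toFun (c, true) <;> simp [h'] at this

-- By the choice of `a`, the two edges of the over-strand are the ones pointing towards `c`. Only
-- they continue through `c`, and changing the resolution exchanges their continuations.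
open Classical in
lemma Alternating.perm_update (a : D.Alternating) {c : Fin D.crossings}
    (ha : a.toFun (c, true) = false) {S : D.Resolution} (hS : S c = false) :
    a.perm (Function.update S c true) = a.perm S * Equiv.swap (D.outEdge c) (D.inEdge c) := by
  have hfc : a.toFun (c, false) = true := by
    have := a.map_flip (c, true)
    rwa [ha] at this
  have hor : D.OrientedAt (Function.update S c true) c ↔ ¬ D.OrientedAt S c := by
    simp [OrientedAt, hS]
  have hor' : ∀ c' ≠ c, D.OrientedAt (Function.update S c true) c' ↔ D.OrientedAt S c' :=
    fun c' h => by simp [OrientedAt, h]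
  have hdef : ∀ S e, a.perm S e = (D.walk S (e, a.orient e)).1 := fun _ _ => rfl
  have hin : a.toFun (D.next.symm (c, true)) = true := by rw [a.map_next_symm, ha]; rfl
  ext x
  rw [Equiv.Perm.mul_apply, Equiv.swap_apply_def]
  split_ifs with h1 h2
  · subst h1
    simp only [hdef, Alternating.orient, ha, hin, walk, Equiv.apply_symm_apply, hor]
    by_cases ho : D.OrientedAt S c <;> simp [ho]
  · subst h2
    simp only [hdef, Alternating.orient, ha, hin, walk, Equiv.apply_symm_apply, hor]
    by_cases ho : D.OrientedAt S c <;> simp [ho]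
  · rcases x with s | i
    · rcases hs : a.toFun s with _ | _
      · have hne : s.1 ≠ c := fun h => by
          obtain ⟨c', b⟩ := s
          obtain rfl : c' = c := h
          cases b
          · rw [hfc] at hs; exact absurd hs (by simp)
          · exact h1 rfl
        simp only [hdef, Alternating.orient, hs, walk, hor' _ hne]
      · have hne : (D.next s).1 ≠ c := fun h => by
          have hn := a.map_next s
          rw [hs] at hn
          rcases hq : D.next s with ⟨c', b⟩
          rw [hq] at h hn
          obtain rfl : c' = c := h
          cases b
          · rw [hfc] at hn; exact absurd hn (by simp)
          · exact h2 (congrArg Sum.inl ((Equiv.eq_symm_apply _).mpr hq))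
        simp only [hdef, Alternating.orient, hs, walk, hor' _ hne]
    · rfl

variable (D)

/-- Two edges lie on the same circle of the resolved diagram. -/
def SameCircle (S : D.Resolution) (e f : D.Edge) : Prop := D.circleOf S e = D.circleOf S f

/-- Changing a `0`-resolution to a `1`-resolution in a planar diagram merges two circles or splits a
circle. -/
theorem merge_or_split {S : D.Resolution} {c : Fin D.crossings} (hS : S c = false) :
    Joins (D.SameCircle S) (D.SameCircle (Function.update S c true)) (D.outEdge c) (D.inEdge c) ∨
      Joins (D.SameCircle (Function.update S c true)) (D.SameCircle S)
        (D.outEdge c) (D.inEdge c) := by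
  classical
  obtain ⟨a, ha⟩ := D.exists_alternating_at c
  have h := joins_mul_swap (a.perm S) (a.outEdge_ne_inEdge c)
  rw [← a.perm_update ha hS] at h
  have e : ∀ S, D.SameCircle S = (a.perm S).SameCycle := fun S => by
    funext e f
    exact propext (a.circleOf_eq_iff S e f)
  rwa [e, e]

end Diagram

namespace Diagram

variable {U : Set ℂ} {L : Link U} (D : Diagram L)

/-! ### Enhanced states and the edge maps of the cube of resolutions -/

lemma SameCircle.equivalence (S : D.Resolution) : Equivalence (D.SameCircle S) :=
  ⟨fun _ => rfl, fun h => h.symm, fun h h' => h.trans h'⟩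

variable {D}

lemma circleOf_out {S : D.Resolution} (C : D.Circle S) : D.circleOf S C.out = C := Quot.out_eq C

lemma label_eq_of_sameCircle {x : D.State} {e f : D.Edge} (h : D.SameCircle x.1 e f) :
    D.label x e = D.label x f := congrArg x.2 h

lemma state_ext {x y : D.State} (h : x.1 = y.1) (hl : ∀ e, D.label x e = D.label y e) : x = y := by
  obtain ⟨S, s⟩ := x
  obtain ⟨S', t⟩ := y
  obtain rfl : S = S' := h
  congr 1
  funext C
  rw [← circleOf_out C]
  exact hl C.out

open Classical in
/-- The state on the resolution `S` with signs `s` and `t` on the circles of `e` and `f`, and with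
the signs of the state `x` on the other circles. -/
def relabel (x : D.State) (S : D.Resolution) (e f : D.Edge) (s t : ℤˣ) : D.State :=
  ⟨S, fun C => if C = D.circleOf S e then s else if C = D.circleOf S f then t
    else D.label x C.out⟩

/-- Away from the circles of `e` and `f`, the resolutions `S` and `S'` have the same circles. -/
def AgreeAway (S S' : D.Resolution) (e f : D.Edge) : Prop :=
  (∀ g, (D.SameCircle S g e ∨ D.SameCircle S g f) ↔ (D.SameCircle S' g e ∨ D.SameCircle S' g f)) ∧
  ∀ g h, ¬ D.SameCircle S g e → ¬ D.SameCircle S g f → (D.SameCircle S g h ↔ D.SameCircle S' g h)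

lemma agreeAway_of_joins {S S' : D.Resolution} {e f : D.Edge}
    (h : Joins (D.SameCircle S) (D.SameCircle S') e f) : AgreeAway S S' e f := by
  have hr := SameCircle.equivalence D S
  refine ⟨fun g => ?_, fun g g' he hf => ?_⟩
  · rw [h.2, h.2]
    constructor
    · exact fun h => Or.inl (Or.inr ⟨h, Or.inl (hr.refl _)⟩)
    · rintro ((h | h) | (h | h))
      exacts [Or.inl h, h.1, Or.inr h, h.1]
  · rw [h.2]
    exact ⟨Or.inl, fun h => h.elim id fun h => (h.1.elim he hf).elim⟩

lemma AgreeAway.symm {S S' : D.Resolution} {e f : D.Edge} (h : AgreeAway S S' e f) :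
    AgreeAway S' S e f := by
  refine ⟨fun g => (h.1 g).symm, fun g g' he hf => (h.2 g g' ?_ ?_).symm⟩
  · exact fun h' => ((h.1 g).mp (Or.inl h')).elim he hf
  · exact fun h' => ((h.1 g).mp (Or.inr h')).elim he hf

open Classical in
lemma label_relabel {x : D.State} {S : D.Resolution} {e f : D.Edge} (h : AgreeAway x.1 S e f)
    (s t : ℤˣ) (g : D.Edge) : D.label (relabel x S e f s t) g =
      if D.SameCircle S g e then s else if D.SameCircle S g f then t else D.label x g := by
  change (if D.circleOf S g = D.circleOf S e then s else if D.circleOf S g = D.circleOf S f then t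
    else D.label x (D.circleOf S g).out) = _
  unfold SameCircle
  split_ifs with h1 h2
  · rfl
  · rfl
  · refine label_eq_of_sameCircle ?_
    have := h.symm.2 g (D.circleOf S g).out h1 h2
    exact (this.mp (circleOf_out _).symm).symm

/-- The labels of the states agree on the circles which do not contain `e` or `f`. -/
def AgreeOutside (x y : D.State) (e f : D.Edge) : Prop :=
  ∀ g, D.circleOf x.1 g ≠ D.circleOf x.1 e → D.circleOf x.1 g ≠ D.circleOf x.1 f →
    D.label y g = D.label x g

/-- This names the states that `cubeCoeff` admits as targets, so that the edge maps can be written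
with explicit basis elements. -/
lemma eq_relabel_iff {x y : D.State} {S : D.Resolution} {e f : D.Edge} (h : AgreeAway x.1 S e f)
    (hy : y.1 = S) {s t : ℤˣ} (hst : D.SameCircle S e f → s = t) : y = relabel x S e f s t ↔
      AgreeOutside x y e f ∧ D.label y e = s ∧ D.label y f = t := by
  have hr := SameCircle.equivalence D S
  constructor
  · rintro rfl
    refine ⟨fun g h1 h2 => ?_, ?_, ?_⟩
    · rw [label_relabel h, if_neg fun h' => ((h.1 g).mpr (Or.inl h')).elim h1 h2,
        if_neg fun h' => ((h.1 g).mpr (Or.inr h')).elim h1 h2]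
    · rw [label_relabel h, if_pos (hr.refl e)]
    · rw [label_relabel h, if_pos (hr.refl f)]
      split_ifs with h'
      · exact hst (hr.symm h')
      · rfl
  · rintro ⟨h1, h2, h3⟩
    refine state_ext hy fun g => ?_
    rw [label_relabel h]
    split_ifs with he hf
    · rw [← h2]; exact label_eq_of_sameCircle (hy ▸ he)
    · rw [← h3]; exact label_eq_of_sameCircle (hy ▸ hf)
    · exact h1 g (fun h' => ((h.1 g).mp (Or.inl h')).elim he hf)
        (fun h' => ((h.1 g).mp (Or.inr h')).elim he hf)

variable (K : Type u) [Field K]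

open Classical in
lemma cubeCoeff_of_merge {c : Fin D.crossings} {x y : D.State}
    (h : ¬ D.SameCircle x.1 (D.outEdge c) (D.inEdge c))
    (h' : D.SameCircle y.1 (D.outEdge c) (D.inEdge c)) : D.cubeCoeff K c x y =
      if AgreeOutside x y (D.outEdge c) (D.inEdge c) then
        mergeCoeff K (D.label x (D.outEdge c)) (D.label x (D.inEdge c)) (D.label y (D.outEdge c))
      else 0 := by
  by_cases hA : AgreeOutside x y (D.outEdge c) (D.inEdge c)
  · rw [if_pos hA]
    exact (if_pos hA).trans (if_pos ⟨h, h'⟩)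
  · rw [if_neg hA]
    exact if_neg hA

open Classical in
lemma cubeCoeff_of_split {c : Fin D.crossings} {x y : D.State}
    (h : D.SameCircle x.1 (D.outEdge c) (D.inEdge c))
    (h' : ¬ D.SameCircle y.1 (D.outEdge c) (D.inEdge c)) : D.cubeCoeff K c x y =
      if AgreeOutside x y (D.outEdge c) (D.inEdge c) then
        splitCoeff K (D.label x (D.outEdge c)) (D.label y (D.outEdge c)) (D.label y (D.inEdge c))
      else 0 := by
  by_cases hA : AgreeOutside x y (D.outEdge c) (D.inEdge c)
  · rw [if_pos hA]
    exact (if_pos hA).trans ((if_neg fun h'' => h''.1 h).trans (if_pos ⟨h, h'⟩))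
  · rw [if_neg hA]
    exact if_neg hA

open Classical in
/-- The edge maps of the cube of resolutions at the crossing `c`. -/
def cubeMap (D : Diagram L) (c : Fin D.crossings) : D.CKh K →ₗ[K] D.CKh K :=
  Finsupp.linearCombination K fun x => if x.1 c = false then
    ∑ y, if y.1 = Function.update x.1 c true then Finsupp.single y (D.cubeCoeff K c x y) else 0
    else 0

lemma units_eq (a : ℤˣ) : a = 1 ∨ a = -1 := Int.units_eq_one_or a

lemma neg_one_ne_one : (-1 : ℤˣ) ≠ 1 := by decide

lemma cubeMap_eq_zero {x : D.State} {c : Fin D.crossings} (h : x.1 c = true) :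
    cubeMap K D c (Finsupp.single x 1) = 0 := by
  simp [cubeMap, h]

section

variable {K}

/-- The sign of a product of generators is the product of their signs, except that two negative
generators multiply to zero. -/
lemma cubeMap_single_of_merge {x : D.State} {c : Fin D.crossings} (hx : x.1 c = false)
    (h : Joins (D.SameCircle x.1) (D.SameCircle (Function.update x.1 c true))
      (D.outEdge c) (D.inEdge c)) :
    cubeMap K D c (Finsupp.single x 1) =
      if D.label x (D.outEdge c) = -1 ∧ D.label x (D.inEdge c) = -1 then 0 else
        Finsupp.single (relabel x (Function.update x.1 c true) (D.outEdge c) (D.inEdge c)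
          (D.label x (D.outEdge c) * D.label x (D.inEdge c))
          (D.label x (D.outEdge c) * D.label x (D.inEdge c))) 1 := by
  classical
  have hag := agreeAway_of_joins h
  have h' : D.SameCircle (Function.update x.1 c true) (D.outEdge c) (D.inEdge c) :=
    (h.2 _ _).mpr (Or.inr ⟨Or.inl rfl, Or.inr rfl⟩)
  set S := Function.update x.1 c true with hS
  set m := D.label x (D.outEdge c) * D.label x (D.inEdge c) with hm
  have key : ∀ y : D.State, (if y.1 = S then Finsupp.single y (D.cubeCoeff K c x y) else 0) =
      if y = relabel x S (D.outEdge c) (D.inEdge c) m m then Finsupp.single y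
        (if D.label x (D.outEdge c) = -1 ∧ D.label x (D.inEdge c) = -1 then 0 else 1) else 0 := by
    intro y
    by_cases hy : y.1 = S
    · have hyl : D.label y (D.outEdge c) = D.label y (D.inEdge c) :=
        label_eq_of_sameCircle (hy ▸ h')
      rw [if_pos hy, cubeCoeff_of_merge K h.1 (hy ▸ h')]
      simp only [eq_relabel_iff hag hy (fun _ => rfl), ← hyl]
      by_cases hall : AgreeOutside x y (D.outEdge c) (D.inEdge c)
      · rw [if_pos hall, mergeCoeff, hm]
        rcases units_eq (D.label x (D.outEdge c)) with h1 | h1 <;>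
          rcases units_eq (D.label x (D.inEdge c)) with h2 | h2 <;>
          rcases units_eq (D.label y (D.outEdge c)) with h3 | h3 <;>
          simp [h1, h2, h3, hall, neg_one_ne_one.symm]
      · simp [hall]
    · rw [if_neg hy, if_neg]
      rintro rfl
      exact hy rfl
  rw [cubeMap, Finsupp.linearCombination_single, one_smul, if_pos hx,
    Finset.sum_congr rfl fun y _ => key y, Finset.sum_ite_eq' Finset.univ, if_pos (Finset.mem_univ _)]
  split_ifs
  · rw [Finsupp.single_zero]
  · rfl

lemma cubeMap_single_of_split {x : D.State} {c : Fin D.crossings} (hx : x.1 c = false)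
    (h : Joins (D.SameCircle (Function.update x.1 c true)) (D.SameCircle x.1)
      (D.outEdge c) (D.inEdge c)) :
    cubeMap K D c (Finsupp.single x 1) =
      if D.label x (D.outEdge c) = -1 then
        Finsupp.single (relabel x (Function.update x.1 c true) (D.outEdge c) (D.inEdge c)
          (-1) (-1)) 1
      else Finsupp.single (relabel x (Function.update x.1 c true) (D.outEdge c) (D.inEdge c)
          1 (-1)) 1 + Finsupp.single (relabel x (Function.update x.1 c true) (D.outEdge c)
          (D.inEdge c) (-1) 1) 1 := by
  classical
  have hag := (agreeAway_of_joins h).symm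
  have h' : D.SameCircle x.1 (D.outEdge c) (D.inEdge c) :=
    (h.2 _ _).mpr (Or.inr ⟨Or.inl rfl, Or.inr rfl⟩)
  set S := Function.update x.1 c true with hS
  have key : ∀ y : D.State, (if y.1 = S then Finsupp.single y (D.cubeCoeff K c x y) else 0) =
      if D.label x (D.outEdge c) = -1 then
        (if y = relabel x S (D.outEdge c) (D.inEdge c) (-1) (-1) then Finsupp.single y 1 else 0)
      else (if y = relabel x S (D.outEdge c) (D.inEdge c) 1 (-1) then Finsupp.single y 1 else 0) +
        (if y = relabel x S (D.outEdge c) (D.inEdge c) (-1) 1 then Finsupp.single y 1 else 0) := by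
    intro y
    by_cases hy : y.1 = S
    · rw [if_pos hy, cubeCoeff_of_split K h' (hy ▸ h.1)]
      have hst : ∀ s t : ℤˣ, D.SameCircle S (D.outEdge c) (D.inEdge c) → s = t :=
        fun _ _ h'' => absurd h'' h.1
      simp only [eq_relabel_iff hag hy (hst _ _)]
      by_cases hall : AgreeOutside x y (D.outEdge c) (D.inEdge c)
      · rw [if_pos hall, splitCoeff]
        rcases units_eq (D.label x (D.outEdge c)) with h1 | h1 <;>
          rcases units_eq (D.label y (D.inEdge c)) with h2 | h2 <;>
          rcases units_eq (D.label y (D.outEdge c)) with h3 | h3 <;>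
          simp [h1, h2, h3, hall, neg_one_ne_one.symm]
      · simp [hall]
    · have : ∀ s t, y ≠ relabel x S (D.outEdge c) (D.inEdge c) s t := by
        rintro s t rfl
        exact hy rfl
      simp [hy, this]
  rw [cubeMap, Finsupp.linearCombination_single, one_smul, if_pos hx,
    Finset.sum_congr rfl fun y _ => key y]
  split_ifs
  · simp
  · rw [Finset.sum_add_distrib]
    simp

end

end Diagram

namespace Diagram

variable {U : Set ℂ} {L : Link U} {D : Diagram L}

/-! ### The action of the edges -/

open Classical in
/-- The state `x` with sign `s` on the circle of `g`. -/
def setSign (x : D.State) (g : D.Edge) (s : ℤˣ) : D.State :=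
  ⟨x.1, Function.update x.2 (D.circleOf x.1 g) s⟩

open Classical in
lemma label_setSign (x : D.State) (g : D.Edge) (s : ℤˣ) (h : D.Edge) :
    D.label (setSign x g s) h = if D.SameCircle x.1 h g then s else D.label x h := by
  by_cases hg : D.SameCircle x.1 h g
  · rw [if_pos hg]
    exact (congrArg (Function.update x.2 (D.circleOf x.1 g) s) hg).trans (Function.update_self ..)
  · rw [if_neg hg]
    exact Function.update_of_ne hg _ _

/-- The state all of whose circles are positive. -/
def posState (S : D.Resolution) : D.State := ⟨S, fun _ => 1⟩

lemma label_posState (S : D.Resolution) (e : D.Edge) : D.label (posState S) e = 1 := rfl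

variable (K : Type u) [Field K]

open Classical in
/-- The multiplication with the negative generator on the circle of the edge `g`. -/
def edgeAct (g : D.Edge) : D.CKh K →ₗ[K] D.CKh K :=
  Finsupp.linearCombination K fun x =>
    if D.label x g = 1 then Finsupp.single (setSign x g (-1)) 1 else 0

variable {K}

lemma edgeAct_single_of_pos {x : D.State} {g : D.Edge} (h : D.label x g = 1) :
    edgeAct K g (Finsupp.single x 1) = Finsupp.single (setSign x g (-1)) 1 := by
  rw [edgeAct, Finsupp.linearCombination_single, one_smul, if_pos h]

lemma edgeAct_single_of_neg {x : D.State} {g : D.Edge} (h : D.label x g = -1) :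
    edgeAct K g (Finsupp.single x 1) = 0 := by
  rw [edgeAct, Finsupp.linearCombination_single, one_smul, if_neg (by rw [h]; decide)]

lemma edgeAct_single_congr {x : D.State} {g h : D.Edge} (hgh : D.SameCircle x.1 g h) :
    edgeAct K g (Finsupp.single x 1) = edgeAct K h (Finsupp.single x 1) := by
  have hl := label_eq_of_sameCircle hgh
  rcases units_eq (D.label x h) with hx | hx
  · rw [edgeAct_single_of_pos hx, edgeAct_single_of_pos (hl.trans hx), setSign, setSign,
      show D.circleOf x.1 g = D.circleOf x.1 h from hgh]
  · rw [edgeAct_single_of_neg hx, edgeAct_single_of_neg (hl.trans hx)]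

lemma linearMap_ext_single {T T' : D.CKh K →ₗ[K] D.CKh K}
    (h : ∀ x, T (Finsupp.single x 1) = T' (Finsupp.single x 1)) : T = T' :=
  Finsupp.lhom_ext' fun x => LinearMap.ext_ring (h x)

lemma edgeAct_comm (g h : D.Edge) :
    edgeAct K g ∘ₗ edgeAct K h = edgeAct (D := D) K h ∘ₗ edgeAct K g := by
  classical
  refine linearMap_ext_single fun x => ?_
  simp only [LinearMap.comp_apply]
  by_cases hgh : D.SameCircle x.1 g h
  · rw [edgeAct_single_congr hgh]
    rcases units_eq (D.label x h) with hx | hx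
    · rw [edgeAct_single_of_pos hx]
      exact edgeAct_single_congr hgh
    · rw [edgeAct_single_of_neg hx, map_zero, map_zero]
  · have hhg : ¬ D.SameCircle x.1 h g := fun h' => hgh h'.symm
    have hg : ∀ s, D.label (setSign x h s) g = D.label x g := fun s => by
      rw [label_setSign, if_neg hgh]
    have hh : ∀ s, D.label (setSign x g s) h = D.label x h := fun s => by
      rw [label_setSign, if_neg hhg]
    rcases units_eq (D.label x h) with hx | hx <;> rcases units_eq (D.label x g) with hx' | hx'
    · rw [edgeAct_single_of_pos hx, edgeAct_single_of_pos hx',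
        edgeAct_single_of_pos ((hg _).trans hx'), edgeAct_single_of_pos ((hh _).trans hx)]
      congr 1
      refine state_ext rfl fun e => ?_
      have e1 : ∀ g s, (setSign x g s).1 = x.1 := fun _ _ => rfl
      simp only [label_setSign, e1]
      split_ifs <;> rfl
    · rw [edgeAct_single_of_pos hx, edgeAct_single_of_neg hx', edgeAct_single_of_neg
        ((hg _).trans hx'), map_zero]
    · rw [edgeAct_single_of_neg hx, edgeAct_single_of_pos hx', edgeAct_single_of_neg
        ((hh _).trans hx), map_zero]
    · rw [edgeAct_single_of_neg hx, edgeAct_single_of_neg hx', map_zero, map_zero]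

/-- The action of the edges generates the Khovanov complex from the positive states. -/
lemma linearMap_ext_of_commute {T T' : D.CKh K →ₗ[K] D.CKh K}
    (hT : ∀ g, T ∘ₗ edgeAct K g = edgeAct K g ∘ₗ T)
    (hT' : ∀ g, T' ∘ₗ edgeAct K g = edgeAct K g ∘ₗ T')
    (h : ∀ S, T (Finsupp.single (posState S) 1) = T' (Finsupp.single (posState S) 1)) : T = T' := by
  classical
  -- Induction on the number of negative edges: making one negative circle positive lowers it, and
  -- the action of an edge on that circle recovers the state.
  have key : ∀ n (x : D.State), (Finset.univ.filter fun e => D.label x e = -1).card = n →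
      T (Finsupp.single x 1) = T' (Finsupp.single x 1) := by
    intro n
    induction n using Nat.strong_induction_on with
    | _ n ih =>
    intro x hx
    rcases (Finset.univ.filter fun e => D.label x e = -1).eq_empty_or_nonempty with he | ⟨e, he⟩
    · have : x = posState x.1 := by
        refine state_ext rfl fun e => (units_eq _).resolve_right ?_
        exact Finset.filter_eq_empty_iff.mp he (Finset.mem_univ e)
      rw [this]
      exact h _
    · replace he : D.label x e = -1 := (Finset.mem_filter.mp he).2
      have hl : D.label (setSign x e 1) e = 1 := by rw [label_setSign]; exact if_pos rfl
      have hx₀x : setSign (setSign x e 1) e (-1) = x := by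
        refine state_ext rfl fun f => ?_
        rw [label_setSign, label_setSign]
        change (if D.SameCircle x.1 f e then _ else _) = _
        split_ifs with hf
        · exact ((label_eq_of_sameCircle hf).trans he).symm
        · rfl
      have hcard : (Finset.univ.filter fun f => D.label (setSign x e 1) f = -1).card < n := by
        rw [← hx]
        refine Finset.card_lt_card ⟨fun f hf => ?_, fun hsub => ?_⟩
        · rw [Finset.mem_filter, label_setSign] at hf
          refine Finset.mem_filter.mpr ⟨Finset.mem_univ f, ?_⟩
          by_cases hfe : D.SameCircle x.1 f e
          · rw [if_pos hfe] at hf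
            exact absurd hf.2.symm neg_one_ne_one
          · rw [if_neg hfe] at hf
            exact hf.2
        · have := (Finset.mem_filter.mp (hsub (Finset.mem_filter.mpr ⟨Finset.mem_univ e, he⟩))).2
          rw [hl] at this
          exact neg_one_ne_one this.symm
      have hs : Finsupp.single x (1 : K) = edgeAct K e (Finsupp.single (setSign x e 1) 1) := by
        rw [edgeAct_single_of_pos hl, hx₀x]
      rw [hs, ← LinearMap.comp_apply, ← LinearMap.comp_apply, hT, hT', LinearMap.comp_apply,
        LinearMap.comp_apply, ih _ hcard _ rfl]
  exact linearMap_ext_single fun x => key _ x rfl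

/-! ### The edge maps are linear over the action of the edges -/

section Relabel

variable {x : D.State} {S : D.Resolution} {e f g : D.Edge} {s t : ℤˣ}

lemma setSign_relabel_outside (h : AgreeAway x.1 S e f) (he : ¬ D.SameCircle x.1 g e)
    (hf : ¬ D.SameCircle x.1 g f) :
    setSign (relabel x S e f s t) g (-1) = relabel (setSign x g (-1)) S e f s t := by
  classical
  refine state_ext rfl fun k => ?_
  have he' : ¬ D.SameCircle S g e := fun h' => ((h.1 g).mpr (Or.inl h')).elim he hf
  have hf' : ¬ D.SameCircle S g f := fun h' => ((h.1 g).mpr (Or.inr h')).elim he hf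
  have hk : D.SameCircle S k g ↔ D.SameCircle x.1 k g :=
    ⟨fun h' => ((h.2 g k he hf).mpr h'.symm).symm, fun h' => ((h.2 g k he hf).mp h'.symm).symm⟩
  rw [label_setSign, label_relabel h, label_relabel (x := setSign x g (-1)) h, label_setSign]
  change (if D.SameCircle S k g then _ else _) = _
  by_cases hkg : D.SameCircle S k g
  · rw [if_pos hkg, if_neg (c := D.SameCircle S k e) fun h' => he' (hkg.symm.trans h'),
      if_neg (c := D.SameCircle S k f) fun h' => hf' (hkg.symm.trans h'), if_pos (hk.mp hkg)]
  · rw [if_neg hkg, if_neg fun h' => hkg (hk.mpr h')]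

lemma setSign_relabel_left (h : AgreeAway x.1 S e f) :
    setSign (relabel x S e f s t) e (-1) =
      relabel x S e f (-1) (haveI := Classical.propDecidable (D.SameCircle S e f);
        if D.SameCircle S e f then -1 else t) := by
  classical
  refine state_ext rfl fun k => ?_
  rw [label_setSign, label_relabel h, label_relabel h]
  change (if D.SameCircle S k e then _ else _) = _
  split_ifs with h1 h2 h3 <;> first | rfl | exact absurd (h2.trans h3.symm) h1

lemma setSign_relabel_right (h : AgreeAway x.1 S e f) (hst : ¬ D.SameCircle S e f) :
    setSign (relabel x S e f s t) f (-1) = relabel x S e f s (-1) := by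
  classical
  refine state_ext rfl fun k => ?_
  rw [label_setSign, label_relabel h, label_relabel h]
  change (if D.SameCircle S k f then _ else _) = _
  split_ifs with h1 h2 <;> first | rfl | exact absurd (h2.symm.trans h1) hst

lemma relabel_setSign_inside (h : AgreeAway x.1 S e f)
    (hg : D.SameCircle x.1 g e ∨ D.SameCircle x.1 g f) (a : ℤˣ) :
    relabel (setSign x g a) S e f s t = relabel x S e f s t := by
  classical
  refine state_ext rfl fun k => ?_
  rw [label_relabel h, label_relabel (x := setSign x g a) h, label_setSign]
  split_ifs with h1 h2 h3
  · rfl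
  · rfl
  · have : D.SameCircle x.1 k e ∨ D.SameCircle x.1 k f := hg.imp h3.trans h3.trans
    exact (((h.1 k).mp this).elim h1 h2).elim
  · rfl

end Relabel

end Diagram

namespace Diagram

variable {U : Set ℂ} {L : Link U} {D : Diagram L} {K : Type u} [Field K]

lemma edgeAct_relabel_outside {x : D.State} {S : D.Resolution} {e f g : D.Edge} {s t : ℤˣ}
    (h : AgreeAway x.1 S e f) (he : ¬ D.SameCircle x.1 g e)
    (hf : ¬ D.SameCircle x.1 g f) : edgeAct K g (Finsupp.single (relabel x S e f s t) 1) =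
      if D.label x g = 1 then Finsupp.single (relabel (setSign x g (-1)) S e f s t) 1 else 0 := by
  classical
  have hl : D.label (relabel x S e f s t) g = D.label x g := by
    rw [label_relabel h, if_neg fun h' => ((h.1 g).mpr (Or.inl h')).elim he hf,
        if_neg fun h' => ((h.1 g).mpr (Or.inr h')).elim he hf]
  split_ifs with hg
  · rw [edgeAct_single_of_pos (hl.trans hg), setSign_relabel_outside h he hf]
  · exact edgeAct_single_of_neg (hl.trans ((units_eq _).resolve_left hg))

lemma edgeAct_relabel_left {x : D.State} {S : D.Resolution} {e f g : D.Edge} {s t : ℤˣ}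
    (h : AgreeAway x.1 S e f) (hef : ¬ D.SameCircle S e f) (hg : D.SameCircle S g e) :
    edgeAct K g (Finsupp.single (relabel x S e f s t) 1) =
      if s = 1 then Finsupp.single (relabel x S e f (-1) t) 1 else 0 := by
  classical
  have hl : D.label (relabel x S e f s t) e = s := by rw [label_relabel h]; exact if_pos rfl
  have hg' : D.SameCircle (relabel x S e f s t).1 g e := hg
  rw [edgeAct_single_congr hg']
  split_ifs with hs
  · rw [edgeAct_single_of_pos (hl.trans hs), setSign_relabel_left h, if_neg hef]
  · exact edgeAct_single_of_neg (hl.trans ((units_eq _).resolve_left hs))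

lemma edgeAct_relabel_merged {x : D.State} {S : D.Resolution} {e f g : D.Edge} {s : ℤˣ}
    (h : AgreeAway x.1 S e f) (hef : D.SameCircle S e f) (hg : D.SameCircle S g e) :
    edgeAct K g (Finsupp.single (relabel x S e f s s) 1) =
      if s = 1 then Finsupp.single (relabel x S e f (-1) (-1)) 1 else 0 := by
  classical
  have hl : D.label (relabel x S e f s s) e = s := by rw [label_relabel h]; exact if_pos rfl
  have hg' : D.SameCircle (relabel x S e f s s).1 g e := hg
  rw [edgeAct_single_congr hg']
  split_ifs with hs
  · rw [edgeAct_single_of_pos (hl.trans hs), setSign_relabel_left h, if_pos hef]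
  · exact edgeAct_single_of_neg (hl.trans ((units_eq _).resolve_left hs))

lemma edgeAct_relabel_right {x : D.State} {S : D.Resolution} {e f g : D.Edge} {s t : ℤˣ}
    (h : AgreeAway x.1 S e f) (hef : ¬ D.SameCircle S e f) (hg : D.SameCircle S g f) :
    edgeAct K g (Finsupp.single (relabel x S e f s t) 1) =
      if t = 1 then Finsupp.single (relabel x S e f s (-1)) 1 else 0 := by
  classical
  have hl : D.label (relabel x S e f s t) f = t := by
    rw [label_relabel h, if_neg fun h' : D.SameCircle S f e => hef h'.symm]
    exact if_pos rfl
  have hg' : D.SameCircle (relabel x S e f s t).1 g f := hg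
  rw [edgeAct_single_congr hg']
  split_ifs with hs
  · rw [edgeAct_single_of_pos (hl.trans hs), setSign_relabel_right h hef]
  · exact edgeAct_single_of_neg (hl.trans ((units_eq _).resolve_left hs))

variable (K)

/-- The edge maps of the cube of resolutions are linear over the action of the edges. -/
lemma cubeMap_comp_edgeAct (c : Fin D.crossings) (g : D.Edge) :
    cubeMap K D c ∘ₗ edgeAct K g = edgeAct K g ∘ₗ cubeMap K D c := by
  classical
  refine linearMap_ext_single fun x => ?_
  simp only [LinearMap.comp_apply]
  rcases hx : x.1 c with _ | _
  swap
  · rw [cubeMap_eq_zero K hx, map_zero]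
    rcases units_eq (D.label x g) with hl | hl
    · rw [edgeAct_single_of_pos hl]
      exact cubeMap_eq_zero K hx
    · rw [edgeAct_single_of_neg hl, map_zero]
  set S := Function.update x.1 c true with hS
  have hpos : D.label x g = 1 →
      edgeAct K g (Finsupp.single x 1) = Finsupp.single (setSign x g (-1)) 1 :=
    edgeAct_single_of_pos
  have hneg : D.label x g = -1 → edgeAct K g (Finsupp.single x 1) = 0 := edgeAct_single_of_neg
  -- The action of `g` multiplies by the negative generator on its circle. For a merge the claim is
  -- associativity and commutativity of the multiplication; for a split it is linearity of the
  -- comultiplication over multiplication on either factor.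
  rcases D.merge_or_split hx with h | h
  · have hag : AgreeAway x.1 S (D.outEdge c) (D.inEdge c) := agreeAway_of_joins h
    have hef : D.SameCircle S (D.outEdge c) (D.inEdge c) :=
      (h.2 _ _).mpr (Or.inr ⟨Or.inl rfl, Or.inr rfl⟩)
    have hm := cubeMap_single_of_merge (K := K) hx h
    rw [← hS] at hm
    have hm' : cubeMap K D c (Finsupp.single (setSign x g (-1)) 1) =
        if D.label (setSign x g (-1)) (D.outEdge c) = -1 ∧
          D.label (setSign x g (-1)) (D.inEdge c) = -1 then 0 else
          Finsupp.single (relabel (setSign x g (-1)) S (D.outEdge c) (D.inEdge c)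
          (D.label (setSign x g (-1)) (D.outEdge c) * D.label (setSign x g (-1)) (D.inEdge c))
          (D.label (setSign x g (-1)) (D.outEdge c) * D.label (setSign x g (-1)) (D.inEdge c))) 1 :=
      cubeMap_single_of_merge (x := setSign x g (-1)) hx h
    by_cases hg : D.SameCircle x.1 g (D.outEdge c) ∨ D.SameCircle x.1 g (D.inEdge c)
    · have hge : D.SameCircle S g (D.outEdge c) :=
        ((hag.1 g).mp hg).elim id fun h' => h'.trans hef.symm
      rw [relabel_setSign_inside hag hg] at hm'
      have hact : ∀ s, edgeAct K g (Finsupp.single (relabel x S (D.outEdge c) (D.inEdge c) s s) 1) =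
          _ := fun s => edgeAct_relabel_merged (K := K) (s := s) hag hef hge
      rcases hg with hg | hg
      · have h1 : D.label x g = D.label x (D.outEdge c) := label_eq_of_sameCircle hg
        have h2 : D.label (setSign x g (-1)) (D.outEdge c) = -1 := by
          rw [label_setSign]; exact if_pos hg.symm
        have h3 : D.label (setSign x g (-1)) (D.inEdge c) = D.label x (D.inEdge c) := by
          rw [label_setSign]; exact if_neg fun h' => h.1 (hg.symm.trans h'.symm)
        rw [h1] at hpos hneg
        rw [h2, h3] at hm'
        rcases units_eq (D.label x (D.outEdge c)) with ho | ho <;>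
          rcases units_eq (D.label x (D.inEdge c)) with hi | hi <;>
          simp [hm, hm', hpos, hneg, ho, hi, hact, neg_one_ne_one.symm]
      · have h1 : D.label x g = D.label x (D.inEdge c) := label_eq_of_sameCircle hg
        have h2 : D.label (setSign x g (-1)) (D.inEdge c) = -1 := by
          rw [label_setSign]; exact if_pos hg.symm
        have h3 : D.label (setSign x g (-1)) (D.outEdge c) = D.label x (D.outEdge c) := by
          rw [label_setSign]; exact if_neg fun h' => h.1 (h'.trans hg)
        rw [h1] at hpos hneg
        rw [h2, h3] at hm'
        rcases units_eq (D.label x (D.outEdge c)) with ho | ho <;>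
          rcases units_eq (D.label x (D.inEdge c)) with hi | hi <;>
          simp [hm, hm', hpos, hneg, ho, hi, hact, neg_one_ne_one.symm]
    · obtain ⟨hgo, hgi⟩ := not_or.mp hg
      have h2 : D.label (setSign x g (-1)) (D.outEdge c) = D.label x (D.outEdge c) := by
        rw [label_setSign]; exact if_neg fun h' => hgo h'.symm
      have h3 : D.label (setSign x g (-1)) (D.inEdge c) = D.label x (D.inEdge c) := by
        rw [label_setSign]; exact if_neg fun h' => hgi h'.symm
      rw [h2, h3] at hm'
      rw [hm]
      rcases units_eq (D.label x g) with hl | hl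
      · rw [hpos hl, hm']
        split_ifs with h'
        · rw [map_zero]
        · rw [edgeAct_relabel_outside hag hgo hgi, if_pos hl]
      · rw [hneg hl, map_zero]
        split_ifs with h'
        · rw [map_zero]
        · rw [edgeAct_relabel_outside hag hgo hgi, hl, if_neg neg_one_ne_one]
  · have hag : AgreeAway x.1 S (D.outEdge c) (D.inEdge c) := (agreeAway_of_joins h).symm
    have hef : D.SameCircle x.1 (D.outEdge c) (D.inEdge c) :=
      (h.2 _ _).mpr (Or.inr ⟨Or.inl rfl, Or.inr rfl⟩)
    have hm := cubeMap_single_of_split (K := K) hx h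
    rw [← hS] at hm
    have hm' : cubeMap K D c (Finsupp.single (setSign x g (-1)) 1) =
        if D.label (setSign x g (-1)) (D.outEdge c) = -1 then
          Finsupp.single (relabel (setSign x g (-1)) S (D.outEdge c) (D.inEdge c) (-1) (-1)) 1
        else Finsupp.single (relabel (setSign x g (-1)) S (D.outEdge c) (D.inEdge c) 1 (-1)) 1 +
          Finsupp.single (relabel (setSign x g (-1)) S (D.outEdge c) (D.inEdge c) (-1) 1) 1 :=
      cubeMap_single_of_split (x := setSign x g (-1)) hx h
    by_cases hg : D.SameCircle x.1 g (D.outEdge c) ∨ D.SameCircle x.1 g (D.inEdge c)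
    · rw [relabel_setSign_inside hag hg, relabel_setSign_inside hag hg,
        relabel_setSign_inside hag hg] at hm'
      have hgo : D.SameCircle x.1 g (D.outEdge c) := hg.elim id fun h' => h'.trans hef.symm
      have h1 : D.label x g = D.label x (D.outEdge c) := label_eq_of_sameCircle hgo
      have h2 : D.label (setSign x g (-1)) (D.outEdge c) = -1 := by
        rw [label_setSign]; exact if_pos hgo.symm
      rw [h1] at hpos hneg
      rw [h2] at hm'
      rcases (hag.1 g).mp hg with hg' | hg'
      · have hact : ∀ s t, edgeAct K g
            (Finsupp.single (relabel x S (D.outEdge c) (D.inEdge c) s t) 1) = _ :=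
          fun s t => edgeAct_relabel_left (K := K) (s := s) (t := t) hag h.1 hg'
        rcases units_eq (D.label x (D.outEdge c)) with ho | ho <;>
          simp [hm, hm', hpos, hneg, ho, hact, neg_one_ne_one.symm]
      · have hact : ∀ s t, edgeAct K g
            (Finsupp.single (relabel x S (D.outEdge c) (D.inEdge c) s t) 1) = _ :=
          fun s t => edgeAct_relabel_right (K := K) (s := s) (t := t) hag h.1 hg'
        rcases units_eq (D.label x (D.outEdge c)) with ho | ho <;>
          simp [hm, hm', hpos, hneg, ho, hact, neg_one_ne_one.symm]
    · obtain ⟨hgo, hgi⟩ := not_or.mp hg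
      have h2 : D.label (setSign x g (-1)) (D.outEdge c) = D.label x (D.outEdge c) := by
        rw [label_setSign]; exact if_neg fun h' => hgo h'.symm
      have hact : ∀ s t, edgeAct K g
          (Finsupp.single (relabel x S (D.outEdge c) (D.inEdge c) s t) 1) = _ :=
        fun s t => edgeAct_relabel_outside (K := K) (s := s) (t := t) hag hgo hgi
      rw [h2] at hm'
      rcases units_eq (D.label x (D.outEdge c)) with ho | ho <;>
        rcases units_eq (D.label x g) with hl | hl <;>
        simp [hm, hm', hpos, hneg, ho, hl, hact, neg_one_ne_one.symm]

end Diagram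

namespace Diagram

variable {U : Set ℂ} {L : Link U} {D : Diagram L}

/-! ### Sums over the circles of a resolution -/

lemma SameCircle.of_joins {S S' : D.Resolution} {e f g h : D.Edge}
    (hj : Joins (D.SameCircle S) (D.SameCircle S') e f) (hgh : D.SameCircle S g h) :
    D.SameCircle S' g h := (hj.2 g h).mpr (Or.inl hgh)

/-- Circles away from `e` and `f` correspond bijectively, so the sums differ only in two terms on
one side and one on the other. The count of circles and all degree computations for `∂` come from
this. -/
lemma sum_circle_of_joins {A : Type*} [AddCommGroup A] {S S' : D.Resolution} {e f : D.Edge}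
    (h : Joins (D.SameCircle S) (D.SameCircle S') e f) {F : D.Circle S → A} {F' : D.Circle S' → A}
    (hF : ∀ g, ¬ D.SameCircle S g e → ¬ D.SameCircle S g f →
      F (D.circleOf S g) = F' (D.circleOf S' g)) :
    ∑ C, F C = ∑ C, F' C + (F (D.circleOf S e) + F (D.circleOf S f) - F' (D.circleOf S' e)) := by
  classical
  have hag := agreeAway_of_joins h
  have hout : ∀ {S} (C : D.Circle S), D.circleOf S C.out = C := fun C => circleOf_out C
  have h1 : ∑ C, F C = F (D.circleOf S e) + (F (D.circleOf S f) +
      ∑ C ∈ (Finset.univ.erase (D.circleOf S e)).erase (D.circleOf S f), F C) := by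
    rw [Finset.add_sum_erase _ F (Finset.mem_erase.mpr ⟨fun h' => h.1 h'.symm, Finset.mem_univ _⟩),
      Finset.add_sum_erase _ F (Finset.mem_univ _)]
  have h2 : ∑ C, F' C = F' (D.circleOf S' e) + ∑ C ∈ Finset.univ.erase (D.circleOf S' e), F' C := by
    rw [Finset.add_sum_erase _ F' (Finset.mem_univ _)]
  have h3 : ∑ C ∈ (Finset.univ.erase (D.circleOf S e)).erase (D.circleOf S f), F C =
      ∑ C ∈ Finset.univ.erase (D.circleOf S' e), F' C := by
    have hef : D.SameCircle S' e f := (h.2 _ _).mpr (Or.inr ⟨Or.inl rfl, Or.inr rfl⟩)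
    have hmem : ∀ C, C ∈ (Finset.univ.erase (D.circleOf S e)).erase (D.circleOf S f) ↔
        ¬ D.SameCircle S C.out e ∧ ¬ D.SameCircle S C.out f := fun C => by
      simp only [Finset.mem_erase, Finset.mem_univ, and_true, SameCircle, hout, ne_eq]
      tauto
    refine Finset.sum_bij (fun C _ => D.circleOf S' C.out) (fun C hC => ?_) (fun C hC C' hC' he => ?_)
      (fun C hC => ?_) (fun C hC => ?_)
    · obtain ⟨he, hf⟩ := (hmem C).mp hC
      exact Finset.mem_erase.mpr ⟨fun h' => ((hag.1 _).mpr (Or.inl h')).elim he hf,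
        Finset.mem_univ _⟩
    · obtain ⟨he', hf'⟩ := (hmem C).mp hC
      have := (hag.2 C.out C'.out he' hf').mpr he
      rwa [SameCircle, hout, hout] at this
    · have hne : ¬ D.SameCircle S' C.out e := by
        rw [SameCircle, hout]
        exact (Finset.mem_erase.mp hC).1
      have hne' : ¬ D.SameCircle S' C.out f := fun h' => hne (h'.trans hef.symm)
      have hs : D.SameCircle S (D.circleOf S C.out).out C.out := hout _
      refine ⟨D.circleOf S C.out, (hmem _).mpr ⟨fun h' => ?_, fun h' => ?_⟩, ?_⟩
      · exact ((hag.1 _).mp (Or.inl (hs.symm.trans h'))).elim hne hne'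
      · exact ((hag.1 _).mp (Or.inr (hs.symm.trans h'))).elim hne hne'
      · exact (hs.of_joins h).trans (hout C)
    · obtain ⟨he, hf⟩ := (hmem C).mp hC
      rw [← hF C.out he hf, hout]
  rw [h1, h2, h3]
  abel

lemma card_circle_of_joins {S S' : D.Resolution} {e f : D.Edge}
    (h : Joins (D.SameCircle S) (D.SameCircle S') e f) :
    Fintype.card (D.Circle S) = Fintype.card (D.Circle S') + 1 := by
  have := sum_circle_of_joins h (F := fun _ => (1 : ℤ)) (F' := fun _ => 1) fun _ _ _ => rfl
  simp only [Finset.sum_const, Finset.card_univ, nsmul_eq_mul, mul_one] at this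
  omega

/-! ### The square of the differential -/

variable (K : Type u) [Field K]

lemma cubeMap_posState_of_merge {S : D.Resolution} {c : Fin D.crossings} (hS : S c = false)
    (h : Joins (D.SameCircle S) (D.SameCircle (Function.update S c true))
      (D.outEdge c) (D.inEdge c)) :
    cubeMap K D c (Finsupp.single (posState S) 1) =
      Finsupp.single (posState (Function.update S c true)) 1 := by
  classical
  rw [cubeMap_single_of_merge (x := posState S) hS h, label_posState, label_posState,
    if_neg fun h' => neg_one_ne_one h'.1.symm]
  congr 1
  refine state_ext rfl fun e => ?_
  refine (label_relabel (x := posState S) (agreeAway_of_joins h) _ _ e).trans ?_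
  split_ifs <;> rfl

/-- The comultiplication of the unit is the sum of the negative generators on the two new circles.
Written through `edgeAct`, it can be moved past further edge maps. -/
lemma cubeMap_posState_of_split {S : D.Resolution} {c : Fin D.crossings} (hS : S c = false)
    (h : Joins (D.SameCircle (Function.update S c true)) (D.SameCircle S)
      (D.outEdge c) (D.inEdge c)) :
    cubeMap K D c (Finsupp.single (posState S) 1) =
      edgeAct K (D.outEdge c) (Finsupp.single (posState (Function.update S c true)) 1) +
      edgeAct K (D.inEdge c) (Finsupp.single (posState (Function.update S c true)) 1) := by
  classical
  have hag := (agreeAway_of_joins h).symm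
  rw [cubeMap_single_of_split (x := posState S) hS h, label_posState,
    if_neg neg_one_ne_one.symm, edgeAct_single_of_pos (label_posState _ _),
    edgeAct_single_of_pos (label_posState _ _), add_comm]
  congr 2
  · refine state_ext rfl fun e => ?_
    refine (label_relabel (x := posState S) hag _ _ e).trans ?_
    rw [label_setSign]
    change _ = if D.SameCircle (Function.update S c true) e _ then _ else _
    split_ifs <;> rfl
  · refine state_ext rfl fun e => ?_
    refine (label_relabel (x := posState S) hag _ _ e).trans ?_
    rw [label_setSign]
    change _ = if D.SameCircle (Function.update S c true) e _ then _ else _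
    split_ifs with h1 h2
    · exact absurd (h1.symm.trans h2) h.1
    all_goals rfl

lemma cubeMap_edgeAct (c : Fin D.crossings) (g : D.Edge) (v : D.CKh K) :
    cubeMap K D c (edgeAct K g v) = edgeAct K g (cubeMap K D c v) :=
  LinearMap.congr_fun (cubeMap_comp_edgeAct K c g) v

lemma cubeMap_cubeMap_posState_of_eq_true {S : D.Resolution} {c c' : Fin D.crossings}
    (hS : Function.update S c' true c = true) :
    cubeMap K D c (cubeMap K D c' (Finsupp.single (posState S) 1)) = 0 := by
  rcases h' : S c' with _ | _
  · have h0 : cubeMap K D c (Finsupp.single (posState (Function.update S c' true)) 1) = 0 :=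
      cubeMap_eq_zero K hS
    rcases D.merge_or_split h' with h | h
    · rw [cubeMap_posState_of_merge K h' h, h0]
    · rw [cubeMap_posState_of_split K h' h, map_add, cubeMap_edgeAct, cubeMap_edgeAct, h0,
        map_zero, map_zero, add_zero]
  · rw [cubeMap_eq_zero (x := posState S) K h', map_zero]

/-- The faces of the cube of resolutions commute. -/
lemma cubeMap_comm {c c' : Fin D.crossings} (hc : c ≠ c') :
    cubeMap K D c' ∘ₗ cubeMap K D c = cubeMap K D c ∘ₗ cubeMap K D c' := by
  refine linearMap_ext_of_commute (fun g => ?_) (fun g => ?_) fun S => ?_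
  · rw [LinearMap.comp_assoc, cubeMap_comp_edgeAct, ← LinearMap.comp_assoc, cubeMap_comp_edgeAct,
      LinearMap.comp_assoc]
  · rw [LinearMap.comp_assoc, cubeMap_comp_edgeAct, ← LinearMap.comp_assoc, cubeMap_comp_edgeAct,
      LinearMap.comp_assoc]
  rw [LinearMap.comp_apply, LinearMap.comp_apply]
  rcases hS : S c with _ | _
  swap
  · rw [cubeMap_eq_zero (x := posState S) K hS, map_zero, cubeMap_cubeMap_posState_of_eq_true K
      (by rw [Function.update_of_ne hc, hS])]
  rcases hS' : S c' with _ | _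
  swap
  · rw [cubeMap_eq_zero (x := posState S) K hS', map_zero, cubeMap_cubeMap_posState_of_eq_true K
      (by rw [Function.update_of_ne hc.symm, hS'])]
  have h1 : Function.update S c true c' = false := by rw [Function.update_of_ne hc.symm, hS']
  have h2 : Function.update S c' true c = false := by rw [Function.update_of_ne hc, hS]
  have hcomm : Function.update (Function.update S c' true) c true =
      Function.update (Function.update S c true) c' true := Function.update_comm hc.symm _ _ _
  have m1 := D.merge_or_split hS
  have m2 := D.merge_or_split h1
  have m1' := D.merge_or_split hS'
  have m2' := D.merge_or_split h2
  rw [hcomm] at m2'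
  set S₁ := Function.update S c true with hS₁
  set S₁' := Function.update S c' true with hS₁'
  set S₂ := Function.update S₁ c' true with hS₂
  have hm : ∀ h, cubeMap K D c (Finsupp.single (posState S₁') 1) = Finsupp.single (posState S₂) 1 :=
    fun h => (cubeMap_posState_of_merge K h2 (hcomm ▸ h)).trans (by rw [hcomm])
  have hs : ∀ h, cubeMap K D c (Finsupp.single (posState S₁') 1) =
      edgeAct K (D.outEdge c) (Finsupp.single (posState S₂) 1) +
        edgeAct K (D.inEdge c) (Finsupp.single (posState S₂) 1) :=
    fun h => (cubeMap_posState_of_split K h2 (hcomm ▸ h)).trans (by rw [hcomm])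
  have act : ∀ {g h}, D.SameCircle S₂ g h → edgeAct K g (Finsupp.single (posState S₂) 1) =
      edgeAct K h (Finsupp.single (posState S₂) 1) := fun h =>
    edgeAct_single_congr (x := posState S₂) h
  have actcomm : ∀ g h v, edgeAct K g (edgeAct K h v) = edgeAct (D := D) K h (edgeAct K g v) :=
    fun g h v => LinearMap.congr_fun (edgeAct_comm g h) v
  -- Each edge of the face changes the number of circles by one and both paths end at `S₂`. Counting
  -- circles leaves six of the sixteen combinations.
  rcases m1 with m1 | m1 <;> rcases m2 with m2 | m2 <;> rcases m1' with m1' | m1' <;>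
    rcases m2' with m2' | m2' <;>
    have n1 := card_circle_of_joins m1 <;> have n2 := card_circle_of_joins m2 <;>
    have n1' := card_circle_of_joins m1' <;> have n2' := card_circle_of_joins m2' <;>
    try omega
  · rw [cubeMap_posState_of_merge K hS m1, cubeMap_posState_of_merge K h1 m2,
      cubeMap_posState_of_merge K hS' m1', hm m2']
  · rw [cubeMap_posState_of_merge K hS m1, cubeMap_posState_of_split K h1 m2,
      cubeMap_posState_of_merge K hS' m1', hs m2']
    -- Merge and then split, along both paths. The edges of `c` share a circle in `S₁` but not in
    -- `S₂`, so their circles in `S₂` are the two that `c'` joins, in one order or the other, and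
    -- the two sums agree.
    have hef : D.SameCircle S₁ (D.outEdge c) (D.inEdge c) :=
      (m1.2 _ _).mpr (Or.inr ⟨Or.inl rfl, Or.inr rfl⟩)
    rcases (m2.2 _ _).mp hef with h | ⟨h | h, h' | h'⟩
    · exact absurd h m2'.1
    · exact absurd (h.trans h'.symm) m2'.1
    · rw [act h, act h']
    · rw [act h, act h', add_comm]
    · exact absurd (h.trans h'.symm) m2'.1
  · rw [cubeMap_posState_of_merge K hS m1, cubeMap_posState_of_split K h1 m2,
      cubeMap_posState_of_split K hS' m1', map_add, cubeMap_edgeAct, cubeMap_edgeAct, hm m2']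
  · rw [cubeMap_posState_of_split K hS m1, map_add, cubeMap_edgeAct, cubeMap_edgeAct,
      cubeMap_posState_of_merge K h1 m2, cubeMap_posState_of_merge K hS' m1', hs m2']
  · rw [cubeMap_posState_of_split K hS m1, map_add, cubeMap_edgeAct, cubeMap_edgeAct,
      cubeMap_posState_of_merge K h1 m2, cubeMap_posState_of_split K hS' m1', map_add,
      cubeMap_edgeAct, cubeMap_edgeAct, hm m2']
    -- Split and then merge, along both paths: each gives twice the action on one circle. These
    -- circles coincide, since the edges of `c'` share a circle in `S` but not in `S₁`, so they lie
    -- on the circle that is split at `c`.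
    have e1 : D.SameCircle S₂ (D.outEdge c) (D.inEdge c) :=
      (m2'.2 _ _).mpr (Or.inr ⟨Or.inl rfl, Or.inr rfl⟩)
    have e2 : D.SameCircle S₂ (D.outEdge c') (D.inEdge c') :=
      (m2.2 _ _).mpr (Or.inr ⟨Or.inl rfl, Or.inr rfl⟩)
    have e3 : D.SameCircle S (D.outEdge c') (D.inEdge c') :=
      (m1'.2 _ _).mpr (Or.inr ⟨Or.inl rfl, Or.inr rfl⟩)
    have e4 : D.SameCircle S₂ (D.outEdge c') (D.outEdge c) := by
      rcases (m1.2 _ _).mp e3 with h | ⟨h | h, -⟩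
      · exact absurd h m2.1
      · exact h.of_joins m2
      · exact (h.of_joins m2).trans e1.symm
    rw [← act e1, ← act e2, act e4]
  · rw [cubeMap_posState_of_split K hS m1, map_add, cubeMap_edgeAct, cubeMap_edgeAct,
      cubeMap_posState_of_split K h1 m2, cubeMap_posState_of_split K hS' m1']
    simp only [map_add, cubeMap_edgeAct]
    rw [hs m2']
    simp only [map_add]
    rw [actcomm (D.outEdge c) (D.outEdge c'), actcomm (D.outEdge c) (D.inEdge c'),
      actcomm (D.inEdge c) (D.outEdge c'), actcomm (D.inEdge c) (D.inEdge c')]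
    abel

lemma cubeMap_comp_self (c : Fin D.crossings) : cubeMap K D c ∘ₗ cubeMap K D c = 0 := by
  refine linearMap_ext_of_commute (fun g => ?_) (fun g => ?_) fun S => ?_
  · rw [LinearMap.comp_assoc, cubeMap_comp_edgeAct, ← LinearMap.comp_assoc, cubeMap_comp_edgeAct,
      LinearMap.comp_assoc]
  · rw [LinearMap.zero_comp, LinearMap.comp_zero]
  · exact cubeMap_cubeMap_posState_of_eq_true K (Function.update_self ..)

end Diagram

/-! ### Signs in the cube of resolutions and the full differential -/

lemma card_and_update {n : ℕ} (P : Fin n → Prop) [DecidablePred P] {S : Fin n → Bool} {c : Fin n}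
    (hS : S c = false) : Nat.card {c' // P c' ∧ Function.update S c true c' = true} =
      Nat.card {c' // P c' ∧ S c' = true} + if P c then 1 else 0 := by
  classical
  rw [Nat.card_eq_fintype_card, Nat.card_eq_fintype_card, Fintype.card_subtype,
    Fintype.card_subtype]
  have hne : ∀ c', S c' = true → c' ≠ c := fun c' h h' => by rw [h', hS] at h; cases h
  split_ifs with hP
  · rw [← Finset.card_insert_of_notMem (a := c) (by simp [hS])]
    congr 1
    ext c'
    by_cases h : c' = c
    · subst h; simp [hP]
    · simp [h]
  · rw [add_zero]
    congr 1
    ext c'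
    by_cases h : c' = c
    · subst h; simp [hP]
    · simp [h]

namespace Diagram

variable {U : Set ℂ} {L : Link U} {D : Diagram L} (K : Type u) [Field K]

/-- The sign of the edges of the cube of resolutions at the crossing `c`. -/
def cubeSign (c : Fin D.crossings) (S : D.Resolution) : K :=
  (-1) ^ Nat.card {c' // c' < c ∧ S c' = true}

lemma cubeSign_update {c c' : Fin D.crossings} {S : D.Resolution} (hS : S c = false) :
    cubeSign K c' (Function.update S c true) = (if c < c' then -1 else 1) * cubeSign K c' S := by
  rw [cubeSign, card_and_update (fun d => d < c') hS, pow_add, mul_comm, cubeSign]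
  split_ifs <;> simp

/-- The diagonal map with the signs of the edges of the cube of resolutions at a crossing. -/
def signMap (D : Diagram L) (c : Fin D.crossings) : D.CKh K →ₗ[K] D.CKh K :=
  Finsupp.linearCombination K fun x => cubeSign K c x.1 • Finsupp.single x 1

lemma signMap_single (c : Fin D.crossings) (x : D.State) (a : K) :
    signMap K D c (Finsupp.single x a) = cubeSign K c x.1 • Finsupp.single x a := by
  rw [signMap, Finsupp.linearCombination_single, smul_comm, Finsupp.smul_single_one]

lemma signMap_comm (c c' : Fin D.crossings) :
    signMap K D c' ∘ₗ signMap K D c = signMap K D c ∘ₗ signMap K D c' := by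
  refine linearMap_ext_single fun x => ?_
  simp only [LinearMap.comp_apply, signMap_single, map_smul]
  exact smul_comm _ _ _

/-- Changing the resolution at `c` alters the number of `1`-resolutions before `c'` exactly when `c
< c'`. This makes the signed faces anticommute. -/
lemma signMap_comp_cubeMap (c c' : Fin D.crossings) :
    signMap K D c' ∘ₗ cubeMap K D c =
      (if c < c' then (-1 : K) else 1) • (cubeMap K D c ∘ₗ signMap K D c') := by
  classical
  refine linearMap_ext_single fun x => ?_
  simp only [LinearMap.comp_apply, LinearMap.smul_apply, signMap_single, map_smul]
  rcases hx : x.1 c with _ | _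
  · rw [cubeMap, Finsupp.linearCombination_single, one_smul, if_pos hx, map_sum, smul_smul,
      Finset.smul_sum]
    refine Finset.sum_congr rfl fun y _ => ?_
    split_ifs with hy h
    · rw [signMap_single, hy, cubeSign_update K hx, if_pos h]
    · rw [signMap_single, hy, cubeSign_update K hx, if_neg h]
    · rw [map_zero, smul_zero]
    · rw [map_zero, smul_zero]
  · rw [cubeMap_eq_zero K hx, map_zero, smul_zero, smul_zero]

lemma differential_single (x : D.State) :
    D.differential K (Finsupp.single x 1) = ∑ y, Finsupp.single y (D.diffCoeff K x y) := by
  rw [differential, Finsupp.linearCombination_single, one_smul]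

lemma differential_eq_sum : D.differential K = ∑ c, cubeMap K D c ∘ₗ signMap K D c := by
  classical
  refine linearMap_ext_single fun x => ?_
  rw [differential_single, LinearMap.sum_apply]
  simp only [LinearMap.comp_apply, signMap_single, map_smul]
  simp only [cubeMap, Finsupp.linearCombination_single, one_smul, diffCoeff,
    Finsupp.single_finsetSum]
  rw [Finset.sum_comm]
  refine Finset.sum_congr rfl fun c _ => ?_
  by_cases hx : x.1 c = false
  · rw [if_pos hx, Finset.smul_sum]
    refine Finset.sum_congr rfl fun y _ => ?_
    by_cases hy : y.1 = Function.update x.1 c true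
    · rw [if_pos ⟨hx, hy⟩, if_pos hy, Finsupp.smul_single, smul_eq_mul, cubeSign]
    · rw [if_neg fun h => hy h.2, if_neg hy, smul_zero, Finsupp.single_zero]
  · rw [if_neg hx, smul_zero]
    exact Finset.sum_eq_zero fun y _ => by rw [if_neg fun h => hx h.1, Finsupp.single_zero]

/-- The square of the Khovanov differential is zero. -/
theorem differential_comp_self : D.differential K ∘ₗ D.differential K = 0 := by
  have h : D.differential K ∘ₗ D.differential K =
      ∑ p : Fin D.crossings × Fin D.crossings, (if p.1 < p.2 then (-1 : K) else 1) •
        ((cubeMap K D p.2 ∘ₗ cubeMap K D p.1) ∘ₗ (signMap K D p.2 ∘ₗ signMap K D p.1)) := by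
    have key : ∀ c c', (cubeMap K D c' ∘ₗ signMap K D c') ∘ₗ (cubeMap K D c ∘ₗ signMap K D c) =
        (if c < c' then (-1 : K) else 1) •
          ((cubeMap K D c' ∘ₗ cubeMap K D c) ∘ₗ (signMap K D c' ∘ₗ signMap K D c)) := fun c c' => by
      refine LinearMap.ext fun v => ?_
      have := LinearMap.congr_fun (signMap_comp_cubeMap K c c') (signMap K D c v)
      simp only [LinearMap.comp_apply, LinearMap.smul_apply] at this ⊢
      rw [this, map_smul]
    refine LinearMap.ext fun v => ?_
    rw [differential_eq_sum, Fintype.sum_prod_type_right]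
    simp only [← key, LinearMap.comp_apply, LinearMap.sum_apply, map_sum]
    exact Finset.sum_comm
  rw [h]
  -- Exchanging the two crossings pairs terms of opposite sign, as exactly one of the two strict
  -- inequalities holds. Terms on the diagonal vanish on their own.
  refine Finset.sum_involution (fun p _ => (p.2, p.1)) (fun p _ => ?_) (fun p _ hp => ?_)
    (fun p _ => Finset.mem_univ _) (fun p _ => rfl)
  · by_cases hp : p.1 = p.2
    · simp only [hp, cubeMap_comp_self, LinearMap.zero_comp, smul_zero, add_zero]
    · simp only
      rw [cubeMap_comm K (Ne.symm hp), signMap_comm K p.2 p.1, ← add_smul]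
      have : (if p.1 < p.2 then (-1 : K) else 1) + (if p.2 < p.1 then (-1 : K) else 1) = 0 := by
        rcases lt_or_gt_of_ne hp with h | h
        · rw [if_pos h, if_neg h.not_gt]; ring
        · rw [if_neg h.not_gt, if_pos h]; ring
      rw [this, zero_smul]
  · intro he
    have hp' : p.1 = p.2 := (congrArg Prod.fst he).symm
    exact hp (by simp only [hp', cubeMap_comp_self, LinearMap.zero_comp, smul_zero])

end Diagram

/-! ### Winding numbers of the circles of a resolution -/

/-- The function `exp (-∫ f' / (f - z)) * (f - z)` has derivative zero, so no branch of the
logarithm has to be chosen. -/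
lemma exp_integral_logDeriv {f : ℝ → ℂ} (hf : ContDiff ℝ ∞ f) {z : ℂ} (hz : ∀ t, f t ≠ z) (a b : ℝ) :
    Complex.exp (∫ t in a..b, deriv f t / (f t - z)) = (f b - z) / (f a - z) := by
  have hc : Continuous (deriv f) := hf.continuous_deriv (by simp)
  have hne : ∀ t, f t - z ≠ 0 := fun t => sub_ne_zero.mpr (hz t)
  have hfc := hf.continuous
  have hint : Continuous fun t => deriv f t / (f t - z) := hc.div (by fun_prop) hne
  have hd : ∀ t, HasDerivAt f (deriv f t) t := fun t =>
    (hf.differentiable (by simp) t).hasDerivAt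
  have hI : ∀ t, HasDerivAt (fun t => ∫ s in a..t, deriv f s / (f s - z))
      (deriv f t / (f t - z)) t := fun t =>
    intervalIntegral.integral_hasDerivAt_right (hint.intervalIntegrable _ _)
      (hint.stronglyMeasurableAtFilter _ _) hint.continuousAt
  have hG : ∀ t, HasDerivAt (fun t => Complex.exp (-∫ s in a..t, deriv f s / (f s - z)) * (f t - z))
      0 t := fun t => by
    convert! ((hI t).neg.cexp).mul ((hd t).sub_const z) using 1
    field_simp [hne t]
    simp
  have hconst := is_const_of_deriv_eq_zero (fun t => (hG t).differentiableAt)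
    (fun t => (hG t).deriv) b a
  simp only [intervalIntegral.integral_same, neg_zero, Complex.exp_zero, one_mul] at hconst
  rw [Complex.exp_neg] at hconst
  rw [eq_div_iff (hne a), ← hconst, mul_inv_cancel_left₀ (Complex.exp_ne_zero _)]

namespace Diagram

variable {U : Set ℂ} {L : Link U} {D : Diagram L}

/-- The point of the plane over which the passage lies. -/
def point (D : Diagram L) (s : Fin D.crossings × Bool) : ℂ := L.proj (D.comp s) (D.time s)

lemma point_flip (s : Fin D.crossings × Bool) : D.point (D.flip s) = D.point s := D.proj_flip s

/-- The starting point of an edge with a direction of traversal. -/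
def start (D : Diagram L) : D.Edge × Bool → ℂ
  | (Sum.inl s, true) => D.point s
  | (Sum.inl s, false) => D.point (D.next s)
  | (Sum.inr i, _) => L.proj i.1 0

lemma start_walk (S : D.Resolution) (e : D.Edge) (b : Bool) :
    D.start (D.walk S (e, b)) = D.start (e, !b) := by
  have h1 : ∀ s : Fin D.crossings × Bool, D.point (s.1, !s.2) = D.point s := D.point_flip
  rcases e with s | i
  · cases b <;> simp only [walk] <;> split_ifs <;> simp [start, h1]
  · rfl

lemma proj_arrival (s : Fin D.crossings × Bool) :
    L.proj (D.comp s) (D.arrival s) = D.point (D.next s) := by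
  obtain ⟨k, hk⟩ := D.arrival_eq s
  rw [hk, periodic_add_int (L.proj_periodic _), point, D.comp_next]

/-- The integral along an edge with a direction of traversal. -/
def directedIntegral (D : Diagram L) (z : ℂ) (d : D.Edge × Bool) : ℂ :=
  if d.2 then D.edgeIntegral z d.1 else -D.edgeIntegral z d.1

lemma exp_edgeIntegral {z : ℂ} (hz : z ∉ U) (e : D.Edge) :
    Complex.exp (D.edgeIntegral z e) = (D.start (e, false) - z) / (D.start (e, true) - z) := by
  have hne : ∀ i t, L.proj i t ≠ z := fun i t h => hz (h ▸ L.proj_mem i t)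
  rcases e with s | i
  · simp only [edgeIntegral, start]
    rw [exp_integral_logDeriv (L.proj_smooth _) (hne _), proj_arrival]
    rfl
  · simp only [edgeIntegral, start]
    rw [exp_integral_logDeriv (L.proj_smooth _) (hne _)]
    congr 2
    have := L.proj_periodic i.1 0
    rwa [zero_add] at this

lemma start_sub_ne_zero {z : ℂ} (hz : z ∉ U) (d : D.Edge × Bool) : D.start d - z ≠ 0 := by
  have hne : ∀ i t, L.proj i t ≠ z := fun i t h => hz (h ▸ L.proj_mem i t)
  rcases d with ⟨s | i, _ | _⟩ <;> exact sub_ne_zero.mpr (hne _ _)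

lemma exp_directedIntegral {z : ℂ} (hz : z ∉ U) (S : D.Resolution) (d : D.Edge × Bool) :
    Complex.exp (D.directedIntegral z d) = (D.start (D.walk S d) - z) / (D.start d - z) := by
  obtain ⟨e, b⟩ := d
  rw [start_walk]
  cases b
  · simp [directedIntegral, Complex.exp_neg, exp_edgeIntegral hz]
  · simp [directedIntegral, exp_edgeIntegral hz]

namespace Alternating

variable (a : D.Alternating)

open Classical in
/-- The integral around a circle of a resolution, in the direction of an alternating orientation. -/
def circleIntegral (z : ℂ) (S : D.Resolution) (C : D.Circle S) : ℂ :=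
  ∑ e : D.Edge with D.circleOf S e = C, D.directedIntegral z (e, a.orient e)

/-- Each edge contributes the quotient of its end by its start, relative to `z`. The end of an edge
is the start of its successor under `a.perm S`, so the product telescopes cyclically. -/
lemma exp_circleIntegral {z : ℂ} (hz : z ∉ U) (S : D.Resolution) (C : D.Circle S) :
    Complex.exp (a.circleIntegral z S C) = 1 := by
  classical
  rw [circleIntegral, Complex.exp_sum, Finset.prod_congr rfl fun e _ => by
    rw [exp_directedIntegral hz S, a.walk_eq], Finset.prod_div_distrib]
  rw [div_eq_one_iff_eq (Finset.prod_ne_zero_iff.mpr fun e _ => start_sub_ne_zero hz _)]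
  exact Finset.prod_equiv (a.perm S) (fun e => by simp [a.circleOf_perm]) fun e _ => rfl

/-- The winding number of a circle of a resolution, in the direction of an alternating
orientation. -/
def circleWinding {z : ℂ} (hz : z ∉ U) (S : D.Resolution) (C : D.Circle S) : ℤ :=
  (Complex.exp_eq_one_iff.mp (a.exp_circleIntegral hz S C)).choose

lemma circleIntegral_eq {z : ℂ} (hz : z ∉ U) (S : D.Resolution) (C : D.Circle S) :
    a.circleIntegral z S C = a.circleWinding hz S C * (2 * Real.pi * Complex.I) :=
  (Complex.exp_eq_one_iff.mp (a.exp_circleIntegral hz S C)).choose_spec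

lemma walk_iterate (S : D.Resolution) (e : D.Edge) (k : ℕ) :
    (D.walk S)^[k] (e, a.orient e) = ((a.perm S ^ k) e, a.orient ((a.perm S ^ k) e)) := by
  induction k with
  | zero => rfl
  | succ k ih => rw [Function.iterate_succ_apply', ih, a.walk_eq, pow_succ', Equiv.Perm.mul_apply]

lemma winding_eq_of_orient {z : ℂ} (hz : z ∉ U) (S : D.Resolution) {e : D.Edge}
    (he : a.orient e = true) : D.winding z S e = a.circleWinding hz S (D.circleOf S e) := by
  classical
  have h : (∑ d : D.Edge × Bool with ∃ k : ℕ, (D.walk S)^[k] (e, true) = d,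
      D.directedIntegral z d) = a.circleIntegral z S (D.circleOf S e) := by
    rw [circleIntegral]
    refine (Finset.sum_bij (fun f _ => (f, a.orient f)) (fun f hf => ?_) (fun f _ g _ h => ?_)
      (fun d hd => ?_) (fun f _ => rfl)).symm
    · have hf := ((a.circleOf_eq_iff S f e).mp (Finset.mem_filter.mp hf).2).symm
      obtain ⟨k, -, rfl⟩ := hf.exists_pow_eq'
      exact Finset.mem_filter.mpr ⟨Finset.mem_univ _, k, by rw [← he, a.walk_iterate]⟩
    · exact (Prod.mk.inj h).1
    · obtain ⟨k, rfl⟩ := (Finset.mem_filter.mp hd).2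
      refine ⟨(a.perm S ^ k) e, Finset.mem_filter.mpr ⟨Finset.mem_univ _, ?_⟩, ?_⟩
      · rw [a.circleOf_eq_iff]
        exact (Equiv.Perm.SameCycle.symm ⟨k, by rw [zpow_natCast]⟩)
      · rw [← he, a.walk_iterate]
  have hw : D.winding z S e = round ((∑ d : D.Edge × Bool with ∃ k : ℕ,
      (D.walk S)^[k] (e, true) = d, D.directedIntegral z d) / (2 * Real.pi * Complex.I)).re := by
    unfold winding directedIntegral
    congr!
  rw [hw, h, a.circleIntegral_eq hz, mul_div_cancel_right₀ _ Complex.two_pi_I_ne_zero,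
    Complex.intCast_re, round_intCast]

lemma circleOf_inr_eq (a : D.Alternating) {S : D.Resolution} {i : {i : Fin L.numComponents // ∀ s, D.comp s ≠ i}}
    {e : D.Edge} (h : D.circleOf S e = D.circleOf S (Sum.inr i)) : e = Sum.inr i := by
  have h1 := ((a.circleOf_eq_iff S _ _).mp h).symm
  obtain ⟨k, -, rfl⟩ := h1.exists_pow_eq'
  have hfix : Function.IsFixedPt (a.perm S) (Sum.inr i) := rfl
  rw [Equiv.Perm.coe_pow]
  exact hfix.iterate k

/-- A walk against `a` is a walk along `a.neg`, which only negates the integral. So the absolute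
value depends on the circle alone, not on the representative that `circleClass` picks. -/
lemma abs_winding {z : ℂ} (hz : z ∉ U) (S : D.Resolution) (e : D.Edge) :
    |D.winding z S e| = |a.circleWinding hz S (D.circleOf S e)| := by
  classical
  by_cases he : a.orient e = true
  · rw [a.winding_eq_of_orient hz S he]
  · rcases e with s | i
    · have hn : a.neg.orient (Sum.inl s) = true := by
        rw [Alternating.neg_orient_inl, Bool.eq_false_of_not_eq_true he]; rfl
      rw [a.neg.winding_eq_of_orient hz S hn]
      have hsum : a.neg.circleIntegral z S (D.circleOf S (Sum.inl s)) =
          -a.circleIntegral z S (D.circleOf S (Sum.inl s)) := by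
        rw [circleIntegral, circleIntegral, ← Finset.sum_neg_distrib]
        refine Finset.sum_congr rfl fun f hf => ?_
        rcases f with t | i
        · rw [Alternating.neg_orient_inl]
          cases a.orient (Sum.inl t) <;> simp [directedIntegral]
        · exact absurd (a.circleOf_inr_eq (Finset.mem_filter.mp hf).2.symm) Sum.inl_ne_inr
      rw [a.neg.circleIntegral_eq hz, a.circleIntegral_eq hz, ← neg_mul,
        mul_left_inj' Complex.two_pi_I_ne_zero] at hsum
      have : a.neg.circleWinding hz S (D.circleOf S (Sum.inl s)) =
        -a.circleWinding hz S (D.circleOf S (Sum.inl s)) := by exact_mod_cast hsum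
      rw [this, abs_neg]
    · exact absurd rfl he

lemma circleClass_eq {z : ℂ} (hz : z ∉ U) (S : D.Resolution) (C : D.Circle S) :
    D.circleClass z S C = |a.circleWinding hz S C| := by
  rw [circleClass, a.abs_winding hz]
  congr 2
  exact circleOf_out C

/-- The orientation `a` is the same for all resolutions, so the integral over the joined circle is a
sum over the disjoint union of the edges of the two circles. -/
lemma circleWinding_add {z : ℂ} (hz : z ∉ U) {S S' : D.Resolution} {e f : D.Edge}
    (h : Joins (D.SameCircle S) (D.SameCircle S') e f) :
    a.circleWinding hz S' (D.circleOf S' e) =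
      a.circleWinding hz S (D.circleOf S e) + a.circleWinding hz S (D.circleOf S f) := by
  classical
  have hag := agreeAway_of_joins h
  have hef : D.SameCircle S' e f := (h.2 _ _).mpr (Or.inr ⟨Or.inl rfl, Or.inr rfl⟩)
  have key : a.circleIntegral z S' (D.circleOf S' e) =
      a.circleIntegral z S (D.circleOf S e) + a.circleIntegral z S (D.circleOf S f) := by
    rw [circleIntegral, circleIntegral, circleIntegral, ← Finset.sum_union]
    · refine Finset.sum_congr ?_ fun _ _ => rfl
      ext g
      simp only [Finset.mem_filter, Finset.mem_univ, true_and, Finset.mem_union]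
      exact ⟨fun h' => (hag.1 g).mpr (Or.inl h'), fun h' =>
        ((hag.1 g).mp h').elim id fun h' => h'.trans hef.symm⟩
    · refine Finset.disjoint_filter.mpr fun g _ h1 h2 => h.1 (h1.symm.trans h2)
  rw [a.circleIntegral_eq hz, a.circleIntegral_eq hz, a.circleIntegral_eq hz, ← add_mul,
    mul_left_inj' Complex.two_pi_I_ne_zero] at key
  exact_mod_cast key

lemma circleWinding_eq_outside {z : ℂ} (hz : z ∉ U) {S S' : D.Resolution} {e f g : D.Edge}
    (h : Joins (D.SameCircle S) (D.SameCircle S') e f) (he : ¬ D.SameCircle S g e)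
    (hf : ¬ D.SameCircle S g f) :
    a.circleWinding hz S (D.circleOf S g) = a.circleWinding hz S' (D.circleOf S' g) := by
  classical
  have hag := agreeAway_of_joins h
  have key : a.circleIntegral z S (D.circleOf S g) = a.circleIntegral z S' (D.circleOf S' g) := by
    rw [circleIntegral, circleIntegral]
    refine Finset.sum_congr ?_ fun _ _ => rfl
    ext k
    simp only [Finset.mem_filter, Finset.mem_univ, true_and]
    have := hag.2 g k he hf
    exact ⟨fun h' => (this.mp h'.symm).symm, fun h' => (this.mpr h'.symm).symm⟩
  rw [a.circleIntegral_eq hz, a.circleIntegral_eq hz,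
    mul_left_inj' Complex.two_pi_I_ne_zero] at key
  exact_mod_cast key

end Alternating

/-! ### The degrees of the differential -/

variable (K : Type u) [Field K]

lemma exists_of_diffCoeff_ne_zero {x y : D.State} (h : D.diffCoeff K x y ≠ 0) :
    ∃ c, x.1 c = false ∧ y.1 = Function.update x.1 c true ∧ D.cubeCoeff K c x y ≠ 0 := by
  obtain ⟨c, -, hc⟩ := Finset.exists_ne_zero_of_sum_ne_zero h
  split_ifs at hc with h'
  · exact ⟨c, h'.1, h'.2, right_ne_zero_of_mul hc⟩
  · exact absurd rfl hc

/-- The change of a sum of signed weights of circles under the differential. -/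
lemma sum_sub_sum_of_diffCoeff_ne_zero {κ : ∀ S : D.Resolution, D.Circle S → ℤ}
    (hκ : ∀ S S' e f, Joins (D.SameCircle S) (D.SameCircle S') e f → ∀ g, ¬ D.SameCircle S g e →
      ¬ D.SameCircle S g f → κ S (D.circleOf S g) = κ S' (D.circleOf S' g))
    {x y : D.State} (h : D.diffCoeff K x y ≠ 0) :
    ∃ S S' e f p q r, Joins (D.SameCircle S) (D.SameCircle S') e f ∧
      p = κ S (D.circleOf S e) ∧ q = κ S (D.circleOf S f) ∧ r = κ S' (D.circleOf S' e) ∧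
      (∑ C, (x.2 C : ℤ) * κ x.1 C = ∑ C, (y.2 C : ℤ) * κ y.1 C + (p + q - r) ∨
       ∑ C, (x.2 C : ℤ) * κ x.1 C = ∑ C, (y.2 C : ℤ) * κ y.1 C + (p - q + r) ∨
       ∑ C, (x.2 C : ℤ) * κ x.1 C = ∑ C, (y.2 C : ℤ) * κ y.1 C + (-p + q + r)) := by
  classical
  obtain ⟨c, hx, hy, hc⟩ := exists_of_diffCoeff_ne_zero K h
  have lab : ∀ (x : D.State) g, x.2 (D.circleOf x.1 g) = D.label x g := fun _ _ => rfl
  have hj' := D.merge_or_split hx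
  rw [← hy] at hj'
  rcases hj' with hj | hj
  · have hef : D.SameCircle y.1 (D.outEdge c) (D.inEdge c) :=
      (hj.2 _ _).mpr (Or.inr ⟨Or.inl rfl, Or.inr rfl⟩)
    rw [cubeCoeff_of_merge K hj.1 hef] at hc
    split_ifs at hc with hag
    · refine ⟨_, _, _, _, _, _, _, hj, rfl, rfl, rfl, ?_⟩
      have key := sum_circle_of_joins hj (F := fun C => (x.2 C : ℤ) * κ x.1 C)
        (F' := fun C => (y.2 C : ℤ) * κ y.1 C) fun g h1 h2 => by
          rw [lab, lab, hag g h1 h2, hκ _ _ _ _ hj g h1 h2]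
      simp only [lab] at key
      rw [key]
      rw [mergeCoeff] at hc
      split_ifs at hc with hm
      · rcases hm with ⟨h1, h2, h3⟩ | ⟨h1, h2, h3⟩ | ⟨h1, h2, h3⟩ <;>
          rw [h1, h2, h3] <;> [left; (right; left); (right; right)] <;> push_cast <;> ring
      · exact absurd rfl hc
    · exact absurd rfl hc
  · have hef : D.SameCircle x.1 (D.outEdge c) (D.inEdge c) :=
      (hj.2 _ _).mpr (Or.inr ⟨Or.inl rfl, Or.inr rfl⟩)
    rw [cubeCoeff_of_split K hef hj.1] at hc
    split_ifs at hc with hag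
    · refine ⟨_, _, _, _, _, _, _, hj, rfl, rfl, rfl, ?_⟩
      have haw := agreeAway_of_joins hj
      have key := sum_circle_of_joins hj (F := fun C => (y.2 C : ℤ) * κ y.1 C)
        (F' := fun C => (x.2 C : ℤ) * κ x.1 C) fun g h1 h2 => by
          rw [lab, lab, hag g (fun h' => ((haw.1 g).mpr (Or.inl h')).elim h1 h2)
            (fun h' => ((haw.1 g).mpr (Or.inr h')).elim h1 h2), hκ _ _ _ _ hj g h1 h2]
      simp only [lab] at key
      rw [key]
      rw [splitCoeff] at hc
      split_ifs at hc with hm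
      · rcases hm with ⟨h1, h2, h3⟩ | ⟨h1, h2, h3⟩ | ⟨h1, h2, h3⟩ <;>
          rw [h1, h2, h3] <;> [(right; right); (right; left); left] <;> push_cast <;> ring
      · exact absurd rfl hc
    · exact absurd rfl hc

lemma hDegree_of_diffCoeff_ne_zero {x y : D.State} (h : D.diffCoeff K x y ≠ 0) :
    D.hDegree y = D.hDegree x + 1 := by
  obtain ⟨c, hx, hy, -⟩ := exists_of_diffCoeff_ne_zero K h
  have := card_and_update (fun _ => True) hx
  simp only [true_and, if_true] at this
  rw [hDegree, hDegree, weight, weight, hy, this]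
  push_cast
  ring

/-- With all weights equal to `1`, each of the three alternatives says that the sum of the signs
drops by one. The additional `1`-resolution makes up for it. -/
lemma qDegree_of_diffCoeff_ne_zero {x y : D.State} (h : D.diffCoeff K x y ≠ 0) :
    D.qDegree y = D.qDegree x := by
  have hh := hDegree_of_diffCoeff_ne_zero K h
  obtain ⟨_, _, _, _, p, q, r, -, rfl, rfl, rfl, hs⟩ := sum_sub_sum_of_diffCoeff_ne_zero K
    (κ := fun _ _ => 1) (fun _ _ _ _ _ _ _ _ => rfl) h
  simp only [mul_one] at hs
  simp only [hDegree] at hh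
  simp only [qDegree]
  omega

/-- The grading drops by `p + q - r`, `p - q + r` or `-p + q + r`, where `p = |m|`, `q = |n|` and `r
= |m + n|` for the winding numbers `m` and `n` of the two circles. All three are nonnegative by the
triangle inequality. -/
lemma gradingAt_le_of_diffCoeff_ne_zero {z : ℂ} (hz : z ∉ U) {x y : D.State}
    (h : D.diffCoeff K x y ≠ 0) : D.gradingAt z y ≤ D.gradingAt z x := by
  obtain ⟨a⟩ := D.nonempty_alternating
  obtain ⟨S, S', e, f, p, q, r, hj, hp, hq, hr, hs⟩ := sum_sub_sum_of_diffCoeff_ne_zero K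
    (κ := D.circleClass z) (fun S S' e f hj g he hf => by
      rw [a.circleClass_eq hz, a.circleClass_eq hz, a.circleWinding_eq_outside hz hj he hf]) h
  rw [a.circleClass_eq hz] at hp hq hr
  rw [a.circleWinding_add hz hj] at hr
  rw [gradingAt, gradingAt]
  have h1 := abs_add_le (a.circleWinding hz S (D.circleOf S e)) (a.circleWinding hz S (D.circleOf S f))
  have h2 := abs_sub_abs_le_abs_add (a.circleWinding hz S (D.circleOf S e))
    (a.circleWinding hz S (D.circleOf S f))
  have h3 := abs_sub_abs_le_abs_add (a.circleWinding hz S (D.circleOf S f))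
    (a.circleWinding hz S (D.circleOf S e))
  rw [add_comm (a.circleWinding hz S (D.circleOf S f))] at h3
  rw [← hp, ← hq, ← hr] at h1
  rw [← hp, ← hq, ← hr] at h2
  rw [← hp, ← hq, ← hr] at h3
  omega

end Diagram

/-! ### Maps on homology -/

section HomologyMap

variable {K : Type u} [Field K] {M N : Type u} [AddCommGroup M] [Module K M] [AddCommGroup N]
  [Module K N]

/-- The map induced on homology by a chain map. -/
def Homology.map {d : M →ₗ[K] M} {d' : N →ₗ[K] N} {M₀ M₁ : Submodule K M} {N₀ N₁ : Submodule K N}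
    (f : M →ₗ[K] N) (hf : ∀ x, f (d x) = d' (f x)) (h₀ : M₀ ≤ N₀.comap f) (h₁ : M₁ ≤ N₁.comap f) :
    Homology d M₀ M₁ →ₗ[K] Homology d' N₀ N₁ :=
  Submodule.mapQ _ _ (f.restrict (p := M₁ ⊓ LinearMap.ker d) (q := N₁ ⊓ LinearMap.ker d')
    fun x hx => ⟨h₁ hx.1, (hf x).symm.trans (by
      rw [LinearMap.mem_ker.mp hx.2, map_zero])⟩) <| by
    rintro ⟨x, hx⟩ ⟨y, hy, hyx⟩
    exact ⟨f y, h₀ hy, by rw [← hf, hyx]; rfl⟩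

lemma Homology.map_mem_homologySub {d : M →ₗ[K] M} {d' : N →ₗ[K] N} {M₀ M₁ A : Submodule K M}
    {N₀ N₁ B : Submodule K N} (f : M →ₗ[K] N) (hf : ∀ x, f (d x) = d' (f x))
    (h₀ : M₀ ≤ N₀.comap f) (h₁ : M₁ ≤ N₁.comap f) (hA : A ≤ B.comap f) {x : Homology d M₀ M₁}
    (hx : x ∈ homologySub d M₀ M₁ A) :
    Homology.map f hf h₀ h₁ x ∈ homologySub d' N₀ N₁ B := by
  obtain ⟨y, hy, rfl⟩ := hx
  exact ⟨_, hA hy, rfl⟩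

end HomologyMap

/-! ### Direct sums -/

section DirectSum

variable {K : Type u} [Field K] {κ : Type} {N : κ → Type u} [∀ k, AddCommGroup (N k)]
  [∀ k, Module K (N k)] {H : Type u} [AddCommGroup H] [Module K H]

/-- A module with a complete system of orthogonal inclusions and projections is a direct sum,
compatibly with submodules respected by the inclusions and projections. -/
lemma exists_directSum_equiv (i : ∀ k, N k →ₗ[K] H) (p : ∀ k, H →ₗ[K] N k)
    (hpi : ∀ k x, p k (i k x) = x) (hpi' : ∀ k l, k ≠ l → ∀ x, p k (i l x) = 0)
    (hsum : ∀ x, ∃ s : Finset κ, x = ∑ k ∈ s, i k (p k x)) :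
    ∃ Φ : (⨁ k, N k) ≃ₗ[K] H, ∀ (G : ∀ k, Submodule K (N k)) (G' : Submodule K H),
      (∀ k, G k ≤ G'.comap (i k)) → (∀ k, G' ≤ (G k).comap (p k)) →
      directSumSub G = G'.comap Φ.toLinearMap := by
  classical
  let Ψ : (⨁ k, N k) →ₗ[K] H := DirectSum.toModule K κ H i
  have hp : ∀ k x, p k (Ψ x) = DirectSum.component K κ N k x := by
    intro k x
    refine LinearMap.congr_fun (f := p k ∘ₗ Ψ) (DirectSum.linearMap_ext K fun l => ?_) x
    ext y
    by_cases hkl : k = l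
    · subst hkl
      simp [Ψ, hpi]
    · simp only [LinearMap.comp_apply, Ψ, DirectSum.toModule_lof, hpi' k l hkl]
      rw [DirectSum.component.of, dif_neg (Ne.symm hkl)]
  have hinj : Function.Injective Ψ := by
    refine (injective_iff_map_eq_zero Ψ).mpr fun x hx => DFinsupp.ext fun k => ?_
    have := hp k x
    rw [hx, map_zero] at this
    exact this.symm
  have hsurj : Function.Surjective Ψ := by
    intro x
    obtain ⟨s, hs⟩ := hsum x
    refine ⟨∑ k ∈ s, DirectSum.lof K κ N k (p k x), ?_⟩
    rw [map_sum]
    conv_rhs => rw [hs]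
    simp [Ψ]
  refine ⟨LinearEquiv.ofBijective Ψ ⟨hinj, hsurj⟩, fun G G' h1 h2 => ?_⟩
  ext x
  simp only [directSumSub, Submodule.mem_iInf, Submodule.mem_comap]
  constructor
  · intro h
    change Ψ x ∈ G'
    obtain ⟨s, hs⟩ := hsum (Ψ x)
    rw [hs]
    exact G'.sum_mem fun k _ => h1 k (by rw [hp]; exact h k)
  · intro h k
    rw [← hp]
    exact h2 k h

end DirectSum

/-! ### Filtrations induced by gradings of a basis -/

section Graded

variable {K : Type u} [Field K] {ι : Type} {P : Type*}

open Classical in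
/-- The projection onto the span of the basis elements of degree `a`. -/
def gradedProj (K : Type u) [Field K] (g : ι → P) (a : P) : (ι →₀ K) →ₗ[K] (ι →₀ K) where
  toFun m := m.filter fun x => g x = a
  map_add' _ _ := Finsupp.filter_add
  map_smul' _ _ := Finsupp.filter_smul

lemma gradedProj_apply (g : ι → P) (a : P) (m : ι →₀ K) (x : ι) [Decidable (g x = a)] :
    gradedProj K g a m x = if g x = a then m x else 0 := by
  simp only [gradedProj, LinearMap.coe_mk, AddHom.coe_mk, Finsupp.filter_apply]
  congr

/-- The part of an endomorphism which preserves the degree of basis elements. -/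
def gradedPart (d : (ι →₀ K) →ₗ[K] (ι →₀ K)) (g : ι → P) : (ι →₀ K) →ₗ[K] (ι →₀ K) :=
  Finsupp.linearCombination K fun x => gradedProj K g (g x) (d (Finsupp.single x 1))

lemma gradedPart_single (d : (ι →₀ K) →ₗ[K] (ι →₀ K)) (g : ι → P) (x : ι) :
    gradedPart d g (Finsupp.single x 1) = gradedProj K g (g x) (d (Finsupp.single x 1)) := by
  simp [gradedPart]

lemma mem_supported_iff {T : Set ι} {m : ι →₀ K} :
    m ∈ Finsupp.supported K K T ↔ ∀ x, m x ≠ 0 → x ∈ T := by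
  rw [Finsupp.mem_supported]
  exact ⟨fun h x hx => h (by simpa using hx), fun h x hx => h x (by simpa using hx)⟩

lemma supported_le_iff {T : Set ι} {N : Submodule K (ι →₀ K)} :
    Finsupp.supported K K T ≤ N ↔ ∀ x ∈ T, Finsupp.single x 1 ∈ N := by
  rw [Finsupp.supported_eq_span_single, Submodule.span_le, Set.image_subset_iff]
  rfl

lemma gradedProj_mem_supported {T : Set ι} (g : ι → P) (a : P) {m : ι →₀ K}
    (hm : m ∈ Finsupp.supported K K T) :
    gradedProj K g a m ∈ Finsupp.supported K K (T ∩ {x | g x = a}) := by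
  classical
  rw [mem_supported_iff] at hm ⊢
  intro x hx
  rw [gradedProj_apply] at hx
  split_ifs at hx with h
  · exact ⟨hm x hx, h⟩
  · exact absurd rfl hx

lemma gradedProj_of_mem {g : ι → P} {a : P} {m : ι →₀ K}
    (hm : m ∈ Finsupp.supported K K {x | g x = a}) : gradedProj K g a m = m := by
  classical
  ext x
  rw [gradedProj_apply]
  split_ifs with h
  · rfl
  · by_contra hx
    exact h (mem_supported_iff.mp hm x (Ne.symm hx))

lemma gradedProj_eq_zero_iff {g : ι → P} {a : P} {m : ι →₀ K} :
    gradedProj K g a m = 0 ↔ m ∈ Finsupp.supported K K {x | g x ≠ a} := by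
  classical
  rw [mem_supported_iff, Finsupp.ext_iff]
  refine forall_congr' fun x => ?_
  rw [gradedProj_apply]
  by_cases h : g x = a <;> simp [h]

lemma gradedProj_gradedProj (g : ι → P) (a : P) (m : ι →₀ K) :
    gradedProj K g a (gradedProj K g a m) = gradedProj K g a m :=
  gradedProj_of_mem (Finsupp.supported_mono Set.inter_subset_right
    (gradedProj_mem_supported (T := Set.univ) g a (by simp)))

lemma gradedProj_gradedProj_of_ne (g : ι → P) {a b : P} (h : a ≠ b) (m : ι →₀ K) :
    gradedProj K g a (gradedProj K g b m) = 0 := by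
  rw [gradedProj_eq_zero_iff]
  refine Finsupp.supported_mono ?_ (gradedProj_mem_supported (T := Set.univ) g b (by simp))
  rintro x ⟨-, hx⟩ rfl
  exact h hx

lemma sum_gradedProj [Finite ι] {g : ι → P} {κ : Type} {e : κ → P} (he : Function.Injective e) {m : ι →₀ K}
    (hm : m ∈ Finsupp.supported K K {x | g x ∈ Set.range e}) :
    ∃ s : Finset κ, m = ∑ k ∈ s, gradedProj K g (e k) m := by
  classical
  have hfin : (e ⁻¹' Set.range g).Finite := (Set.finite_range g).preimage he.injOn
  refine ⟨hfin.toFinset, Finsupp.ext fun x => ?_⟩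
  rw [Finsupp.finsetSum_apply]
  simp only [gradedProj_apply]
  by_cases hx : m x = 0
  · simp [hx]
  obtain ⟨k, hk⟩ := mem_supported_iff.mp hm x hx
  rw [Finset.sum_eq_single k (fun l _ hl => if_neg fun h => hl (he (h.symm.trans hk.symm)))
    (fun h => absurd (by simp [hk]) h), if_pos hk.symm]

lemma gradedPart_mem_supported {d : (ι →₀ K) →ₗ[K] (ι →₀ K)} {T T' : Set ι} (g : ι → P)
    (h : Finsupp.supported K K T ≤ (Finsupp.supported K K T').comap d) :
    Finsupp.supported K K T ≤ (Finsupp.supported K K T').comap (gradedPart d g) := by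
  refine supported_le_iff.mpr fun x hx => ?_
  rw [Submodule.mem_comap, gradedPart_single]
  exact Finsupp.supported_mono Set.inter_subset_left
    (gradedProj_mem_supported g _ (supported_le_iff.mp h x hx))

lemma gradedProj_gradedPart (d : (ι →₀ K) →ₗ[K] (ι →₀ K)) (g : ι → P) (a : P) (m : ι →₀ K) :
    gradedProj K g a (gradedPart d g m) = gradedPart d g (gradedProj K g a m) := by
  refine LinearMap.congr_fun (f := gradedProj K g a ∘ₗ gradedPart d g)
    (g := gradedPart d g ∘ₗ gradedProj K g a) (Finsupp.lhom_ext' fun x => LinearMap.ext_ring ?_) m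
  have hx : (Finsupp.single x 1 : ι →₀ K) ∈ Finsupp.supported K K {y | g y = g x} :=
    Finsupp.single_mem_supported K _ rfl
  have hy : gradedPart d g (Finsupp.single x 1) ∈ Finsupp.supported K K {y | g y = g x} := by
    rw [gradedPart_single]
    exact Finsupp.supported_mono Set.inter_subset_right
      (gradedProj_mem_supported (T := Set.univ) g _ (by simp))
  simp only [LinearMap.comp_apply, Finsupp.lsingle_apply]
  by_cases h : g x = a
  · subst h
    rw [gradedProj_of_mem hy, gradedProj_of_mem hx]
  · rw [gradedProj_eq_zero_iff.mpr (Finsupp.supported_mono _ hy),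
      gradedProj_eq_zero_iff.mpr (Finsupp.supported_mono _ hx), map_zero]
    all_goals exact fun y hy => ne_of_eq_of_ne hy h

variable [PartialOrder P]

/-- On elements of filtration degree `a`, taking leading terms intertwines an endomorphism and its
degree preserving part. -/
lemma gradedProj_apply_of_filtered {d : (ι →₀ K) →ₗ[K] (ι →₀ K)} {g : ι → P}
    (hd : ∀ a, Finsupp.supported K K {x | g x ≤ a} ≤
      (Finsupp.supported K K {x | g x ≤ a}).comap d) {a : P} {m : ι →₀ K}
    (hm : m ∈ Finsupp.supported K K {x | g x ≤ a}) :
    gradedProj K g a (d m) = gradedPart d g (gradedProj K g a m) := by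
  have key : Finsupp.supported K K {x | g x ≤ a} ≤
      LinearMap.eqLocus (gradedProj K g a ∘ₗ d) (gradedPart d g ∘ₗ gradedProj K g a) := by
    refine supported_le_iff.mpr fun x hx => ?_
    rw [LinearMap.mem_eqLocus, LinearMap.comp_apply, LinearMap.comp_apply]
    by_cases h : g x = a
    · subst h
      rw [gradedProj_of_mem (Finsupp.single_mem_supported K _ rfl), gradedPart_single]
    · rw [gradedProj_eq_zero_iff.mpr (Finsupp.single_mem_supported K _ h), map_zero,
        gradedProj_eq_zero_iff]
      refine Finsupp.supported_mono ?_ (supported_le_iff.mp (hd (g x)) x le_rfl)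
      rintro y (hy : g y ≤ g x) rfl
      exact h (le_antisymm hx hy)
  exact key hm

/-- Applying the degree preserving part to a leading term gives the leading term of the image, so
its square picks out the leading term of `d (d x) = 0`. -/
lemma gradedPart_gradedPart_apply {d : (ι →₀ K) →ₗ[K] (ι →₀ K)} {g : ι → P}
    (hd : ∀ a, Finsupp.supported K K {x | g x ≤ a} ≤
      (Finsupp.supported K K {x | g x ≤ a}).comap d) (hdd : d ∘ₗ d = 0) :
    gradedPart d g ∘ₗ gradedPart d g = 0 := by
  refine Finsupp.lhom_ext' fun x => LinearMap.ext_ring ?_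
  simp only [LinearMap.comp_apply, Finsupp.lsingle_apply, LinearMap.zero_apply]
  rw [gradedPart_single,
    ← gradedProj_apply_of_filtered hd (supported_le_iff.mp (hd (g x)) x le_rfl),
    show d (d (Finsupp.single x 1)) = 0 from LinearMap.congr_fun hdd _, map_zero]

end Graded

/-! ### The associated graded complex of a filtration induced by a grading -/

section GradedFiltration

variable {K : Type u} [Field K] {ι : Type} {P : Type*} [PartialOrder P]

/-- The filtration of a free module induced by a grading of its basis. -/
abbrev gradedFiltration (K : Type u) [Field K] (g : ι → P) (a : P) : Submodule K (ι →₀ K) :=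
  Finsupp.supported K K {x | g x ≤ a}

lemma iSup_gradedFiltration (g : ι → P) (a : P) :
    ⨆ b, ⨆ (_ : b < a), gradedFiltration K g b = Finsupp.supported K K {x | g x < a} := by
  refine le_antisymm (iSup₂_le fun b hb => Finsupp.supported_mono fun x hx => lt_of_le_of_lt hx hb)
    (supported_le_iff.mpr fun x hx => ?_)
  exact (le_iSup₂ (f := fun b (_ : b < a) => gradedFiltration K g b) (g x) hx)
    (Finsupp.single_mem_supported K _ le_rfl)

lemma mem_lower_iff {g : ι → P} {a : P} {m : ι →₀ K} (hm : m ∈ gradedFiltration K g a) :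
    gradedProj K g a m = 0 ↔ m ∈ ⨆ b, ⨆ (_ : b < a), gradedFiltration K g b := by
  rw [iSup_gradedFiltration, gradedProj_eq_zero_iff, mem_supported_iff, mem_supported_iff]
  rw [gradedFiltration, mem_supported_iff] at hm
  exact forall_congr' fun x => forall_congr' fun hx =>
    ⟨fun h => lt_of_le_of_ne (hm x hx) h, fun h => ne_of_lt h⟩

/-- The graded piece of degree `a`, embedded as the span of the basis elements of degree `a`. -/
def grIncl (K : Type u) [Field K] (g : ι → P) (a : P) :
    Gr (gradedFiltration K g) a →ₗ[K] (ι →₀ K) :=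
  Submodule.liftQ _ (gradedProj K g a ∘ₗ (gradedFiltration K g a).subtype)
    fun x hx => (mem_lower_iff x.2).mpr hx

/-- The projection onto the graded piece of degree `a`. -/
def grProj (K : Type u) [Field K] (g : ι → P) (a : P) :
    (ι →₀ K) →ₗ[K] Gr (gradedFiltration K g) a :=
  Submodule.mkQ _ ∘ₗ (gradedProj K g a).codRestrict (gradedFiltration K g a) fun m =>
    Finsupp.supported_mono (fun _ hx => le_of_eq hx.2)
      (gradedProj_mem_supported (T := Set.univ) g a (by simp))

lemma grIncl_grProj (g : ι → P) (a : P) (m : ι →₀ K) :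
    grIncl K g a (grProj K g a m) = gradedProj K g a m :=
  gradedProj_gradedProj g a m

lemma grIncl_injective (g : ι → P) (a : P) : Function.Injective (grIncl K g a) := by
  refine (injective_iff_map_eq_zero _).mpr fun x hx => ?_
  obtain ⟨m, rfl⟩ := Submodule.Quotient.mk_surjective _ x
  exact (Submodule.Quotient.mk_eq_zero _).mpr ((mem_lower_iff m.2).mp hx)

lemma gradedProj_grIncl (g : ι → P) (a : P) (x : Gr (gradedFiltration K g) a) :
    gradedProj K g a (grIncl K g a x) = grIncl K g a x := by
  obtain ⟨m, rfl⟩ := Submodule.Quotient.mk_surjective _ x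
  exact gradedProj_gradedProj g a m.1

lemma grProj_grIncl (g : ι → P) (a : P) (x : Gr (gradedFiltration K g) a) :
    grProj K g a (grIncl K g a x) = x :=
  grIncl_injective g a (by rw [grIncl_grProj, gradedProj_grIncl])

lemma grProj_grIncl_of_ne (g : ι → P) {a b : P} (h : a ≠ b) (x : Gr (gradedFiltration K g) b) :
    grProj K g a (grIncl K g b x) = 0 :=
  grIncl_injective g a (by
    rw [grIncl_grProj, ← gradedProj_grIncl, gradedProj_gradedProj_of_ne g h, map_zero])

lemma grIncl_mem (g : ι → P) (a : P) (T : Set ι) {x : Gr (gradedFiltration K g) a}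
    (hx : x ∈ grSub (gradedFiltration K g) a (Finsupp.supported K K T)) :
    grIncl K g a x ∈ Finsupp.supported K K (T ∩ {x | g x = a}) := by
  obtain ⟨m, hm, rfl⟩ := hx
  exact gradedProj_mem_supported g a hm

lemma grProj_mem (g : ι → P) (a : P) {T : Set ι} {m : ι →₀ K}
    (hm : m ∈ Finsupp.supported K K T) :
    grProj K g a m ∈ grSub (gradedFiltration K g) a (Finsupp.supported K K T) :=
  ⟨_, Finsupp.supported_mono Set.inter_subset_left (gradedProj_mem_supported g a hm), rfl⟩

variable {d : (ι →₀ K) →ₗ[K] (ι →₀ K)} {g : ι → P}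

lemma grIncl_grMap (hd : ∀ a, gradedFiltration K g a ≤ (gradedFiltration K g a).comap d) (a : P)
    (x : Gr (gradedFiltration K g) a) :
    grIncl K g a (grMap (gradedFiltration K g) d hd a x) = gradedPart d g (grIncl K g a x) := by
  obtain ⟨m, rfl⟩ := Submodule.Quotient.mk_surjective _ x
  exact gradedProj_apply_of_filtered hd m.2

lemma grProj_gradedPart (hd : ∀ a, gradedFiltration K g a ≤ (gradedFiltration K g a).comap d)
    (a : P) (m : ι →₀ K) :
    grProj K g a (gradedPart d g m) = grMap (gradedFiltration K g) d hd a (grProj K g a m) :=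
  grIncl_injective g a (by
    rw [grIncl_grMap, grIncl_grProj, grIncl_grProj, gradedProj_gradedPart])

/-- The homology of the associated graded complex, summed over an injective family of degrees, is
the homology of the degree preserving part of the differential. -/
lemma exists_grHomology_equiv [Finite ι]
    (hd : ∀ a, gradedFiltration K g a ≤ (gradedFiltration K g a).comap d)
    {κ : Type} {e : κ → P} (he : Function.Injective e) {T₀ T₁ T₀' T₁' : Set ι}
    (h₀ : T₀ ∩ {x | g x ∈ Set.range e} = T₀') (h₁ : T₁ ∩ {x | g x ∈ Set.range e} = T₁') :
    ∃ Φ : (⨁ k, Homology (grMap (gradedFiltration K g) d hd (e k))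
        (grSub (gradedFiltration K g) (e k) (Finsupp.supported K K T₀))
        (grSub (gradedFiltration K g) (e k) (Finsupp.supported K K T₁))) ≃ₗ[K]
      Homology (gradedPart d g) (Finsupp.supported K K T₀')
        (Finsupp.supported K K T₁'),
      ∀ N : Set ι, directSumSub (fun k => homologySub (grMap (gradedFiltration K g) d hd (e k))
        (grSub (gradedFiltration K g) (e k) (Finsupp.supported K K T₀))
        (grSub (gradedFiltration K g) (e k) (Finsupp.supported K K T₁))
        (grSub (gradedFiltration K g) (e k) (Finsupp.supported K K N))) =
      (homologySub (gradedPart d g)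
        (Finsupp.supported K K T₀')
        (Finsupp.supported K K T₁')
        (Finsupp.supported K K N)).comap Φ.toLinearMap := by
  subst h₀ h₁
  have hi : ∀ (k : κ) (T : Set ι),
      grSub (gradedFiltration K g) (e k) (Finsupp.supported K K T) ≤
      (Finsupp.supported K K (T ∩ {x | g x ∈ Set.range e})).comap (grIncl K g (e k)) :=
    fun k T x hx => Finsupp.supported_mono
      (s := T ∩ {x | g x = e k}) (t := T ∩ {x | g x ∈ Set.range e})
      (fun y hy => ⟨hy.1, k, hy.2.symm⟩) (grIncl_mem g (e k) T hx)
  have hp : ∀ (k : κ) (T : Set ι),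
      Finsupp.supported K K (T ∩ {x | g x ∈ Set.range e}) ≤
      (grSub (gradedFiltration K g) (e k) (Finsupp.supported K K T)).comap (grProj K g (e k)) :=
    fun k T x hx => grProj_mem g (e k) (Finsupp.supported_mono Set.inter_subset_left hx)
  let i := fun k => Homology.map (grIncl K g (e k)) (grIncl_grMap hd (e k)) (hi k T₀) (hi k T₁)
  let p := fun k => Homology.map (grProj K g (e k)) (grProj_gradedPart hd (e k)) (hp k T₀) (hp k T₁)
  have hpi : ∀ k x, p k (i k x) = x := by
    intro k x
    obtain ⟨y, rfl⟩ := Submodule.Quotient.mk_surjective _ x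
    exact congrArg Submodule.Quotient.mk (Subtype.ext (grProj_grIncl g (e k) y.1))
  have hpi' : ∀ k l, k ≠ l → ∀ x, p k (i l x) = 0 := by
    intro k l hkl x
    obtain ⟨y, rfl⟩ := Submodule.Quotient.mk_surjective _ x
    exact congrArg Submodule.Quotient.mk
      (Subtype.ext (grProj_grIncl_of_ne g (he.ne hkl) y.1))
  have hsum : ∀ x, ∃ s : Finset κ, x = ∑ k ∈ s, i k (p k x) := by
    intro x
    obtain ⟨y, rfl⟩ := Submodule.Quotient.mk_surjective _ x
    obtain ⟨s, hs⟩ := sum_gradedProj (g := g) he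
      (Finsupp.supported_mono Set.inter_subset_right y.2.1)
    refine ⟨s, ?_⟩
    have hmem : ∀ k, gradedProj K g (e k) y.1 ∈
        Finsupp.supported K K (T₁ ∩ {x | g x ∈ Set.range e}) ⊓
          LinearMap.ker (gradedPart d g) := fun k =>
      ⟨Finsupp.supported_mono Set.inter_subset_left (gradedProj_mem_supported g _ y.2.1), by
        change gradedPart d g _ = 0
        rw [← gradedProj_gradedPart, LinearMap.mem_ker.mp y.2.2, map_zero]⟩
    have hk : ∀ k, i k (p k (Submodule.Quotient.mk y)) =
        Submodule.mkQ _ ⟨gradedProj K g (e k) y.1, hmem k⟩ := fun k =>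
      congrArg Submodule.Quotient.mk (Subtype.ext (grIncl_grProj g (e k) y.1))
    simp only [hk]
    rw [← map_sum]
    refine congrArg (Submodule.mkQ _) (Subtype.ext ?_)
    rw [AddSubmonoidClass.coe_finsetSum]
    exact hs
  obtain ⟨Φ, hΦ⟩ := exists_directSum_equiv i p hpi hpi' hsum
  refine ⟨Φ, fun N => hΦ _ _ (fun k x hx => ?_) (fun k x hx => ?_)⟩
  · exact Homology.map_mem_homologySub
      (A := grSub (gradedFiltration K g) (e k) (Finsupp.supported K K N))
      (B := Finsupp.supported K K N) (grIncl K g (e k))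
      (grIncl_grMap hd (e k)) (hi k T₀) (hi k T₁)
      (fun y hy => Finsupp.supported_mono Set.inter_subset_left (grIncl_mem g (e k) N hy)) hx
  · exact Homology.map_mem_homologySub
      (A := Finsupp.supported K K N)
      (B := grSub (gradedFiltration K g) (e k) (Finsupp.supported K K N)) (grProj K g (e k))
      (grProj_gradedPart hd (e k)) (hp k T₀) (hp k T₁) (fun y hy => grProj_mem g (e k) hy) hx

end GradedFiltration

/-! ### The spectral sequence of a filtered complex -/

section SpectralSequence

variable {K : Type u} [Field K] {M : Type u} [AddCommGroup M] [Module K M]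

/-- A surjection from `Z` with kernel `Z ∩ B` identifies its target with `Z / (Z ∩ B)`. -/
def subquotientEquiv {Z B : Submodule K M} {V : Type u} [AddCommGroup V] [Module K V]
    (φ : Z →ₗ[K] V) (hφ : Function.Surjective φ) (h : ∀ x, φ x = 0 ↔ x.1 ∈ B) :
    (↥Z ⧸ B.submoduleOf Z) ≃ₗ[K] V :=
  (Submodule.quotEquivOfEq _ _ (Submodule.ext fun x => (h x).symm)).trans
    (φ.quotKerEquivOfSurjective hφ)

variable (d : M →ₗ[K] M) (piece : ℤ → ℤ → Submodule K M) (F : ℤ → Submodule K M)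

/-- The elements of filtration degree `a` whose boundary has filtration degree `a - r`. -/
def approxCycles (r a h q : ℤ) : Submodule K M := F a ⊓ piece h q ⊓ (F (a - r)).comap d

/-- The submodule by which the cycles are divided on the `r`-th page. -/
def approxBoundaries (r a h q : ℤ) : Submodule K M :=
  approxCycles d piece F (r - 1) (a - 1) h q ⊔
    (approxCycles d piece F (r - 1) (a + r - 1) (h - 1) q).map d

/-- The terms of the `r`-th page. -/
abbrev PageTerm (r : ℤ) (i : ℤ × ℤ × ℤ) : Type u :=
  ↥(approxCycles d piece F r i.1 i.2.1 i.2.2) ⧸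
    (approxBoundaries d piece F r i.1 i.2.1 i.2.2).submoduleOf
      (approxCycles d piece F r i.1 i.2.1 i.2.2)

variable {d piece F}

lemma mem_approxCycles {r a h q : ℤ} {x : M} : x ∈ approxCycles d piece F r a h q ↔
    x ∈ F a ∧ x ∈ piece h q ∧ d x ∈ F (a - r) := and_assoc

lemma mem_approxBoundaries {r a h q : ℤ} {x : M} : x ∈ approxBoundaries d piece F r a h q ↔
    ∃ u w, (u ∈ F (a - 1) ∧ u ∈ piece h q ∧ d u ∈ F (a - r)) ∧
      (w ∈ F (a + r - 1) ∧ w ∈ piece (h - 1) q ∧ d w ∈ F a) ∧ u + d w = x := by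
  have h1 : a - 1 - (r - 1) = a - r := by ring
  have h2 : a + r - 1 - (r - 1) = a := by ring
  simp only [approxBoundaries, Submodule.mem_sup, Submodule.mem_map, mem_approxCycles, h1, h2]
  constructor
  · rintro ⟨u, hu, _, ⟨w, hw, rfl⟩, h⟩
    exact ⟨u, w, hu, hw, h⟩
  · rintro ⟨u, w, hu, hw, h⟩
    exact ⟨u, hu, _, ⟨w, hw, rfl⟩, h⟩

lemma rel_iff {r : ℤ} {i j : ℤ × ℤ × ℤ} : (ComplexShape.up' ((-r, 1, 0) : ℤ × ℤ × ℤ)).Rel i j ↔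
    j.1 = i.1 - r ∧ j.2.1 = i.2.1 + 1 ∧ j.2.2 = i.2.2 := by
  obtain ⟨a, h, q⟩ := i
  obtain ⟨a', h', q'⟩ := j
  simp only [ComplexShape.up'_Rel, Prod.mk_add_mk, Prod.mk.injEq]
  omega

section

variable (hF : IsFilteredComplex d piece F)
include hF

lemma IsFilteredComplex.d_d (x : M) : d (d x) = 0 := LinearMap.congr_fun hF.sq_zero x

lemma IsFilteredComplex.d_mem_piece {h h' q : ℤ} {x : M} (hx : x ∈ piece h q) (hh : h' = h + 1) :
    d x ∈ piece h' q := hh ▸ hF.degree h q hx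

lemma IsFilteredComplex.mem_of_le {a b : ℤ} {x : M} (hx : x ∈ F a) (hab : a ≤ b) : x ∈ F b :=
  hF.monotone hab hx

end

/-- The differential of the `r`-th page. -/
def pageMap (hF : IsFilteredComplex d piece F) {r : ℤ} {i j : ℤ × ℤ × ℤ}
    (hij : (ComplexShape.up' ((-r, 1, 0) : ℤ × ℤ × ℤ)).Rel i j) :
    PageTerm d piece F r i →ₗ[K] PageTerm d piece F r j :=
  Submodule.mapQ _ _ (d.restrict (p := approxCycles d piece F r i.1 i.2.1 i.2.2)
      (q := approxCycles d piece F r j.1 j.2.1 j.2.2) fun x hx => by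
    obtain ⟨h1, h2, h3⟩ := rel_iff.mp hij
    rw [mem_approxCycles] at hx ⊢
    rw [h1, h2, h3]
    exact ⟨hx.2.2, hF.d_mem_piece hx.2.1 rfl, by rw [hF.d_d]; exact zero_mem _⟩) <| by
    rintro ⟨x, hx⟩ hxB
    obtain ⟨h1, h2, h3⟩ := rel_iff.mp hij
    obtain ⟨u, w, hu, hw, rfl⟩ := mem_approxBoundaries.mp (Submodule.mem_comap.mp hxB)
    refine Submodule.mem_comap.mpr (Submodule.mem_comap.mpr (mem_approxBoundaries.mpr
      ⟨0, u, ⟨zero_mem _, zero_mem _, by rw [map_zero]; exact zero_mem _⟩, ⟨?_, ?_, ?_⟩, ?_⟩))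
    · rw [h1]; exact hF.mem_of_le hu.1 (by omega)
    · rw [h2, h3, add_sub_cancel_right]; exact hu.2.1
    · rw [h1]; exact hu.2.2
    · rw [zero_add]
      change d u = d (u + d w)
      rw [map_add, hF.d_d, add_zero]

/-- The correction `v` has lower filtration degree, so `x - v` represents the same class and
survives to the next page. This gives surjectivity in `pageHomologyEquiv`. -/
lemma pageMap_mk_eq_zero_iff (hF : IsFilteredComplex d piece F) {r : ℤ} {i j : ℤ × ℤ × ℤ}
    (hij : (ComplexShape.up' ((-r, 1, 0) : ℤ × ℤ × ℤ)).Rel i j)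
    (x : approxCycles d piece F r i.1 i.2.1 i.2.2) :
    pageMap hF hij (Submodule.Quotient.mk x) = 0 ↔
      ∃ v ∈ F (i.1 - 1), v ∈ piece i.2.1 i.2.2 ∧ d v ∈ F (i.1 - r) ∧
        d (x.1 - v) ∈ F (i.1 - r - 1) := by
  obtain ⟨h1, h2, h3⟩ := rel_iff.mp hij
  refine (Submodule.Quotient.mk_eq_zero _).trans ((Submodule.mem_comap.trans
    mem_approxBoundaries).trans ?_)
  change (∃ u w, _ ∧ _ ∧ u + d w = d x.1) ↔ _
  rw [h1, h2, h3]
  constructor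
  · rintro ⟨u, w, hu, hw, h⟩
    refine ⟨w, by convert hw.1 using 2; ring, by simpa using hw.2.1, hw.2.2, ?_⟩
    have : d (x.1 - w) = u := by
      rw [map_sub, sub_eq_iff_eq_add]
      exact h.symm
    rw [this]
    exact hu.1
  · rintro ⟨v, hv1, hv2, hv3, hv4⟩
    refine ⟨d (x.1 - v), v, ⟨hv4, hF.d_mem_piece (sub_mem (mem_approxCycles.mp x.2).2.1 hv2) rfl,
      by rw [hF.d_d]; exact zero_mem _⟩, ⟨by convert hv1 using 2; ring, by simpa using hv2, hv3⟩, ?_⟩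
    rw [map_sub, sub_add_cancel]

lemma pageMap_pageMap (hF : IsFilteredComplex d piece F) {r : ℤ} {i j k : ℤ × ℤ × ℤ}
    (hij : (ComplexShape.up' ((-r, 1, 0) : ℤ × ℤ × ℤ)).Rel i j)
    (hjk : (ComplexShape.up' ((-r, 1, 0) : ℤ × ℤ × ℤ)).Rel j k) (x) :
    pageMap hF hjk (pageMap hF hij x) = 0 := by
  obtain ⟨x, rfl⟩ := Submodule.Quotient.mk_surjective _ x
  refine (congrArg Submodule.Quotient.mk (Subtype.ext (hF.d_d x.1))).trans rfl

lemma approxCycles_succ_le (hF : IsFilteredComplex d piece F) (r a h q : ℤ) :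
    approxCycles d piece F (r + 1) a h q ≤ approxCycles d piece F r a h q := fun x hx => by
  rw [mem_approxCycles] at hx ⊢
  exact ⟨hx.1, hx.2.1, hF.mem_of_le hx.2.2 (by omega)⟩

/-- Elements surviving one page further, as cycles of the page. -/
def toPageCycles (hF : IsFilteredComplex d piece F) {r : ℤ} {i j : ℤ × ℤ × ℤ}
    (hij : (ComplexShape.up' ((-r, 1, 0) : ℤ × ℤ × ℤ)).Rel i j) :
    approxCycles d piece F (r + 1) i.1 i.2.1 i.2.2 →ₗ[K] LinearMap.ker (pageMap hF hij) :=
  (Submodule.mkQ _ ∘ₗ Submodule.inclusion (approxCycles_succ_le hF r i.1 i.2.1 i.2.2)).codRestrict _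
    fun x => LinearMap.mem_ker.mpr <| (pageMap_mk_eq_zero_iff hF hij _).mpr
      ⟨0, zero_mem _, zero_mem _, by rw [map_zero]; exact zero_mem _, by
        rw [sub_zero, sub_sub]; exact (mem_approxCycles.mp x.2).2.2⟩

/-- The next page is the homology of a page. -/
def pageHomologyEquiv (hF : IsFilteredComplex d piece F) {r : ℤ} {i j k : ℤ × ℤ × ℤ}
    (hij : (ComplexShape.up' ((-r, 1, 0) : ℤ × ℤ × ℤ)).Rel i j)
    (hjk : (ComplexShape.up' ((-r, 1, 0) : ℤ × ℤ × ℤ)).Rel j k) :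
    PageTerm d piece F (r + 1) j ≃ₗ[K]
      LinearMap.ker (pageMap hF hjk) ⧸ LinearMap.range ((pageMap hF hij).codRestrict
        (LinearMap.ker (pageMap hF hjk)) (pageMap_pageMap hF hij hjk)) :=
  subquotientEquiv (Submodule.mkQ _ ∘ₗ toPageCycles hF hjk)
    (by
      intro y
      obtain ⟨⟨y, hy⟩, rfl⟩ := Submodule.Quotient.mk_surjective _ y
      obtain ⟨x, rfl⟩ := Submodule.Quotient.mk_surjective _ y
      obtain ⟨v, hv1, hv2, hv3, hv4⟩ := (pageMap_mk_eq_zero_iff hF hjk x).mp hy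
      have hx := mem_approxCycles.mp x.2
      refine ⟨⟨x.1 - v, mem_approxCycles.mpr ⟨sub_mem hx.1 (hF.mem_of_le hv1 (by omega)),
        sub_mem hx.2.1 hv2, by rw [← sub_sub]; exact hv4⟩⟩, ?_⟩
      refine congrArg (Submodule.mkQ _) (Subtype.ext ?_)
      refine (Submodule.Quotient.eq _).mpr (Submodule.mem_comap.mpr (mem_approxBoundaries.mpr
        ⟨-v, 0, ⟨neg_mem hv1, neg_mem hv2, by rw [map_neg]; exact neg_mem hv3⟩,
          ⟨zero_mem _, zero_mem _, by rw [map_zero]; exact zero_mem _⟩, ?_⟩))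
      rw [map_zero, add_zero]
      exact (sub_sub_cancel_left x.1 v).symm)
    (by
      intro x
      obtain ⟨h1, h2, h3⟩ := rel_iff.mp hij
      have hx := mem_approxCycles.mp x.2
      refine (Submodule.Quotient.mk_eq_zero _).trans ?_
      rw [mem_approxBoundaries]
      constructor
      · rintro ⟨w, hw⟩
        obtain ⟨w, rfl⟩ := Submodule.Quotient.mk_surjective _ w
        obtain ⟨u', w', hu', hw', he⟩ := mem_approxBoundaries.mp (Submodule.mem_comap.mp
          ((Submodule.Quotient.eq _).mp (congrArg Subtype.val hw).symm))
        have hw2 := mem_approxCycles.mp w.2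
        replace he : u' + d w' = x.1 - d w.1 := he
        have hx' : u' + d (w.1 + w') = x.1 := by
          rw [map_add, add_left_comm, he, add_sub_cancel]
        refine ⟨u', w.1 + w', ⟨hu'.1, hu'.2.1, ?_⟩, ⟨add_mem ?_ ?_, add_mem ?_ hw'.2.1, ?_⟩, hx'⟩
        · have hd := congrArg d hx'
          rw [map_add, hF.d_d, add_zero] at hd
          rw [hd]
          exact hx.2.2
        · exact hF.mem_of_le hw2.1 (by omega)
        · exact hF.mem_of_le hw'.1 (by omega)
        · rw [h2, h3, add_sub_cancel_right]
          exact hw2.2.1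
        · rw [map_add]
          exact add_mem (hF.mem_of_le hw2.2.2 (by omega)) hw'.2.2
      · rintro ⟨u, w, hu, hw, he⟩
        refine ⟨Submodule.Quotient.mk ⟨w, mem_approxCycles.mpr ⟨hF.mem_of_le hw.1 (by omega), ?_,
          hF.mem_of_le hw.2.2 (by omega)⟩⟩, Subtype.ext ?_⟩
        · convert hw.2.1 using 2 <;> omega
        · refine ((Submodule.Quotient.eq _).mpr (Submodule.mem_comap.mpr (mem_approxBoundaries.mpr
            ⟨u, 0, ⟨hu.1, hu.2.1, hF.mem_of_le hu.2.2 (by omega)⟩,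
              ⟨zero_mem _, zero_mem _, by rw [map_zero]; exact zero_mem _⟩, ?_⟩))).symm
          change u + d 0 = x.1 - d w
          rw [← he, map_zero, add_zero, add_sub_cancel_right])

open Classical in
/-- The pages as complexes. -/
def pageComplex (hF : IsFilteredComplex d piece F) (r : ℤ) :
    HomologicalComplex (ModuleCat.{u} K) (ComplexShape.up' ((-r, 1, 0) : ℤ × ℤ × ℤ)) where
  X i := ModuleCat.of K (PageTerm d piece F r i)
  d i j := if h : (ComplexShape.up' ((-r, 1, 0) : ℤ × ℤ × ℤ)).Rel i j then
    ModuleCat.ofHom (pageMap hF h) else 0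
  shape i j h := dif_neg h
  d_comp_d' i j k hij hjk := by
    rw [dif_pos hij, dif_pos hjk]
    exact ModuleCat.hom_ext (LinearMap.ext fun x => pageMap_pageMap hF hij hjk x)

lemma pageComplex_d (hF : IsFilteredComplex d piece F) {r : ℤ} {i j : ℤ × ℤ × ℤ}
    (h : (ComplexShape.up' ((-r, 1, 0) : ℤ × ℤ × ℤ)).Rel i j) :
    (pageComplex hF r).d i j = ModuleCat.ofHom (pageMap hF h) := dif_pos h

/-- The homology of a short complex of modules with prescribed maps. -/
def homologyIsoOfEq {S : ShortComplex (ModuleCat.{u} K)} {f : S.X₁ →ₗ[K] S.X₂}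
    {g : S.X₂ →ₗ[K] S.X₃} (hf : S.f = ModuleCat.ofHom f) (hg : S.g = ModuleCat.ofHom g)
    (h : ∀ x, g (f x) = 0) :
    S.homology ≅ ModuleCat.of K
      (LinearMap.ker g ⧸ LinearMap.range (f.codRestrict (LinearMap.ker g) h)) :=
  S.moduleCatHomologyIso ≪≫ eqToIso (by
    obtain rfl : S.f.hom = f := by rw [hf]; rfl
    obtain rfl : S.g.hom = g := by rw [hg]; rfl
    rfl)

/-- The homology of a page is the next page. -/
def pageComplexHomologyIso (hF : IsFilteredComplex d piece F) (r : ℤ) (j : ℤ × ℤ × ℤ) :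
    (pageComplex hF r).homology j ≅ (pageComplex hF (r + 1)).X j :=
  have hij : (ComplexShape.up' ((-r, 1, 0) : ℤ × ℤ × ℤ)).Rel (j - (-r, 1, 0)) j :=
    sub_add_cancel _ _
  have hjk : (ComplexShape.up' ((-r, 1, 0) : ℤ × ℤ × ℤ)).Rel j (j + (-r, 1, 0)) := rfl
  ShortComplex.homologyMapIso ((pageComplex hF r).isoSc' _ j _
    ((ComplexShape.up' ((-r, 1, 0) : ℤ × ℤ × ℤ)).prev_eq' hij)
    ((ComplexShape.up' ((-r, 1, 0) : ℤ × ℤ × ℤ)).next_eq' hjk)) ≪≫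
  homologyIsoOfEq (pageComplex_d hF hij) (pageComplex_d hF hjk) (pageMap_pageMap hF hij hjk) ≪≫
  (pageHomologyEquiv hF hij hjk).symm.toModuleIso

/-- The spectral sequence of a filtered complex. -/
def spectralSequence (hF : IsFilteredComplex d piece F) : TrigradedSpectralSequence K where
  page r _ := pageComplex hF r
  iso r r' j hr _ := by
    subst hr
    exact pageComplexHomologyIso hF r j

end SpectralSequence

/-! ### The first page -/

section FirstPage

variable {K : Type u} [Field K] {ι : Type} {d : (ι →₀ K) →ₗ[K] (ι →₀ K)} {T : ℤ → ℤ → Set ι}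
  {f : ι → ℤ}

lemma gradedProj_eq_zero_iff_of_mem {a : ℤ} {m : ι →₀ K} (hm : m ∈ gradedFiltration K f a) :
    gradedProj K f a m = 0 ↔ m ∈ gradedFiltration K f (a - 1) := by
  rw [mem_lower_iff hm, iSup_gradedFiltration]
  simp only [gradedFiltration, Int.le_sub_one_iff]

/-- The first page is the homology of the degree preserving part of the differential. -/
def firstPageEquiv
    (hF : IsFilteredComplex d (fun h q => Finsupp.supported K K (T h q)) (gradedFiltration K f))
    (a h q : ℤ) :
    PageTerm d (fun h q => Finsupp.supported K K (T h q)) (gradedFiltration K f) 1 (a, h, q) ≃ₗ[K]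
      Homology (gradedPart d f) (Finsupp.supported K K (T (h - 1) q ∩ {x | f x = a}))
        (Finsupp.supported K K (T h q ∩ {x | f x = a})) :=
  subquotientEquiv
    -- An element is sent to its leading term, which is a cycle of the degree preserving part
    -- because the boundary of the element drops to degree `a - 1`.
    (Submodule.mkQ _ ∘ₗ (gradedProj K f a).restrict (p := approxCycles d _ _ 1 a h q)
      (q := Finsupp.supported K K (T h q ∩ {x | f x = a}) ⊓ LinearMap.ker (gradedPart d f))
      fun x hx => by
        rw [mem_approxCycles] at hx
        refine ⟨gradedProj_mem_supported f a hx.2.1, ?_⟩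
        change gradedPart d f _ = 0
        rw [← gradedProj_apply_of_filtered hF.filtered hx.1,
          gradedProj_eq_zero_iff_of_mem (hF.filtered a hx.1)]
        exact hx.2.2)
    (by
      intro y
      obtain ⟨⟨y, hy, hdy⟩, rfl⟩ := Submodule.Quotient.mk_surjective _ y
      have hya : y ∈ Finsupp.supported K K {x | f x = a} :=
        Finsupp.supported_mono Set.inter_subset_right hy
      have hyF : y ∈ gradedFiltration K f a :=
        Finsupp.supported_mono (fun x (hx : f x = a) => le_of_eq hx) hya
      have hyd : d y ∈ gradedFiltration K f (a - 1) := by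
        rw [← gradedProj_eq_zero_iff_of_mem (hF.filtered a hyF),
          gradedProj_apply_of_filtered hF.filtered hyF, gradedProj_of_mem hya]
        exact hdy
      exact ⟨⟨y, mem_approxCycles.mpr ⟨hyF, Finsupp.supported_mono Set.inter_subset_left hy, hyd⟩⟩,
        congrArg Submodule.Quotient.mk (Subtype.ext (gradedProj_of_mem hya))⟩)
    (by
      intro x
      have hx := mem_approxCycles.mp x.2
      refine (Submodule.Quotient.mk_eq_zero _).trans ?_
      rw [mem_approxBoundaries]
      constructor
      · rintro ⟨w, hw, he⟩
        replace he : gradedPart d f w = gradedProj K f a x.1 := he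
        have hwa : w ∈ Finsupp.supported K K {x | f x = a} :=
          Finsupp.supported_mono Set.inter_subset_right hw
        have hwT : w ∈ Finsupp.supported K K (T (h - 1) q) :=
          Finsupp.supported_mono Set.inter_subset_left hw
        have hwF : w ∈ gradedFiltration K f a :=
          Finsupp.supported_mono (fun x (hx : f x = a) => le_of_eq hx) hwa
        refine ⟨x.1 - d w, w, ⟨?_, sub_mem hx.2.1 (hF.d_mem_piece hwT (sub_add_cancel h 1).symm), ?_⟩,
          ⟨by simpa using hwF, hwT, hF.filtered a hwF⟩, sub_add_cancel _ _⟩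
        · rw [← gradedProj_eq_zero_iff_of_mem (sub_mem hx.1 (hF.filtered a hwF)), map_sub,
            gradedProj_apply_of_filtered hF.filtered hwF, gradedProj_of_mem hwa, he, sub_self]
        · rw [map_sub, hF.d_d, sub_zero]
          exact hx.2.2
      · rintro ⟨v, w, hv, hw, he⟩
        have hwF : w ∈ gradedFiltration K f a := by simpa using hw.1
        refine ⟨gradedProj K f a w, gradedProj_mem_supported f a hw.2.1, ?_⟩
        rw [← gradedProj_apply_of_filtered hF.filtered hwF]
        change _ = gradedProj K f a x.1
        rw [← he, map_add, (gradedProj_eq_zero_iff_of_mem (hF.mem_of_le hv.1 (by omega))).mpr hv.1,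
          zero_add])

end FirstPage

/-! ### Convergence -/

section Convergence

variable {K : Type u} [Field K] {M : Type u} [AddCommGroup M] [Module K M] {d : M →ₗ[K] M}
  {piece : ℤ → ℤ → Submodule K M} {F : ℤ → Submodule K M}

lemma subsingleton_pageTerm_of_le {r : ℤ} {i : ℤ × ℤ × ℤ} (h : F i.1 ≤ F (i.1 - 1)) :
    Subsingleton (PageTerm d piece F r i) := by
  refine Submodule.Quotient.subsingleton_iff.mpr (eq_top_iff.mpr fun x _ => ?_)
  have hx := mem_approxCycles.mp x.2
  exact Submodule.mem_comap.mpr (mem_approxBoundaries.mpr ⟨x.1, 0, ⟨h hx.1, hx.2⟩,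
    ⟨zero_mem _, zero_mem _, by rw [map_zero]; exact zero_mem _⟩, by rw [map_zero]; exact add_zero _⟩)

/-- Terms are nonzero only in filtration degrees from `-B` to `B`, and the differential lowers the
degree by more than the length `2 * B` of this range; so its source or its target is zero. -/
lemma pageComplex_d_eq_zero (hF : IsFilteredComplex d piece F) {B : ℤ}
    (hbot : ∀ a < -B, F a = ⊥) (htop : ∀ a ≥ B, F a = ⊤) {r : ℤ} (hr : 2 * B + 1 ≤ r)
    (i j : ℤ × ℤ × ℤ) : (pageComplex hF r).d i j = 0 := by
  by_cases hij : (ComplexShape.up' ((-r, 1, 0) : ℤ × ℤ × ℤ)).Rel i j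
  · rw [pageComplex_d hF hij]
    refine ModuleCat.hom_ext (LinearMap.ext fun x => ?_)
    rcases lt_or_ge B i.1 with h | h
    · have : Subsingleton (PageTerm d piece F r i) :=
        subsingleton_pageTerm_of_le (by rw [htop (i.1 - 1) (by omega)]; exact le_top)
      exact (congrArg (pageMap hF hij) (Subsingleton.elim x 0)).trans (map_zero _)
    · have : Subsingleton (PageTerm d piece F r j) := by
        have hj := (rel_iff.mp hij).1
        exact subsingleton_pageTerm_of_le (by rw [hbot j.1 (by omega)]; exact bot_le)
      exact Subsingleton.elim (α := PageTerm d piece F r j) _ _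
  · exact (pageComplex hF r).shape i j hij

/-- For a bounded filtration, the late pages are the associated graded of the homology. -/
lemma nonempty_pageTerm_equiv (hF : IsFilteredComplex d piece F) {B : ℤ}
    (hbot : ∀ a < -B, F a = ⊥) (htop : ∀ a ≥ B, F a = ⊤) {r : ℤ} (hr : 2 * B + 1 ≤ r) (a h q : ℤ)
    {V : Type u} [AddCommGroup V] [Module K V] (φ : ↥(piece h q ⊓ LinearMap.ker d) →ₗ[K] V)
    (hφ : ∀ x, φ x = 0 ↔ x.1 ∈ (piece (h - 1) q).map d) {G : ℤ → Submodule K V}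
    (hG : ∀ a, G a = ((F a).submoduleOf (piece h q ⊓ LinearMap.ker d)).map φ) :
    Nonempty (PageTerm d piece F r (a, h, q) ≃ₗ[K] (↥(G a) ⧸ (G (a - 1)).submoduleOf (G a))) := by
  have hle : F a ≤ F (a - 1) → Nonempty (PageTerm d piece F r (a, h, q) ≃ₗ[K]
      (↥(G a) ⧸ (G (a - 1)).submoduleOf (G a))) := by
    intro hFa
    have h1 : Subsingleton (PageTerm d piece F r (a, h, q)) := subsingleton_pageTerm_of_le hFa
    have h2 : Subsingleton (↥(G a) ⧸ (G (a - 1)).submoduleOf (G a)) := by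
      refine Submodule.Quotient.subsingleton_iff.mpr (eq_top_iff.mpr fun x _ => ?_)
      have : G a ≤ G (a - 1) := by
        rw [hG, hG]
        exact Submodule.map_mono (Submodule.comap_mono hFa)
      exact Submodule.mem_comap.mpr (this x.2)
    exact ⟨LinearEquiv.ofSubsingleton _ _⟩
  rcases lt_or_ge B a with ha | ha
  · exact hle (by rw [htop (a - 1) (by omega)]; exact le_top)
  rcases lt_or_ge a (-B) with ha' | ha'
  · exact hle (by rw [hbot a ha']; exact bot_le)
  -- As `a` lies between `-B` and `B`, the bound on `r` gives `a - r < -B` and `a + r - 1 ≥ B`. So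
  -- approximate cycles are cycles, and the filtration no longer restricts which elements bound
  -- them.
  have hbot' : F (a - r) = ⊥ := hbot _ (by omega)
  have hker : ∀ x ∈ approxCycles d piece F r a h q, x ∈ piece h q ⊓ LinearMap.ker d := by
    intro x hx
    rw [mem_approxCycles, hbot'] at hx
    exact ⟨hx.2.1, hx.2.2⟩
  let ψ : approxCycles d piece F r a h q →ₗ[K] G a :=
    (φ ∘ₗ Submodule.inclusion hker).codRestrict (G a) fun x => by
      rw [hG]
      exact ⟨_, (mem_approxCycles.mp x.2).1, rfl⟩
  refine ⟨subquotientEquiv (Submodule.mkQ _ ∘ₗ ψ)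
    ((Submodule.mkQ_surjective _).comp fun y => ?_) fun x => ?_⟩
  · obtain ⟨y, hy⟩ := y
    obtain ⟨x, hx, hxy⟩ := (hG a).le hy
    refine ⟨⟨x.1, mem_approxCycles.mpr ⟨hx, x.2.1, ?_⟩⟩, Subtype.ext hxy⟩
    rw [LinearMap.mem_ker.mp x.2.2]
    exact zero_mem _
  · have hx := mem_approxCycles.mp x.2
    refine (Submodule.Quotient.mk_eq_zero _).trans ?_
    rw [Submodule.submoduleOf, Submodule.mem_comap, hG, mem_approxBoundaries]
    constructor
    · rintro ⟨y, hy, he⟩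
      have hxy : φ (⟨x.1, hker _ x.2⟩ - y) = 0 := by
        rw [map_sub, he]
        exact sub_self _
      obtain ⟨w, hw, hwe⟩ := (hφ _).mp hxy
      replace hwe : d w = x.1 - y.1 := hwe
      refine ⟨y.1, w, ⟨hy, y.2.1, ?_⟩, ⟨?_, hw, ?_⟩, by rw [hwe, add_sub_cancel]⟩
      · rw [LinearMap.mem_ker.mp y.2.2]
        exact zero_mem _
      · rw [htop _ (by omega)]
        exact Submodule.mem_top
      · rw [hwe]
        exact sub_mem hx.1 (hF.mem_of_le hy (by omega))
    · rintro ⟨v, w, hv, hw, he⟩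
      rw [hbot'] at hv
      refine ⟨⟨v, hv.2.1, hv.2.2⟩, hv.1, ?_⟩
      have : φ (⟨x.1, hker _ x.2⟩ - ⟨v, hv.2.1, hv.2.2⟩) = 0 :=
        (hφ _).mpr ⟨w, hw.2.1, eq_sub_of_add_eq' he⟩
      rw [map_sub, sub_eq_zero] at this
      exact this.symm

end Convergence

/-! ### Enlarging the surface -/

/-- A module with a basis, an endomorphism and gradings of the basis. -/
structure GradedComplexData (K : Type u) [Field K] where
  basis : Type
  differential : (basis →₀ K) →ₗ[K] (basis →₀ K)
  hDegree : basis → ℤ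
  qDegree : basis → ℤ
  gradingAt : ℂ → basis → ℤ

section OfWalk

variable (K : Type u) [Field K] {m : ℕ} {X : Type} [Finite X]
  (walk : (Fin m → Bool) → ((Fin m × Bool) ⊕ X) × Bool → ((Fin m × Bool) ⊕ X) × Bool)
  (winding : ℂ → (Fin m → Bool) → (Fin m × Bool) ⊕ X → ℤ)
  (next : Equiv.Perm (Fin m × Bool))

/-- The circles of a resolution, in terms of the walk along the edges. -/
abbrev WalkCircle (S : Fin m → Bool) : Type :=
  Quot fun e f : (Fin m × Bool) ⊕ X => ∃ b b', walk S (e, b) = (f, b')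

open Classical in
/-- The coefficients of the edges of the cube of resolutions, in terms of the walk. -/
def walkCubeCoeff (c : Fin m) (x y : Σ S, WalkCircle walk S → ℤˣ) : K :=
  let e : (Fin m × Bool) ⊕ X := Sum.inl (c, true)
  let f : (Fin m × Bool) ⊕ X := Sum.inl (next.symm (c, true))
  let circ : ∀ S, (Fin m × Bool) ⊕ X → WalkCircle walk S := fun _ g => Quot.mk _ g
  if ∀ g, circ x.1 g ≠ circ x.1 e → circ x.1 g ≠ circ x.1 f →
      y.2 (circ y.1 g) = x.2 (circ x.1 g) then
    if circ x.1 e ≠ circ x.1 f ∧ circ y.1 e = circ y.1 f then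
      Diagram.mergeCoeff K (x.2 (circ x.1 e)) (x.2 (circ x.1 f)) (y.2 (circ y.1 e))
    else if circ x.1 e = circ x.1 f ∧ circ y.1 e ≠ circ y.1 f then
      Diagram.splitCoeff K (x.2 (circ x.1 e)) (y.2 (circ y.1 e)) (y.2 (circ y.1 f))
    else 0
  else 0

open Classical in
/-- The Khovanov complex as a function of the walk along the edges and of the winding numbers. -/
def GradedComplexData.ofWalk (hd qd : (Fin m → Bool) → ℤ) : GradedComplexData K :=
  letI (S : Fin m → Bool) : Fintype (WalkCircle walk S) := Fintype.ofFinite _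
  letI : Fintype (Σ S, WalkCircle walk S → ℤˣ) := Fintype.ofFinite _
  { basis := Σ S, WalkCircle walk S → ℤˣ
    differential := Finsupp.linearCombination K fun x => ∑ y, Finsupp.single y
      (∑ c, if x.1 c = false ∧ y.1 = Function.update x.1 c true then
        (-1) ^ Nat.card {c' // c' < c ∧ x.1 c' = true} * walkCubeCoeff K walk next c x y else 0)
    hDegree := fun x => hd x.1
    qDegree := fun x => ∑ C, (x.2 C : ℤ) + qd x.1
    gradingAt := fun z x => ∑ C, (x.2 C : ℤ) * |winding z x.1 (Quot.out C)| }

end OfWalk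

namespace Diagram
variable {U V : Set ℂ} (h : U ⊆ V) {L : Link U} (D : Diagram L) (K : Type u) [Field K]

/-- The Khovanov complex with its gradings. -/
def gradedComplexData : GradedComplexData K :=
  ⟨D.State, D.differential K, D.hDegree, D.qDegree, D.gradingAt⟩

lemma cubeCoeff_eq_walkCubeCoeff (c : Fin D.crossings) (x y : D.State) :
    D.cubeCoeff K c x y = walkCubeCoeff K D.walk D.next c x y := by
  unfold cubeCoeff walkCubeCoeff label circleOf
  dsimp only
  congr!

/-- The states of a diagram and of its inclusion in a larger surface form types built from two walks
whose equality is proved case by case. Once all data are a function of the walk and the winding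
numbers, rewriting these identifies the complexes without casts. -/
lemma gradedComplexData_eq_ofWalk :
    D.gradedComplexData K = GradedComplexData.ofWalk K D.walk D.winding D.next
      (fun S => D.weight S - D.nNeg) (fun S => D.weight S - D.nNeg + D.writhe) := by
  have h1 : D.differential K = (GradedComplexData.ofWalk K D.walk D.winding D.next
      (fun S => D.weight S - D.nNeg) (fun S => D.weight S - D.nNeg + D.writhe)).differential := by
    unfold differential diffCoeff GradedComplexData.ofWalk
    simp only [cubeCoeff_eq_walkCubeCoeff]
    congr!
  unfold gradedComplexData
  rw [h1]
  rfl

lemma inclusion_walk : (D.inclusion h).walk = D.walk := by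
  funext S e
  match e with
  | (Sum.inl _, true) => rfl
  | (Sum.inl _, false) => rfl
  | (Sum.inr _, _) => rfl

lemma inclusion_edgeIntegral : (D.inclusion h).edgeIntegral = D.edgeIntegral := by
  funext z e
  match e with
  | Sum.inl _ => rfl
  | Sum.inr _ => rfl

lemma inclusion_winding : (D.inclusion h).winding = D.winding := by
  funext z S e
  unfold winding
  rw [inclusion_walk, inclusion_edgeIntegral]
  rfl

lemma inclusion_gradedComplexData :
    (D.inclusion h).gradedComplexData K = D.gradedComplexData K := by
  rw [gradedComplexData_eq_ofWalk, gradedComplexData_eq_ofWalk]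
  exact congrArg₂ (fun w v => GradedComplexData.ofWalk K w v D.next
    (fun S => D.weight S - D.nNeg) (fun S => D.weight S - D.nNeg + D.writhe))
    (D.inclusion_walk h) (D.inclusion_winding h)
end Diagram

/-! ### A second filtration on the associated graded complex of a first one -/

section Flattening

variable {K : Type u} [Field K]

lemma gradedPart_gradedPart_eq {ι : Type} {P Q R : Type*} {d : (ι →₀ K) →ₗ[K] (ι →₀ K)}
    {g : ι → P} {f : ι → Q} {k : ι → R}
    (h : ∀ x y, d (Finsupp.single x 1) y ≠ 0 → ((g y = g x ∧ f y = f x) ↔ k y = k x)) :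
    gradedPart (gradedPart d g) f = gradedPart d k := by
  classical
  refine Finsupp.lhom_ext' fun x => LinearMap.ext_ring (Finsupp.ext fun y => ?_)
  simp only [LinearMap.comp_apply, Finsupp.lsingle_apply, gradedPart_single, gradedProj_apply]
  by_cases hxy : d (Finsupp.single x 1) y = 0
  · simp [hxy]
  · have := h x y hxy
    by_cases h1 : k y = k x
    · simp [h1, this.mpr h1]
    · rw [if_neg h1]
      split_ifs with h2 h3
      · exact absurd (this.mp ⟨h3, h2⟩) h1
      · rfl
      · rfl

/-- The degree preserving part of the differential of a filtered complex, with another filtration. -/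
lemma isFilteredComplex_gradedPart {ι : Type} {d : (ι →₀ K) →ₗ[K] (ι →₀ K)} {P Q : Type*}
    [PartialOrder P] [PartialOrder Q] {g : ι → P} {f : ι → Q} {T : ℤ → ℤ → Set ι}
    (hg : IsFilteredComplex d (fun h q => Finsupp.supported K K (T h q)) (gradedFiltration K g))
    (hf : ∀ a, gradedFiltration K f a ≤ (gradedFiltration K f a).comap d) :
    IsFilteredComplex (gradedPart d g) (fun h q => Finsupp.supported K K (T h q))
      (gradedFiltration K f) where
  sq_zero := gradedPart_gradedPart_apply hg.filtered hg.sq_zero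
  degree h q := gradedPart_mem_supported g (hg.degree h q)
  monotone _ _ hab := Finsupp.supported_mono fun _ hx => le_trans hx hab
  filtered a := gradedPart_mem_supported g (hf a)

lemma exists_bound {ι : Type} [Finite ι] (f : ι → ℤ) : ∃ B : ℤ, 0 ≤ B ∧ ∀ x, |f x| ≤ B := by
  obtain ⟨B, hB⟩ := (Set.finite_range fun x => |f x|).bddAbove
  exact ⟨max B 0, le_max_right _ _, fun x => (hB ⟨x, rfl⟩).trans (le_max_left _ _)⟩

/-- The spectral sequence of a bounded filtered complex converges to its homology. -/
lemma convergesTo_of_surjective {M : Type u} [AddCommGroup M] [Module K M] {d : M →ₗ[K] M}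
    {piece : ℤ → ℤ → Submodule K M} {F : ℤ → Submodule K M} (hF : IsFilteredComplex d piece F)
    {B : ℤ} (hB : 0 ≤ B) (hbot : ∀ a < -B, F a = ⊥) (htop : ∀ a ≥ B, F a = ⊤)
    {H : ℤ → ℤ → Type u} [∀ h q, AddCommGroup (H h q)] [∀ h q, Module K (H h q)]
    {G : ∀ h q, ℤ → Submodule K (H h q)}
    (φ : ∀ h q, ↥(piece h q ⊓ LinearMap.ker d) →ₗ[K] H h q)
    (hφ : ∀ h q x, φ h q x = 0 ↔ x.1 ∈ (piece (h - 1) q).map d)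
    (hsurj : ∀ h q, Function.Surjective (φ h q))
    (hG : ∀ h q a, G h q a = ((F a).submoduleOf (piece h q ⊓ LinearMap.ker d)).map (φ h q)) :
    ConvergesTo (spectralSequence hF) H G := by
  refine ⟨fun h q a b hab => ?_, fun h q => ⟨-B - 1, ?_⟩, fun h q => ⟨B, ?_⟩, 2 * B + 1, by omega,
    fun r hr hBr => ⟨pageComplex_d_eq_zero hF hbot htop hBr, fun a h q =>
      nonempty_pageTerm_equiv hF hbot htop hBr a h q (φ h q) (hφ h q) (hG h q)⟩⟩
  · rw [hG, hG]
    exact Submodule.map_mono (Submodule.comap_mono (hF.monotone hab))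
  · rw [hG, hbot _ (by omega), Submodule.submoduleOf, Submodule.comap_bot, Submodule.ker_subtype,
      Submodule.map_bot]
  · rw [hG, htop _ le_rfl, Submodule.submoduleOf, Submodule.comap_top, Submodule.map_top,
      LinearMap.range_eq_top]
    exact hsurj h q

/-- The classes in the homology of `gr_a` which are represented by a cycle in the image of `N`. -/
def grHomologySub {M : Type u} [AddCommGroup M] [Module K M] {P : Type*} [PartialOrder P]
    {d : M →ₗ[K] M} {piece : ℤ → ℤ → Submodule K M} {F : P → Submodule K M}
    (hF : IsFilteredComplex d piece F) (h q : ℤ) (a : P) (N : Submodule K M) :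
    Submodule K (GrHomology hF h q a) :=
  homologySub (grMap F d hF.filtered a) (grSub F a (piece (h - 1) q)) (grSub F a (piece h q))
    (grSub F a N)

/-- The spectral sequence of a second filtration on the associated graded complex of a first one
converges to the homology of the associated graded complex. -/
lemma convergesTo_spectralSequence {ι : Type} [Finite ι] {d : (ι →₀ K) →ₗ[K] (ι →₀ K)}
    {g f : ι → ℤ} {T : ℤ → ℤ → Set ι}
    (hg : IsFilteredComplex d (fun h q => Finsupp.supported K K (T h q)) (gradedFiltration K g))
    (hf : IsFilteredComplex (gradedPart d g) (fun h q => Finsupp.supported K K (T h q))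
      (gradedFiltration K f)) :
    ConvergesTo (spectralSequence hf) (fun h q => ⨁ k : ℤ, GrHomology hg h q k)
      (fun h q a => directSumSub fun k => grHomologySub hg h q k (gradedFiltration K f a)) := by
  obtain ⟨B, hB0, hB⟩ := exists_bound f
  have hbot : ∀ a < -B, gradedFiltration K f a = ⊥ := by
    intro a ha
    refine (Submodule.eq_bot_iff _).mpr fun m hm => Finsupp.ext fun x => ?_
    by_contra hx
    have h1 : f x ≤ a := mem_supported_iff.mp hm x hx
    have h2 := abs_le.mp (hB x)
    omega
  have htop : ∀ a ≥ B, gradedFiltration K f a = ⊤ := fun a ha =>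
    eq_top_iff.mpr fun m _ => mem_supported_iff.mpr fun x _ =>
      (le_abs_self _).trans ((hB x).trans ha)
  have key : ∀ h q, ∃ φ : ↥(Finsupp.supported K K (T h q) ⊓ LinearMap.ker (gradedPart d g)) →ₗ[K]
      (⨁ k : ℤ, GrHomology hg h q k),
      (∀ x, φ x = 0 ↔ x.1 ∈ (Finsupp.supported K K (T (h - 1) q)).map (gradedPart d g)) ∧
      Function.Surjective φ ∧
      ∀ a, (directSumSub fun k => grHomologySub hg h q k (gradedFiltration K f a) :
          Submodule K (⨁ k : ℤ, GrHomology hg h q k)) =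
        ((gradedFiltration K f a).submoduleOf _).map φ := by
    intro h q
    -- The family of degrees is all of `ℤ`, so restricting to its range changes nothing.
    have hset : ∀ S : Set ι, S ∩ {x | g x ∈ Set.range fun k : ℤ => k} = S :=
      fun S => Set.inter_eq_left.mpr fun x _ => ⟨_, rfl⟩
    obtain ⟨Φ, hΦ⟩ := exists_grHomology_equiv (K := K) hg.filtered
      (e := fun k : ℤ => k) Function.injective_id (hset (T (h - 1) q)) (hset (T h q))
    refine ⟨Φ.symm.toLinearMap ∘ₗ Submodule.mkQ _, fun x => ?_,
      Φ.symm.surjective.comp (Submodule.mkQ_surjective _), fun a => ?_⟩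
    · exact Φ.symm.map_eq_zero_iff.trans (Submodule.Quotient.mk_eq_zero _)
    · rw [Submodule.map_comp]
      exact (hΦ {x | f x ≤ a}).trans (Submodule.map_equiv_eq_comap_symm Φ.symm _).symm
  choose φ hφ hsurj hG using key
  exact convergesTo_of_surjective hf hB0 hbot htop φ hφ hsurj hG

end Flattening

/-! ### Flattening the multipunctured grading -/

section FlattenedComplex

variable {K : Type u} [Field K]

/-- The graded piece of homological degree `h` and quantum degree `q`. -/
abbrev GradedComplexData.piece (X : GradedComplexData K) (h q : ℤ) : Submodule K (X.basis →₀ K) :=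
  Finsupp.supported K K {x | X.hDegree x = h ∧ X.qDegree x = q}

/-- The differential has square zero and bidegree `(1, 0)`, and does not increase the gradings
around the points `z i`. -/
structure GradedComplexData.IsFiltered (X : GradedComplexData K) {κ : Type*} (z : κ → ℂ) :
    Prop where
  finite : Finite X.basis
  sq_zero : X.differential ∘ₗ X.differential = 0
  hDegree : ∀ x y, X.differential (Finsupp.single x 1) y ≠ 0 → X.hDegree y = X.hDegree x + 1
  qDegree : ∀ x y, X.differential (Finsupp.single x 1) y ≠ 0 → X.qDegree y = X.qDegree x
  gradingAt : ∀ x y, X.differential (Finsupp.single x 1) y ≠ 0 →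
    ∀ i, X.gradingAt (z i) y ≤ X.gradingAt (z i) x

lemma supported_le_comap_of_forall {ι : Type} {d : (ι →₀ K) →ₗ[K] (ι →₀ K)} {S T : Set ι}
    (h : ∀ x y, x ∈ S → d (Finsupp.single x 1) y ≠ 0 → y ∈ T) :
    Finsupp.supported K K S ≤ (Finsupp.supported K K T).comap d :=
  supported_le_iff.mpr fun x hx => mem_supported_iff.mpr fun y hy => h x y hx hy

namespace GradedComplexData.IsFiltered

variable {X : GradedComplexData K} {n : ℕ} {z : Fin n → ℂ}

lemma isFilteredComplex (hX : X.IsFiltered z) {P : Type*} [PartialOrder P] {g : X.basis → P}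
    (hg : ∀ x y, X.differential (Finsupp.single x 1) y ≠ 0 → g y ≤ g x) :
    IsFilteredComplex X.differential X.piece (gradedFiltration K g) where
  sq_zero := hX.sq_zero
  degree h q := supported_le_comap_of_forall fun x y hx hxy =>
    ⟨by rw [hX.hDegree x y hxy, hx.1], by rw [hX.qDegree x y hxy, hx.2]⟩
  monotone _ _ hab := Finsupp.supported_mono fun _ hx => le_trans hx hab
  filtered a := supported_le_comap_of_forall fun x y hx hxy => (hg x y hxy).trans hx

lemma multi (hX : X.IsFiltered z) : IsFilteredComplex X.differential X.piece
    (gradedFiltration K fun x i => X.gradingAt (z i) x) :=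
  hX.isFilteredComplex fun x y h i => hX.gradingAt x y h i

lemma annular (hX : X.IsFiltered z) (p : Fin n) : IsFilteredComplex X.differential X.piece
    (gradedFiltration K (X.gradingAt (z p))) :=
  hX.isFilteredComplex fun x y h => hX.gradingAt x y h p

lemma flat (hX : X.IsFiltered z) (p : Fin n) :
    IsFilteredComplex (gradedPart X.differential (X.gradingAt (z p))) X.piece
      (gradedFiltration K fun x => ∑ i, X.gradingAt (z i) x) :=
  isFilteredComplex_gradedPart (hX.annular p) (hX.isFilteredComplex fun x y h =>
    Finset.sum_le_sum fun i _ => hX.gradingAt x y h i).filtered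

/-- The degree preserving part, for the flattened grading, of the annular differential is the degree
preserving part of the differential for the multipunctured grading. -/
lemma gradedPart_flat (hX : X.IsFiltered z) (p : Fin n) :
    gradedPart (gradedPart X.differential (X.gradingAt (z p))) (fun x => ∑ i, X.gradingAt (z i) x) =
      gradedPart X.differential fun x i => X.gradingAt (z i) x := by
  refine gradedPart_gradedPart_eq fun x y h => ?_
  refine ⟨fun h1 => funext fun i => ?_, fun h1 => ⟨congrFun h1 p, ?_⟩⟩
  -- No coordinate increases under the differential, so equal sums force every coordinate to be
  -- equal.
  · exact (Finset.sum_eq_sum_iff_of_le fun i _ => hX.gradingAt x y h i).mp h1.2 i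
      (Finset.mem_univ i)
  · exact congrArg (fun v => ∑ i, v i) h1

/-- The page is formed from the complex in the annulus, `X'`, and the multipunctured homology from
the complex in the punctured disk, `X`. Keeping `e` as a hypothesis allows the two to be identified
by substitution. -/
lemma nonempty_firstPage_equiv {X' : GradedComplexData K} (e : X' = X) (hX : X.IsFiltered z)
    (p : Fin n) (a h q : ℤ) :
    Nonempty (PageTerm (gradedPart X'.differential (X'.gradingAt (z p))) X'.piece
      (gradedFiltration K fun x => ∑ i, X'.gradingAt (z i) x) 1 (a, h, q) ≃ₗ[K]
      ⨁ v : {v : Fin n → ℤ // ∑ i, v i = a}, GrHomology hX.multi h q v.1) := by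
  subst e
  have := hX.finite
  have hset : ∀ S : Set X'.basis, S ∩ {x | (fun i => X'.gradingAt (z i) x) ∈
      Set.range fun v : {v : Fin n → ℤ // ∑ i, v i = a} => v.1} =
      S ∩ {x | ∑ i, X'.gradingAt (z i) x = a} := by
    intro S
    congr 1
    ext x
    exact ⟨fun ⟨v, hv⟩ => (congrArg (fun v : Fin n → ℤ => ∑ i, v i) hv.symm).trans v.2,
      fun hx => ⟨⟨_, hx⟩, rfl⟩⟩
  obtain ⟨Φ, -⟩ := exists_grHomology_equiv (K := K) hX.multi.filtered
    (e := fun v : {v : Fin n → ℤ // ∑ i, v i = a} => v.1) Subtype.val_injective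
    (hset {x | X'.hDegree x = h - 1 ∧ X'.qDegree x = q})
    (hset {x | X'.hDegree x = h ∧ X'.qDegree x = q})
  -- The homology of the multigraded part becomes that of the flat part of the annular differential,
  -- which is the first page.
  rw [← hX.gradedPart_flat p] at Φ
  exact ⟨(firstPageEquiv (hX.flat p) a h q).trans Φ.symm⟩

end GradedComplexData.IsFiltered

lemma Diagram.gradedComplexData_isFiltered {U : Set ℂ} {L : Link U} (D : Diagram L) {n : ℕ}
    {z : Fin n → ℂ} (hz : ∀ i, z i ∉ U) : (D.gradedComplexData K).IsFiltered z := by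
  have hd : ∀ x y, D.differential K (Finsupp.single x 1) y ≠ 0 → D.diffCoeff K x y ≠ 0 := by
    classical
    intro x y h
    rw [differential_single, Finsupp.finsetSum_apply] at h
    simpa [Finsupp.single_apply] using h
  exact ⟨inferInstanceAs (Finite D.State), D.differential_comp_self K,
    fun x y h => D.hDegree_of_diffCoeff_ne_zero K (hd x y h),
    fun x y h => D.qDegree_of_diffCoeff_ne_zero K (hd x y h),
    fun x y h i => D.gradingAt_le_of_diffCoeff_ne_zero K (hz i) (hd x y h)⟩

end FlattenedComplex

end PuncturedKhovanov

end

open PuncturedKhovanov in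
theorem theorem4 {K : Type u} [Field K] {n : ℕ} (hn : 1 < n) (P : PuncturedDisk n)
    (L : Link P.carrier) (D : Diagram L) (p : Fin n) :
    ∃ (hD : IsMultiFiltered K D)
      (hA : IsAnnularFiltered K (D.inclusion (P.carrier_subset_annulus p)))
      (E : TrigradedSpectralSequence K),
      (∀ a h q : ℤ, Nonempty ((E.page 1 le_rfl).X (a, h, q) ≃ₗ[K] FlatMKh K D hD a h q)) ∧
      ConvergesTo E (AKh K (D.inclusion (P.carrier_subset_annulus p)) hA)
        (flatFiltrationAKh K P (D.inclusion (P.carrier_subset_annulus p)) hA) := by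
  have hX : (D.gradedComplexData K).IsFiltered P.puncture :=
    D.gradedComplexData_isFiltered fun i hi => hi.2 ⟨i, rfl⟩
  have e := D.inclusion_gradedComplexData (P.carrier_subset_annulus p) K
  have hX' := e ▸ hX
  have := hX'.finite
  -- The complex behind the spectral sequence is the Khovanov module with the part of the
  -- differential preserving the annular grading, filtered by the flattened grading.
  exact ⟨hX.multi, hX'.annular p, spectralSequence (hX'.flat p),
    fun a h q => GradedComplexData.IsFiltered.nonempty_firstPage_equiv e hX p a h q,
    convergesTo_spectralSequence (hX'.annular p) (hX'.flat p)⟩
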